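/- Let $k$ be a commutative ring. A (small) dg category $\mathcal C$ over $k$ is *semifree* if it has a set of generating morphisms: a family $\{f_i\}$ of homogeneous morphisms indexed by a well-ordered set whose composable words (including the identities) form a $k$-basis of the morphisms of $\mathcal C$, and such that $df_i$ is generated by $\{f_j \mid j<i\}$. A dg functor $F\colon\mathcal C\to\mathcal D$ is a *semifree extension* by a set of objects $R$ and a family of morphisms $\{f_i\}$ if it is injective on objects and morphisms, $\mathrm{Ob}\,\mathcal D=F(\mathrm{Ob}\,\mathcal C)\sqcup R$, the graded category $\mathcal D$ is freely generated over $F(\mathcal C)$ by $\{f_i\}$, and, for some well-ordering of the index set, $df_i$ is generated by $F(\mathcal C)$ and $\{f_j\mid j<i\}$. Let $\mathrm{dgCat}$ be the category of small dg categories over $k$ and $\mathrm{dgCat}_s$ its full subcategory of semifree dg categories. Consider on $\mathrm{dgCat}$ the Dwyer–Kan, quasi-equiconic and Morita model structures. In all of them the cofibrations are the retracts of semifree extensions; the weak equivalences are, respectively, the quasi-equivalences, the dg functors $F$ for which $\mathrm{Tw}\,F$ (on one-sided twisted complexes) is a quasi-equivalence, and those for which $\mathrm{Perf}\,F$ (on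 the split-closure of $\mathrm{Tw}$) is a quasi-equivalence; the fibrations are the dg functors with the right lifting property with respect to the cofibrations that are weak equivalences. The differential satisfies $d(gf)=dg\,f+(-1)^{|g|}g\,df$. For $\mathcal C\in\mathrm{dgCat}_s$ choose a set of generating morphisms. Let $\mathrm{Cyl}(\mathcal C)$ be the semifree extension of $\mathcal C\sqcup\mathcal C$, with inclusions $i_1,i_2$ of the two copies of $\mathcal C$, by no new objects and the following morphisms. For each object $A$ of $\mathcal C$: $$t_A\colon i_1A\to i_2A,\quad t'_A\colon i_2A\to i_1A,\quad \hat t_A\colon i_1A\to i_1A,\quad \check t_A\colon i_2A\to i_2A,\quad \bar t_A\colon i_1A\to i_2A$$ of degrees $0,0,-1,-1,-2$, with $$dt_A=dt'_A=0,\quad d\hat t_A=1-t'_At_A,\quad d\check t_A=1-t_At'_A,\quad d\bar t_A=t_A\hat t_A-\check t_At_A .$$ For each generating morphism $f\colon A\to B$, a morphism $t_f\colon i_1A\to i_2B$ of degree $|f|-1$ with $$dt_f=(-1)^{|f|}\bigl(i_2(f)\,t_A-t_B\,i_1(f)\bigr)+t_{df}.$$ Here $t_\theta$, for an arbitrary morphism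 $\theta$ of $\mathcal C$, is determined by linearity in $\theta$, $t_{1_A}=0$, and, for generating morphisms $f_1,\dots,f_n$, $$t_{f_n\cdots f_1}=\sum_{j=1}^n(-1)^{|f_{j-1}|+\dots+|f_1|}\,i_2(f_n)\cdots i_2(f_{j+1})\,t_{f_j}\,i_1(f_{j-1})\cdots i_1(f_1).$$ Then such a dg category $\mathrm{Cyl}(\mathcal C)$ exists, for every semifree $\mathcal C$ and every choice of generating morphisms. Moreover, for every choice of generating morphisms and of $\mathrm{Cyl}(\mathcal C)$ for all $\mathcal C\in\mathrm{dgCat}_s$: 1. $\mathrm{Cyl}(\mathcal C)$ is semifree. 2. For every dg functor $F\colon\mathcal C\to\mathcal D$ between semifree dg categories there is exactly one dg functor $\mathrm{Cyl}(F)\colon\mathrm{Cyl}(\mathcal C)\to\mathrm{Cyl}(\mathcal D)$ that extends $F\sqcup F$ and satisfies $$t_A,t'_A,\hat t_A,\check t_A,\bar t_A\mapsto t_{FA},t'_{FA},\hat t_{FA},\check t_{FA},\bar t_{FA},\qquad t_f\mapsto t_{F(f)}$$ for all objects $A$ and generating morphisms $f$ of $\mathcal C$. There is exactly one dg functor $p_{\mathcal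 C}\colon\mathrm{Cyl}(\mathcal C)\to\mathcal C$ that restricts to the identity on both copies of $\mathcal C$ and satisfies $t_A,t'_A\mapsto 1_A$ and $\hat t_A,\check t_A,\bar t_A,t_f\mapsto 0$. 3. $\mathcal C\mapsto\mathrm{Cyl}(\mathcal C)$, $F\mapsto\mathrm{Cyl}(F)$ is a functor $\mathrm{dgCat}_s\to\mathrm{dgCat}_s$. 4. This functor is a cylinder functor for each of the three model structures. That is, for every $\mathcal C\in\mathrm{dgCat}_s$ the map $i_1\sqcup i_2\colon\mathcal C\sqcup\mathcal C\to\mathrm{Cyl}(\mathcal C)$ is a cofibration (indeed a semifree extension), $p_{\mathcal C}$ is a fibration and a weak equivalence, and $p_{\mathcal C}\circ(i_1\sqcup i_2)$ is the codiagonal; and for every $F\colon\mathcal C\to\mathcal D$ in $\mathrm{dgCat}_s$, $$\mathrm{Cyl}(F)\circ(i_1\sqcup i_2)=(i_1\sqcup i_2)\circ(F\sqcup F),\qquad p_{\mathcal D}\circ\mathrm{Cyl}(F)=F\circ p_{\mathcal C}.$$ -/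

import Mathlib

open CategoryTheory

set_option linter.checkUnivs false

universe w v w' v' w'' v'' u

/-- The Koszul sign `(-1)^n` as an element of the ground ring. -/
def koszul (k : Type u) [CommRing k] (n : ℤ) : k := (((Int.negOnePow n : ℤˣ) : ℤ) : k)

lemma koszul_add (k : Type u) [CommRing k] (m n : ℤ) :
    koszul k (m + n) = koszul k m * koszul k n := by
  simp [koszul, Int.negOnePow_add]

lemma koszul_sub (k : Type u) [CommRing k] (m n : ℤ) :
    koszul k (m - n) = koszul k m * koszul k n := by
  simp [koszul, Int.negOnePow_sub]

lemma koszul_one (k : Type u) [CommRing k] : koszul k 1 = -1 := by simp [koszul]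

lemma koszul_zero (k : Type u) [CommRing k] : koszul k 0 = 1 := by simp [koszul]

lemma koszul_mul_self (k : Type u) [CommRing k] (n : ℤ) : koszul k n * koszul k n = 1 := by
  rw [← koszul_add]
  simp [koszul, ← two_mul]

/-- A `k`-linear `ℤ`-graded category. `comp h g f` is the composition `g ∘ f`; the composite of
morphisms of degrees `q` and `p` is placed in any degree `n` equipped with a proof of `q + p = n`. -/
structure GrCat (k : Type u) [CommRing k] where
  Obj : Type w
  Hom : Obj → Obj → ℤ → Type v
  [addCommGroup : ∀ A B n, AddCommGroup (Hom A B n)]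
  [module : ∀ A B n, Module k (Hom A B n)]
  id : ∀ A, Hom A A 0
  comp : ∀ {A B C : Obj} {q p n : ℤ}, q + p = n → (Hom B C q →ₗ[k] Hom A B p →ₗ[k] Hom A C n)
  id_comp : ∀ {A B : Obj} {p : ℤ} (h : 0 + p = p) (f : Hom A B p), comp h (id B) f = f
  comp_id : ∀ {A B : Obj} {p : ℤ} (h : p + 0 = p) (f : Hom A B p), comp h f (id A) = f
  assoc : ∀ {A B C D : Obj} {r q p rq qp n : ℤ} (h₁ : r + q = rq) (h₂ : q + p = qp)
    (h₃ : rq + p = n) (h₄ : r + qp = n) (h : Hom C D r) (g : Hom B C q) (f : Hom A B p),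
    comp h₃ (comp h₁ h g) f = comp h₄ h (comp h₂ g f)

attribute [instance] GrCat.addCommGroup GrCat.module

namespace GrCat

variable {k : Type u} [CommRing k]

/-- The type of all homogeneous morphisms of a graded category. Equality of two elements means
equality of sources, targets, degrees and morphisms. -/
def Mor (C : GrCat.{w, v} k) : Type (max w v) := Σ (A B : C.Obj) (n : ℤ), C.Hom A B n

/-- A morphism, regarded as an element of `C.Mor`. -/
def mor (C : GrCat.{w, v} k) {A B : C.Obj} {n : ℤ} (f : C.Hom A B n) : C.Mor := ⟨A, B, n, f⟩

/-- The identity of `A`, placed in a degree that is provably `0`. -/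
def idAt (C : GrCat.{w, v} k) (A : C.Obj) {n : ℤ} (h : n = 0) : C.Hom A A n :=
  cast (congrArg (C.Hom A A) h.symm) (C.id A)

lemma idAt_comp (C : GrCat.{w, v} k) {A B : C.Obj} {n p : ℤ} (h : n = 0) (h' : n + p = p)
    (f : C.Hom A B p) : C.comp h' (C.idAt B h) f = f := by
  subst h
  exact C.id_comp _ f

lemma comp_idAt (C : GrCat.{w, v} k) {A B : C.Obj} {n p : ℤ} (h : n = 0) (h' : p + n = p)
    (f : C.Hom A B p) : C.comp h' f (C.idAt A h) = f := by
  subst h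
  exact C.comp_id _ f

/-- `Generated S f`: the morphism `f` lies in the smallest `k`-linear graded subcategory
(with all objects) that contains the homogeneous morphisms in `S`. -/
inductive Generated (C : GrCat.{w, v} k) (S : Set C.Mor) :
    ∀ {A B : C.Obj} {n : ℤ}, C.Hom A B n → Prop
  | of {A B : C.Obj} {n : ℤ} (f : C.Hom A B n) : C.mor f ∈ S → Generated C S f
  | id (A : C.Obj) : Generated C S (C.id A)
  | zero (A B : C.Obj) (n : ℤ) : Generated C S (0 : C.Hom A B n)
  | add {A B : C.Obj} {n : ℤ} (f g : C.Hom A B n) :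
      Generated C S f → Generated C S g → Generated C S (f + g)
  | smul {A B : C.Obj} {n : ℤ} (c : k) (f : C.Hom A B n) : Generated C S f → Generated C S (c • f)
  | comp {A B D : C.Obj} {q p n : ℤ} (h : q + p = n) (g : C.Hom B D q) (f : C.Hom A B p) :
      Generated C S g → Generated C S f → Generated C S (C.comp h g f)

/-- A functor of graded categories with prescribed map `o` on objects. -/
structure FunctorOver (C : GrCat.{w, v} k) (D : GrCat.{w', v'} k) (o : C.Obj → D.Obj) where
  map : ∀ {A B : C.Obj} {n : ℤ}, C.Hom A B n →ₗ[k] D.Hom (o A) (o B) n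
  map_id : ∀ A, map (C.id A) = D.id (o A)
  map_comp : ∀ {A B E : C.Obj} {q p n : ℤ} (h : q + p = n) (g : C.Hom B E q) (f : C.Hom A B p),
    map (C.comp h g f) = D.comp h (map g) (map f)

lemma FunctorOver.map_idAt {C : GrCat.{w, v} k} {D : GrCat.{w', v'} k} {o : C.Obj → D.Obj}
    (F : FunctorOver C D o) (A : C.Obj) {n : ℤ} (h : n = 0) :
    F.map (C.idAt A h) = D.idAt (o A) h := by
  subst h
  exact F.map_id A

end GrCat

/-- A dg category over `k`: a graded category whose morphism spaces are cochain complexes, with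
`d (g ∘ f) = dg ∘ f + (-1)^|g| g ∘ df`. -/
structure DGCat (k : Type u) [CommRing k] extends GrCat.{w, v} k where
  d : ∀ {A B : Obj} {m n : ℤ}, m + 1 = n → (Hom A B m →ₗ[k] Hom A B n)
  d_d : ∀ {A B : Obj} {l m n : ℤ} (h : l + 1 = m) (h' : m + 1 = n) (f : Hom A B l),
    d h' (d h f) = 0
  leibniz : ∀ {A B C : Obj} {q p n q' p' n' : ℤ} (h : q + p = n) (hq : q + 1 = q')
    (hp : p + 1 = p') (hn : n + 1 = n') (h₁ : q' + p = n') (h₂ : q + p' = n')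
    (g : Hom B C q) (f : Hom A B p),
    d hn (comp h g f) = comp h₁ (d hq g) f + koszul k q • comp h₂ g (d hp f)

/-- A dg functor. -/
structure DGFunctor {k : Type u} [CommRing k] (C : DGCat.{w, v} k) (D : DGCat.{w', v'} k) where
  obj : C.Obj → D.Obj
  toGr : GrCat.FunctorOver C.toGrCat D.toGrCat obj
  map_d : ∀ {A B : C.Obj} {m n : ℤ} (h : m + 1 = n) (f : C.Hom A B m),
    toGr.map (C.d h f) = D.d h (toGr.map f)

namespace DGFunctor

variable {k : Type u} [CommRing k]

/-- The action of a dg functor on morphisms. -/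
abbrev map {C : DGCat.{w, v} k} {D : DGCat.{w', v'} k} (F : DGFunctor C D) {A B : C.Obj} {n : ℤ}
    (f : C.Hom A B n) : D.Hom (F.obj A) (F.obj B) n := F.toGr.map f

def id (C : DGCat.{w, v} k) : DGFunctor C C where
  obj A := A
  toGr := { map := LinearMap.id, map_id := fun _ => rfl, map_comp := fun _ _ _ => rfl }
  map_d _ _ := rfl

/-- `comp F G` is `G ∘ F`. -/
def comp {C : DGCat.{w, v} k} {D : DGCat.{w', v'} k} {E : DGCat.{w'', v''} k}
    (F : DGFunctor C D) (G : DGFunctor D E) : DGFunctor C E where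
  obj A := G.obj (F.obj A)
  toGr :=
    { map := G.toGr.map ∘ₗ F.toGr.map
      map_id := fun A => by simp [F.toGr.map_id, G.toGr.map_id]
      map_comp := fun h g f => by simp [F.toGr.map_comp, G.toGr.map_comp] }
  map_d h f := by simp [F.map_d, G.map_d]

end DGFunctor

namespace DGCat

variable {k : Type u} [CommRing k]

/-- The category of dg categories and dg functors. -/
instance : Category (DGCat.{w, v} k) where
  Hom C D := DGFunctor C D
  id C := DGFunctor.id C
  comp F G := DGFunctor.comp F G

lemma d_id (C : DGCat.{w, v} k) (A : C.Obj) {n : ℤ} (h : 0 + 1 = n) : C.d h (C.id A) = 0 := by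
  subst h
  have := C.leibniz (A := A) (add_zero 0) rfl rfl rfl (by norm_num) (by norm_num) (C.id A) (C.id A)
  simpa [C.id_comp, C.comp_id, koszul_zero] using this

lemma d_idAt (C : DGCat.{w, v} k) (A : C.Obj) {m n : ℤ} (h : m = 0) (h' : m + 1 = n) :
    C.d h' (C.idAt A h) = 0 := by
  subst h
  exact C.d_id A h'

/-! ### Coproducts -/

lemma zero_add_smul_zero {M : Type v} [AddCommGroup M] [Module k M] (c : k) :
    (0 : M) = 0 + c • (0 : M) := by simp

section Coprod

variable (C D : DGCat.{w, v} k)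

/-- Morphisms of `C ⊔ D`: those of `C`, those of `D`, and only zero between the two parts. -/
def CoprodHom : C.Obj ⊕ D.Obj → C.Obj ⊕ D.Obj → ℤ → Type v
  | .inl A, .inl B, n => C.Hom A B n
  | .inr A, .inr B, n => D.Hom A B n
  | .inl _, .inr _, _ => PUnit
  | .inr _, .inl _, _ => PUnit

instance coprodAddCommGroup : ∀ A B n, AddCommGroup (CoprodHom C D A B n)
  | .inl A, .inl B, n => inferInstanceAs (AddCommGroup (C.Hom A B n))
  | .inr A, .inr B, n => inferInstanceAs (AddCommGroup (D.Hom A B n))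
  | .inl _, .inr _, _ => inferInstanceAs (AddCommGroup PUnit)
  | .inr _, .inl _, _ => inferInstanceAs (AddCommGroup PUnit)

instance coprodModule : ∀ A B n, Module k (CoprodHom C D A B n)
  | .inl A, .inl B, n => inferInstanceAs (Module k (C.Hom A B n))
  | .inr A, .inr B, n => inferInstanceAs (Module k (D.Hom A B n))
  | .inl _, .inr _, _ =>
    { smul := fun _ x => x, one_smul := fun _ => rfl, mul_smul := fun _ _ _ => rfl,
      smul_zero := fun _ => rfl, smul_add := fun _ _ _ => rfl, add_smul := fun _ _ _ => rfl,
      zero_smul := fun _ => rfl }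
  | .inr _, .inl _, _ =>
    { smul := fun _ x => x, one_smul := fun _ => rfl, mul_smul := fun _ _ _ => rfl,
      smul_zero := fun _ => rfl, smul_add := fun _ _ _ => rfl, add_smul := fun _ _ _ => rfl,
      zero_smul := fun _ => rfl }

/-- Composition in `C ⊔ D`. -/
def coprodComp : ∀ (A B E : C.Obj ⊕ D.Obj) {q p n : ℤ}, q + p = n →
    (CoprodHom C D B E q →ₗ[k] CoprodHom C D A B p →ₗ[k] CoprodHom C D A E n)
  | .inl _, .inl _, .inl _, _, _, _, h => C.comp h
  | .inr _, .inr _, .inr _, _, _, _, h => D.comp h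
  | .inl _, .inl _, .inr _, _, _, _, _ => 0
  | .inl _, .inr _, .inl _, _, _, _, _ => 0
  | .inl _, .inr _, .inr _, _, _, _, _ => 0
  | .inr _, .inl _, .inl _, _, _, _, _ => 0
  | .inr _, .inl _, .inr _, _, _, _, _ => 0
  | .inr _, .inr _, .inl _, _, _, _, _ => 0

/-- The differential of `C ⊔ D`. -/
def coprodD : ∀ (A B : C.Obj ⊕ D.Obj) {m n : ℤ}, m + 1 = n →
    (CoprodHom C D A B m →ₗ[k] CoprodHom C D A B n)
  | .inl _, .inl _, _, _, h => C.d h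
  | .inr _, .inr _, _, _, h => D.d h
  | .inl _, .inr _, _, _, _ => 0
  | .inr _, .inl _, _, _, _ => 0

/-- Identities of `C ⊔ D`. -/
def coprodId : ∀ A : C.Obj ⊕ D.Obj, CoprodHom C D A A 0
  | .inl A => C.id A
  | .inr A => D.id A

/-- The coproduct `C ⊔ D` of dg categories: the disjoint union. -/
def coprod : DGCat.{w, v} k where
  Obj := C.Obj ⊕ D.Obj
  Hom := CoprodHom C D
  id := coprodId C D
  comp := coprodComp C D _ _ _
  d := coprodD C D _ _
  id_comp {A B p} h f := by
    rcases A with A | A <;> rcases B with B | B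
    exacts [C.id_comp h f, rfl, rfl, D.id_comp h f]
  comp_id {A B p} h f := by
    rcases A with A | A <;> rcases B with B | B
    exacts [C.comp_id h f, rfl, rfl, D.comp_id h f]
  assoc {A B E G r q p rq qp n} h₁ h₂ h₃ h₄ h g f := by
    rcases A with A | A <;> rcases B with B | B <;> rcases E with E | E <;> rcases G with G | G <;>
      first
        | exact C.assoc h₁ h₂ h₃ h₄ h g f
        | exact D.assoc h₁ h₂ h₃ h₄ h g f
        | rfl
        | exact LinearMap.map_zero₂ (C.comp h₃) f
        | exact LinearMap.map_zero₂ (D.comp h₃) f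
        | exact (LinearMap.map_zero (C.comp h₄ h)).symm
        | exact (LinearMap.map_zero (D.comp h₄ h)).symm
  d_d {A B l m n} h h' f := by
    rcases A with A | A <;> rcases B with B | B
    exacts [C.d_d h h' f, rfl, rfl, D.d_d h h' f]
  leibniz {A B E q p n q' p' n'} h hq hp hn h₁ h₂ g f := by
    rcases A with A | A <;> rcases B with B | B <;> rcases E with E | E <;>
      first
        | exact C.leibniz h hq hp hn h₁ h₂ g f
        | exact D.leibniz h hq hp hn h₁ h₂ g f
        | rfl
        | exact (LinearMap.map_zero (C.d hn)).trans (zero_add_smul_zero _)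
        | exact (LinearMap.map_zero (D.d hn)).trans (zero_add_smul_zero _)

/-- The inclusion `C ⟶ C ⊔ D`. -/
def inl : C ⟶ coprod C D where
  obj A := Sum.inl A
  toGr := { map := LinearMap.id, map_id := fun _ => rfl, map_comp := fun _ _ _ => rfl }
  map_d _ _ := rfl

/-- The inclusion `D ⟶ C ⊔ D`. -/
def inr : D ⟶ coprod C D where
  obj A := Sum.inr A
  toGr := { map := LinearMap.id, map_id := fun _ => rfl, map_comp := fun _ _ _ => rfl }
  map_d _ _ := rfl

variable {C D}

/-- The action on morphisms of the dg functor `C ⊔ D ⟶ E` with components `F` and `G`. -/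
def descMap {E : DGCat.{w, v} k} (F : C ⟶ E) (G : D ⟶ E) : ∀ (A B : C.Obj ⊕ D.Obj) (n : ℤ),
    CoprodHom C D A B n →ₗ[k] E.Hom (Sum.elim F.obj G.obj A) (Sum.elim F.obj G.obj B) n
  | .inl _, .inl _, _ => F.toGr.map
  | .inr _, .inr _, _ => G.toGr.map
  | .inl _, .inr _, _ => 0
  | .inr _, .inl _, _ => 0

/-- The dg functor `F ⊔ G : C ⊔ D ⟶ E` with components `F` and `G`. -/
def desc {E : DGCat.{w, v} k} (F : C ⟶ E) (G : D ⟶ E) : coprod C D ⟶ E where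
  obj := Sum.elim F.obj G.obj
  toGr :=
    { map := descMap F G _ _ _
      map_id := by
        rintro (A | A)
        exacts [F.toGr.map_id A, G.toGr.map_id A]
      map_comp := by
        rintro (A | A) (B | B) (X | X) q p n h g f <;>
          first
            | exact F.toGr.map_comp h g f
            | exact G.toGr.map_comp h g f
            | exact (LinearMap.map_zero (E.comp h _)).symm
            | exact (LinearMap.map_zero₂ (E.comp h) _).symm
            | exact F.toGr.map.map_zero.trans (LinearMap.map_zero (E.comp h _)).symm
            | exact G.toGr.map.map_zero.trans (LinearMap.map_zero (E.comp h _)).symm }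
  map_d := by
    rintro (A | A) (B | B) m n h f <;>
      first
        | exact F.map_d h f
        | exact G.map_d h f
        | exact (LinearMap.map_zero (E.d h)).symm

/-- The codiagonal `C ⊔ C ⟶ C`. -/
def codiagonal (C : DGCat.{w, v} k) : coprod C C ⟶ C := desc (𝟙 C) (𝟙 C)

/-- The dg functor `F ⊔ G : C ⊔ D ⟶ C' ⊔ D'`. -/
def coprodMap {C' D' : DGCat.{w, v} k} (F : C ⟶ C') (G : D ⟶ D') : coprod C D ⟶ coprod C' D' :=
  desc (F ≫ inl C' D') (G ≫ inr C' D')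

end Coprod

end DGCat

namespace DGCat

variable {k : Type u} [CommRing k]

/-! ### Quasi-equivalences -/

/-- `u : A ⟶ B` and `v : B ⟶ A` of degree `0` are closed and `v ∘ u` is homotopic to `1_A`. -/
structure IsHomotopyRetraction (C : DGCat.{w, v} k) {A B : C.Obj} (u : C.Hom A B 0)
    (v : C.Hom B A 0) : Prop where
  closed_u : C.d (zero_add 1) u = 0
  closed_v : C.d (zero_add 1) v = 0
  homotopy : ∃ h : C.Hom A A (-1), C.d (neg_add_cancel 1) h = C.comp (zero_add 0) v u - C.id A

/-- `A` and `B` are isomorphic in the homotopy category `H⁰(C)`. -/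
def HomotopyEquivalent (C : DGCat.{w, v} k) (A B : C.Obj) : Prop :=
  ∃ (u : C.Hom A B 0) (v : C.Hom B A 0), C.IsHomotopyRetraction u v ∧ C.IsHomotopyRetraction v u

/-- `A` is a retract (direct summand) of `B` in the homotopy category `H⁰(C)`. -/
def HomotopyRetract (C : DGCat.{w, v} k) (A B : C.Obj) : Prop :=
  ∃ (u : C.Hom A B 0) (v : C.Hom B A 0), C.IsHomotopyRetraction u v

/-- A dg functor is a quasi-equivalence if it induces isomorphisms on the cohomology of all morphism
complexes and `H⁰(F)` is essentially surjective. -/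
structure _root_.DGFunctor.IsQuasiEquivalence {C : DGCat.{w, v} k} {D : DGCat.{w', v'} k}
    (F : DGFunctor C D) : Prop where
  injective : ∀ (A B : C.Obj) (l m n : ℤ) (hl : l + 1 = m) (hm : m + 1 = n) (f : C.Hom A B m),
    C.d hm f = 0 → (∃ g, D.d hl g = F.map f) → ∃ g, C.d hl g = f
  surjective : ∀ (A B : C.Obj) (l m n : ℤ) (hl : l + 1 = m) (hm : m + 1 = n)
    (f : D.Hom (F.obj A) (F.obj B) m), D.d hm f = 0 →
      ∃ f', C.d hm f' = 0 ∧ ∃ g, D.d hl g = F.map f' - f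
  essSurj : ∀ B : D.Obj, ∃ A : C.Obj, D.HomotopyEquivalent (F.obj A) B

/-! ### Formal sums of shifts of objects -/

/-- A formal direct sum `⨁ i, X i [r i]` of shifts of objects of `C`. -/
structure FormalSum (C : DGCat.{w, v} k) : Type (max w (u + 1)) where
  I : Type u
  X : I → C.Obj
  r : I → ℤ

/-- A degree `n` morphism of formal sums: a matrix, all of whose columns `f i` have only finitely
many nonzero entries. The entry `X i [r i] ⟶ Y j [s j]` is a morphism of `C` of degree
`n + s j - r i`. -/
abbrev FormalSum.Hom {C : DGCat.{w, v} k} (X Y : C.FormalSum) (n : ℤ) : Type (max u v) :=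
  ∀ i : X.I, Π₀ j : Y.I, C.Hom (X.X i) (Y.X j) (n + Y.r j - X.r i)

namespace FormalSum

variable {C : DGCat.{w, v} k}

open Classical in
/-- For a fixed matrix `g : Y ⟶ Z`, the linear map `f ↦ g ∘ f` on columns: its `l`-th entry is
`∑ j, g j l ∘ f j`. -/
noncomputable def compCol {Y Z : C.FormalSum} {q p n : ℤ} (h : q + p = n) (A : C.Obj) (r : ℤ)
    (g : Hom Y Z q) :
    (Π₀ j : Y.I, C.Hom A (Y.X j) (p + Y.r j - r)) →ₗ[k]
      Π₀ l : Z.I, C.Hom A (Z.X l) (n + Z.r l - r) :=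
  DFinsupp.lsum ℕ fun j =>
    { toFun := fun f => DFinsupp.mapRange.linearMap
        (fun l => (C.comp (show (q + Z.r l - Y.r j) + (p + Y.r j - r) = n + Z.r l - r by
          omega)).flip f) (g j)
      map_add' := fun f f' => by ext l; simp
      map_smul' := fun c f => by ext l; simp }

open Classical in
@[simp]
lemma compCol_single {Y Z : C.FormalSum} {q p n : ℤ} (h : q + p = n) (A : C.Obj) (r : ℤ)
    (g : Hom Y Z q) (j : Y.I) (f : C.Hom A (Y.X j) (p + Y.r j - r)) (l : Z.I) :
    compCol h A r g (DFinsupp.single j f) l =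
      C.comp (show (q + Z.r l - Y.r j) + (p + Y.r j - r) = n + Z.r l - r by omega) (g j l) f := by
  simp [compCol]

/-- Composition of matrices. -/
noncomputable def comp {X Y Z : C.FormalSum} {q p n : ℤ} (h : q + p = n) :
    Hom Y Z q →ₗ[k] Hom X Y p →ₗ[k] Hom X Z n :=
  LinearMap.mk₂ k (fun g f i => compCol h (X.X i) (X.r i) g (f i))
    (fun g g' f => by
      funext i
      have : compCol h (X.X i) (X.r i) (g + g') =
          compCol h (X.X i) (X.r i) g + compCol h (X.X i) (X.r i) g' := by
        classical
        apply DFinsupp.lhom_ext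
        intro j x
        ext l
        simp
      simp [this])
    (fun c g f => by
      funext i
      have : compCol h (X.X i) (X.r i) (c • g) = c • compCol h (X.X i) (X.r i) g := by
        classical
        apply DFinsupp.lhom_ext
        intro j x
        ext l
        simp
      simp [this])
    (fun g f f' => by funext i; simp)
    (fun c g f => by funext i; simp)

lemma comp_apply {X Y Z : C.FormalSum} {q p n : ℤ} (h : q + p = n) (g : Hom Y Z q)
    (f : Hom X Y p) (i : X.I) : comp h g f i = compCol h (X.X i) (X.r i) g (f i) := rfl

/-- The differential on columns. -/
noncomputable def dCol (Y : C.FormalSum) {m n : ℤ} (h : m + 1 = n) (A : C.Obj) (r : ℤ) :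
    (Π₀ j : Y.I, C.Hom A (Y.X j) (m + Y.r j - r)) →ₗ[k]
      Π₀ j : Y.I, C.Hom A (Y.X j) (n + Y.r j - r) :=
  DFinsupp.mapRange.linearMap fun j =>
    koszul k (Y.r j) • C.d (show (m + Y.r j - r) + 1 = n + Y.r j - r by omega)

@[simp]
lemma dCol_apply (Y : C.FormalSum) {m n : ℤ} (h : m + 1 = n) (A : C.Obj) (r : ℤ)
    (f : Π₀ j : Y.I, C.Hom A (Y.X j) (m + Y.r j - r)) (j : Y.I) :
    dCol Y h A r f j =
      koszul k (Y.r j) • C.d (show (m + Y.r j - r) + 1 = n + Y.r j - r by omega) (f j) := by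
  simp [dCol]

/-- The differential of a matrix: the entry `X i [r i] ⟶ Y j [s j]` is mapped to `(-1)^(s j)` times
its differential in `C`. -/
noncomputable def d {X Y : C.FormalSum} {m n : ℤ} (h : m + 1 = n) : Hom X Y m →ₗ[k] Hom X Y n :=
  LinearMap.pi fun i => dCol Y h (X.X i) (X.r i) ∘ₗ LinearMap.proj i

lemma d_apply {X Y : C.FormalSum} {m n : ℤ} (h : m + 1 = n) (f : Hom X Y m) (i : X.I) :
    d h f i = dCol Y h (X.X i) (X.r i) (f i) := rfl

open Classical in
/-- The identity matrix. -/
noncomputable def id (X : C.FormalSum) : Hom X X 0 :=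
  fun i => DFinsupp.single i (C.idAt (X.X i) (show 0 + X.r i - X.r i = 0 by omega))

lemma id_comp {X Y : C.FormalSum} {p : ℤ} (h : 0 + p = p) (f : Hom X Y p) :
    comp h (id Y) f = f := by
  classical
  funext i
  have : compCol h (X.X i) (X.r i) (id Y) = LinearMap.id := by
    apply DFinsupp.lhom_ext
    intro j x
    ext l
    rw [compCol_single]
    by_cases hjl : j = l
    · subst hjl
      simp only [id, DFinsupp.single_eq_same, LinearMap.id_apply]
      exact C.idAt_comp _ _ x
    · simp [id, hjl, DFinsupp.single_apply]
  rw [comp_apply, this]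
  rfl

lemma comp_id {X Y : C.FormalSum} {p : ℤ} (h : p + 0 = p) (f : Hom X Y p) :
    comp h f (id X) = f := by
  classical
  funext i
  ext l
  rw [comp_apply, id, compCol_single]
  exact C.comp_idAt _ _ _

lemma assoc {X Y Z W : C.FormalSum} {r q p rq qp n : ℤ} (h₁ : r + q = rq) (h₂ : q + p = qp)
    (h₃ : rq + p = n) (h₄ : r + qp = n) (h : Hom Z W r) (g : Hom Y Z q) (f : Hom X Y p) :
    comp h₃ (comp h₁ h g) f = comp h₄ h (comp h₂ g f) := by
  classical
  funext i
  rw [comp_apply, comp_apply, comp_apply]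
  have key : compCol h₃ (X.X i) (X.r i) (comp h₁ h g) =
      compCol h₄ (X.X i) (X.r i) h ∘ₗ compCol h₂ (X.X i) (X.r i) g := by
    apply DFinsupp.lhom_ext
    intro j x
    rw [LinearMap.comp_apply]
    -- both sides are additive in the column `g j`
    have aux : ∀ v : Π₀ l : Z.I, C.Hom (Y.X j) (Z.X l) (q + Z.r l - Y.r j),
        DFinsupp.mapRange.linearMap (fun l => (C.comp
          (show (rq + W.r l - Y.r j) + (p + Y.r j - X.r i) = n + W.r l - X.r i by omega)).flip x)
          (compCol h₁ (Y.X j) (Y.r j) h v) =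
        compCol h₄ (X.X i) (X.r i) h (DFinsupp.mapRange.linearMap (fun l => (C.comp
          (show (q + Z.r l - Y.r j) + (p + Y.r j - X.r i) = qp + Z.r l - X.r i by
            omega)).flip x) v) := by
      intro v
      rw [← LinearMap.comp_apply, ← LinearMap.comp_apply]
      refine LinearMap.congr_fun ?_ v
      apply DFinsupp.lhom_ext
      intro l y
      ext m
      simp only [LinearMap.comp_apply, DFinsupp.mapRange.linearMap_apply, DFinsupp.mapRange_single,
        DFinsupp.mapRange_apply, compCol_single, LinearMap.flip_apply]
      exact C.assoc _ _ _ _ _ _ _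
    have e : compCol h₂ (X.X i) (X.r i) g (DFinsupp.single j x) =
        DFinsupp.mapRange.linearMap (fun l => (C.comp
          (show (q + Z.r l - Y.r j) + (p + Y.r j - X.r i) = qp + Z.r l - X.r i by
            omega)).flip x) (g j) := by
      ext l
      simp
    rw [e, ← aux]
    ext m
    simp [comp_apply]
  rw [key]
  rfl

lemma d_d {X Y : C.FormalSum} {l m n : ℤ} (h : l + 1 = m) (h' : m + 1 = n) (f : Hom X Y l) :
    d h' (d h f) = 0 := by
  funext i
  ext j
  simp [d_apply, C.d_d]

lemma leibniz {X Y Z : C.FormalSum} {q p n q' p' n' : ℤ} (h : q + p = n) (hq : q + 1 = q')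
    (hp : p + 1 = p') (hn : n + 1 = n') (h₁ : q' + p = n') (h₂ : q + p' = n')
    (g : Hom Y Z q) (f : Hom X Y p) :
    d hn (comp h g f) = comp h₁ (d hq g) f + koszul k q • comp h₂ g (d hp f) := by
  classical
  funext i
  rw [Pi.add_apply, Pi.smul_apply, d_apply, comp_apply, comp_apply, comp_apply, d_apply]
  have key : dCol Z hn (X.X i) (X.r i) ∘ₗ compCol h (X.X i) (X.r i) g =
      compCol h₁ (X.X i) (X.r i) (d hq g) +
        koszul k q • (compCol h₂ (X.X i) (X.r i) g ∘ₗ dCol Y hp (X.X i) (X.r i)) := by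
    apply DFinsupp.lhom_ext
    intro j x
    ext l
    have e : dCol Y hp (X.X i) (X.r i) (DFinsupp.single j x) = DFinsupp.single j
        (koszul k (Y.r j) • C.d (show (p + Y.r j - X.r i) + 1 = p' + Y.r j - X.r i by omega) x) := by
      simp [dCol]
    simp only [LinearMap.comp_apply, LinearMap.add_apply, LinearMap.smul_apply, e, dCol_apply,
      compCol_single, DFinsupp.add_apply, DFinsupp.smul_apply, d_apply, map_smul]
    rw [C.leibniz _ (show (q + Z.r l - Y.r j) + 1 = q' + Z.r l - Y.r j by omega)
      (show (p + Y.r j - X.r i) + 1 = p' + Y.r j - X.r i by omega) _ (by omega) (by omega)]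
    simp only [smul_add, smul_smul, koszul_sub, koszul_add]
    congr 2
    linear_combination (koszul k q * koszul k (Y.r j)) * koszul_mul_self k (Z.r l)
  exact LinearMap.congr_fun key (f i)

end FormalSum

/-- The dg category of formal sums of shifts of objects of `C`. -/
noncomputable def mat (C : DGCat.{w, v} k) : DGCat.{max w (u + 1), max u v} k where
  Obj := C.FormalSum
  Hom := FormalSum.Hom
  id := FormalSum.id
  comp := FormalSum.comp
  id_comp := FormalSum.id_comp
  comp_id := FormalSum.comp_id
  assoc := FormalSum.assoc
  d := FormalSum.d
  d_d := FormalSum.d_d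
  leibniz := FormalSum.leibniz

namespace FormalSum

variable {C : DGCat.{w, v} k} {D : DGCat.{w', v'} k} (F : DGFunctor C D)

/-- The formal sum obtained by applying `F` to all components. -/
abbrev mapObj (X : C.FormalSum) : D.FormalSum where
  I := X.I
  X i := F.obj (X.X i)
  r := X.r

/-- Application of `F` to all entries of a column. -/
noncomputable def mapCol (Y : C.FormalSum) (A : C.Obj) (n r : ℤ) :
    (Π₀ j : Y.I, C.Hom A (Y.X j) (n + Y.r j - r)) →ₗ[k]
      Π₀ j : Y.I, D.Hom (F.obj A) (F.obj (Y.X j)) (n + Y.r j - r) :=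
  DFinsupp.mapRange.linearMap fun _ => F.toGr.map

@[simp]
lemma mapCol_apply (Y : C.FormalSum) (A : C.Obj) (n r : ℤ)
    (f : Π₀ j : Y.I, C.Hom A (Y.X j) (n + Y.r j - r)) (j : Y.I) :
    mapCol F Y A n r f j = F.map (f j) := by
  simp [mapCol]

/-- Application of `F` to all entries of a matrix. -/
noncomputable def mapHom {X Y : C.FormalSum} {n : ℤ} :
    Hom X Y n →ₗ[k] Hom (mapObj F X) (mapObj F Y) n :=
  LinearMap.pi fun i => mapCol F Y (X.X i) n (X.r i) ∘ₗ LinearMap.proj i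

lemma mapHom_apply {X Y : C.FormalSum} {n : ℤ} (f : Hom X Y n) (i : X.I) :
    mapHom F f i = mapCol F Y (X.X i) n (X.r i) (f i) := rfl

lemma mapHom_id (X : C.FormalSum) : mapHom F (id X) = id (mapObj F X) := by
  classical
  refine funext fun (i : X.I) => ?_
  have : mapCol F X (X.X i) 0 (X.r i)
      (DFinsupp.single i (C.idAt (X.X i) (show 0 + X.r i - X.r i = 0 by omega))) =
      DFinsupp.single i (D.idAt (F.obj (X.X i)) (show 0 + X.r i - X.r i = 0 by omega)) := by
    rw [mapCol, DFinsupp.mapRange.linearMap_apply, DFinsupp.mapRange_single, F.toGr.map_idAt]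
  exact this

lemma mapCol_compCol {Y Z : C.FormalSum} {q p n : ℤ} (h : q + p = n) (A : C.Obj) (r : ℤ)
    (g : Hom Y Z q) (f : Π₀ j : Y.I, C.Hom A (Y.X j) (p + Y.r j - r)) :
    mapCol F Z A n r (compCol h A r g f) =
      compCol h (F.obj A) r (mapHom F g) (mapCol F Y A p r f) := by
  classical
  have key : mapCol F Z A n r ∘ₗ compCol h A r g =
      compCol h (F.obj A) r (mapHom F g) ∘ₗ mapCol F Y A p r := by
    apply DFinsupp.lhom_ext
    intro j x
    have e : mapCol F Y A p r (DFinsupp.single j x) = DFinsupp.single j (F.map x) := by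
      rw [mapCol, DFinsupp.mapRange.linearMap_apply, DFinsupp.mapRange_single]
    refine Eq.trans ?_ (congrArg (compCol h (F.obj A) r (mapHom F g)) e).symm
    refine DFinsupp.ext fun (l : Z.I) => ?_
    refine (mapCol_apply F Z A n r _ l).trans (Eq.trans ?_
      (compCol_single h (F.obj A) r (mapHom F g) j (F.map x) l).symm)
    refine (congrArg F.map (compCol_single h A r g j x l)).trans ?_
    refine (F.toGr.map_comp _ _ _).trans ?_
    exact congrArg (fun y => D.comp _ y (F.map x)) (mapCol_apply F Z _ q _ (g j) l).symm
  exact LinearMap.congr_fun key f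

lemma mapHom_comp {X Y Z : C.FormalSum} {q p n : ℤ} (h : q + p = n) (g : Hom Y Z q)
    (f : Hom X Y p) : mapHom F (comp h g f) = comp h (mapHom F g) (mapHom F f) :=
  funext fun (i : X.I) => mapCol_compCol F h (X.X i) (X.r i) g (f i)

lemma mapCol_dCol (Y : C.FormalSum) {m n : ℤ} (h : m + 1 = n) (A : C.Obj) (r : ℤ)
    (f : Π₀ j : Y.I, C.Hom A (Y.X j) (m + Y.r j - r)) :
    mapCol F Y A n r (dCol Y h A r f) = dCol (mapObj F Y) h (F.obj A) r (mapCol F Y A m r f) := by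
  refine DFinsupp.ext fun (j : Y.I) => ?_
  refine (mapCol_apply F Y A n r _ j).trans (Eq.trans ?_
    (dCol_apply (mapObj F Y) h (F.obj A) r _ j).symm)
  rw [dCol_apply, DGFunctor.map, map_smul, F.map_d]
  exact congrArg (fun y => koszul k (Y.r j) • D.d _ y) (mapCol_apply F Y A m r f j).symm

lemma mapHom_d {X Y : C.FormalSum} {m n : ℤ} (h : m + 1 = n) (f : Hom X Y m) :
    mapHom F (d h f) = d h (mapHom F f) :=
  funext fun (i : X.I) => mapCol_dCol F Y h (X.X i) (X.r i) (f i)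

end FormalSum

/-- The dg functor on formal sums of shifts that applies `F` to all components. -/
noncomputable def matMap {C : DGCat.{w, v} k} {D : DGCat.{w', v'} k} (F : DGFunctor C D) :
    DGFunctor C.mat D.mat where
  obj := FormalSum.mapObj F
  toGr :=
    { map := FormalSum.mapHom F
      map_id := FormalSum.mapHom_id F
      map_comp := FormalSum.mapHom_comp F }
  map_d := FormalSum.mapHom_d F

/-! ### Twisting -/

/-- A twisted object: an object with a degree `1` endomorphism `δ` with `dδ + δ ∘ δ = 0`. -/
structure TwistedObj (A : DGCat.{w, v} k) where
  X : A.Obj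
  δ : A.Hom X X 1
  mc : A.d (one_add_one_eq_two) δ + A.comp (one_add_one_eq_two) δ δ = 0

namespace TwistedObj

variable {A : DGCat.{w, v} k} {B : DGCat.{w', v'} k}

/-- The twisted differential `f ↦ df + ε ∘ f - (-1)^|f| f ∘ δ` on morphisms `(X, δ) ⟶ (Y, ε)`. -/
def d {X Y : A.TwistedObj} {m n : ℤ} (h : m + 1 = n) : A.Hom X.X Y.X m →ₗ[k] A.Hom X.X Y.X n :=
  A.d h + A.comp (show 1 + m = n by omega) Y.δ - koszul k m • (A.comp h).flip X.δ

lemma d_apply {X Y : A.TwistedObj} {m n : ℤ} (h : m + 1 = n) (f : A.Hom X.X Y.X m) :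
    d h f = A.d h f + A.comp (show 1 + m = n by omega) Y.δ f - koszul k m • A.comp h f X.δ := rfl

lemma d_d {X Y : A.TwistedObj} {l m n : ℤ} (h : l + 1 = m) (h' : m + 1 = n)
    (f : A.Hom X.X Y.X l) : d h' (d h f) = 0 := by
  simp only [d_apply, map_add, map_sub, map_smul, A.d_d]
  rw [A.leibniz (show 1 + l = m by omega) one_add_one_eq_two h h' (show 2 + l = n by omega)
      (by omega),
    A.leibniz h h one_add_one_eq_two h' (by omega) (show l + 2 = n by omega),
    eq_neg_of_add_eq_zero_left Y.mc, eq_neg_of_add_eq_zero_left X.mc, map_neg, map_neg,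
    LinearMap.neg_apply,
    A.assoc one_add_one_eq_two (show 1 + l = m by omega) _ (show 1 + m = n by omega),
    A.assoc (show 1 + l = m by omega) h _ (show 1 + m = n by omega),
    A.assoc h one_add_one_eq_two _ (show l + 2 = n by omega),
    show koszul k m = koszul k l * -1 by rw [← h, koszul_add, koszul_one], koszul_one]
  have := koszul_mul_self k l
  simp only [mul_neg, mul_one, neg_smul, smul_add, smul_sub, smul_smul, smul_neg, one_smul, this]
  abel

lemma leibniz {X Y Z : A.TwistedObj} {q p n q' p' n' : ℤ} (h : q + p = n) (hq : q + 1 = q')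
    (hp : p + 1 = p') (hn : n + 1 = n') (h₁ : q' + p = n') (h₂ : q + p' = n')
    (g : A.Hom Y.X Z.X q) (f : A.Hom X.X Y.X p) :
    d hn (A.comp h g f) = A.comp h₁ (d hq g) f + koszul k q • A.comp h₂ g (d hp f) := by
  simp only [d_apply, map_add, map_sub, map_smul, LinearMap.add_apply, LinearMap.sub_apply,
    LinearMap.smul_apply]
  rw [A.leibniz h hq hp hn h₁ h₂, A.assoc (show 1 + q = q' by omega) h h₁ (by omega),
    A.assoc hq (show 1 + p = p' by omega) h₁ h₂, A.assoc h hp hn h₂,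
    show koszul k n = koszul k q * koszul k p by rw [← h, koszul_add]]
  simp only [smul_add, smul_sub, smul_smul]
  abel

end TwistedObj

/-- The dg category of twisted objects of `A`. -/
def twist (A : DGCat.{w, v} k) : DGCat.{max w v, v} k where
  Obj := A.TwistedObj
  Hom X Y n := A.Hom X.X Y.X n
  id X := A.id X.X
  comp := A.comp
  id_comp := A.id_comp
  comp_id := A.comp_id
  assoc := A.assoc
  d := TwistedObj.d
  d_d := TwistedObj.d_d
  leibniz := TwistedObj.leibniz

/-- The image of a twisted object under a dg functor. -/
def TwistedObj.mapObj {A : DGCat.{w, v} k} {B : DGCat.{w', v'} k} (F : DGFunctor A B)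
    (X : A.TwistedObj) : B.TwistedObj where
  X := F.obj X.X
  δ := F.map X.δ
  mc := by
    have := congrArg F.toGr.map X.mc
    rwa [map_zero, map_add, F.map_d, F.toGr.map_comp] at this

lemma TwistedObj.map_d {A : DGCat.{w, v} k} {B : DGCat.{w', v'} k} (F : DGFunctor A B)
    {X Y : A.TwistedObj} {m n : ℤ} (h : m + 1 = n) (f : A.Hom X.X Y.X m) :
    F.map (TwistedObj.d h f) = TwistedObj.d (X := mapObj F X) (Y := mapObj F Y) h (F.map f) := by
  refine Eq.trans ?_ (TwistedObj.d_apply (X := mapObj F X) (Y := mapObj F Y) h (F.map f)).symm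
  rw [TwistedObj.d_apply, DGFunctor.map, map_sub, map_add, map_smul, F.map_d, F.toGr.map_comp,
    F.toGr.map_comp]
  rfl

/-- The dg functor induced on twisted objects. -/
def twistMap {A : DGCat.{w, v} k} {B : DGCat.{w', v'} k} (F : DGFunctor A B) :
    DGFunctor A.twist B.twist where
  obj := TwistedObj.mapObj F
  toGr := { map := F.toGr.map, map_id := fun X => F.toGr.map_id X.X, map_comp := F.toGr.map_comp }
  map_d := TwistedObj.map_d F

/-- The full dg subcategory on the objects satisfying `P`. -/
def full (A : DGCat.{w, v} k) (P : A.Obj → Prop) : DGCat.{w, v} k where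
  Obj := { X : A.Obj // P X }
  Hom X Y n := A.Hom X.1 Y.1 n
  id X := A.id X.1
  comp := A.comp
  id_comp := A.id_comp
  comp_id := A.comp_id
  assoc := A.assoc
  d := A.d
  d_d := A.d_d
  leibniz := A.leibniz

/-- The restriction of a dg functor to full dg subcategories. -/
def fullMap {A : DGCat.{w, v} k} {B : DGCat.{w', v'} k} (F : DGFunctor A B) (P : A.Obj → Prop)
    (Q : B.Obj → Prop) (hF : ∀ X, P X → Q (F.obj X)) : DGFunctor (A.full P) (B.full Q) where
  obj X := ⟨F.obj X.1, hF X.1 X.2⟩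
  toGr :=
    { map := F.toGr.map
      map_id := fun X => F.toGr.map_id X.1
      map_comp := F.toGr.map_comp }
  map_d := F.map_d

/-! ### Twisted complexes and perfect objects -/

/-- The twisting `δ` of a twisted sum of shifts of objects is one-sided: the relation
"`δ` has a nonzero component from the `i`-th to the `j`-th summand" is well-founded (for finitely
many summands: `δ` is strictly triangular with respect to some ordering of the summands). -/
def IsOneSided {C : DGCat.{w, v} k} (X : C.mat.twist.Obj) : Prop :=
  WellFounded fun j i : X.X.I => X.δ i j ≠ 0

/-- A one-sided twisted complex: finitely many summands and one-sided twisting. -/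
def IsTw {C : DGCat.{w, v} k} (X : C.mat.twist.Obj) : Prop := Finite X.X.I ∧ IsOneSided X

/-- A one-sided twisted sum of possibly infinitely many shifts of objects (that is, a semifree dg
module over `C`) that is a direct summand of a one-sided twisted complex up to homotopy. -/
def IsPerf {C : DGCat.{w, v} k} (X : C.mat.twist.Obj) : Prop :=
  IsOneSided X ∧ ∃ Y : C.mat.twist.Obj, IsTw Y ∧ C.mat.twist.HomotopyRetract X Y

/-- `Tw C`, the dg category of one-sided twisted complexes in `C`. -/
noncomputable def Tw (C : DGCat.{w, v} k) : DGCat.{max w v (u + 1), max u v} k :=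
  C.mat.twist.full IsTw

/-- `Perf C`, the split-closure of `Tw C`. -/
noncomputable def Perf (C : DGCat.{w, v} k) : DGCat.{max w v (u + 1), max u v} k :=
  C.mat.twist.full IsPerf

section

variable {C : DGCat.{w, v} k} {D : DGCat.{w', v'} k} (F : DGFunctor C D)

lemma isOneSided_map (X : C.mat.twist.Obj) (hX : IsOneSided X) :
    IsOneSided ((twistMap (matMap F)).obj X) := by
  refine Subrelation.wf (r := fun j i : X.X.I => X.δ i j ≠ 0) ?_ hX
  intro j i h h'
  apply h
  exact (congrArg F.map h').trans F.toGr.map.map_zero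

lemma isTw_map (X : C.mat.twist.Obj) (hX : IsTw X) : IsTw ((twistMap (matMap F)).obj X) :=
  ⟨hX.1, isOneSided_map F X hX.2⟩

lemma HomotopyRetract.map {A B : C.Obj} (h : C.HomotopyRetract A B) :
    D.HomotopyRetract (F.obj A) (F.obj B) := by
  obtain ⟨u, v, hu, hv, s, hs⟩ := h
  refine ⟨F.map u, F.map v, ?_, ?_, F.map s, ?_⟩
  · rw [← F.map_d, hu, map_zero]
  · rw [← F.map_d, hv, map_zero]
  · rw [← F.map_d, hs, map_sub, F.toGr.map_comp, F.toGr.map_id]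

lemma isPerf_map (X : C.mat.twist.Obj) (hX : IsPerf X) : IsPerf ((twistMap (matMap F)).obj X) := by
  obtain ⟨h, Y, hY, hXY⟩ := hX
  exact ⟨isOneSided_map F X h, _, isTw_map F Y hY, hXY.map _⟩

/-- The dg functor `Tw C ⟶ Tw D` induced by `F`. -/
noncomputable def TwMap : DGFunctor C.Tw D.Tw :=
  fullMap (twistMap (matMap F)) IsTw IsTw (isTw_map F)

/-- The dg functor `Perf C ⟶ Perf D` induced by `F`. -/
noncomputable def PerfMap : DGFunctor C.Perf D.Perf :=
  fullMap (twistMap (matMap F)) IsPerf IsPerf (isPerf_map F)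

end

end DGCat

namespace DGCat

variable {k : Type u} [CommRing k]

/-! ### Semifree dg categories and semifree extensions -/

/-- Words `f_m ∘ ⋯ ∘ f_1` of composable elements of a graded set of arrows `i : src i ⟶ tgt i` of
degree `deg i`. `Word src tgt deg A B n` consists of the words from `A` to `B` of total degree `n`,
including the empty word at each object. -/
inductive Word {O : Type w} {I : Type v} (src tgt : I → O) (deg : I → ℤ) :
    O → O → ℤ → Type (max w v)
  | nil (A : O) : Word src tgt deg A A 0
  | cons {A : O} {n : ℤ} (i : I) (p : Word src tgt deg A (src i) n) :
      Word src tgt deg A (tgt i) (deg i + n)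

/-- The composite in `C` of a word of morphisms. -/
def Word.eval (C : DGCat.{w, v} k) {I : Type v'} {src tgt : I → C.Obj} {deg : I → ℤ}
    (mor : ∀ i, C.Hom (src i) (tgt i) (deg i)) :
    ∀ {A B : C.Obj} {n : ℤ}, Word src tgt deg A B n → C.Hom A B n
  | _, _, _, .nil A => C.id A
  | _, _, _, .cons i p => C.comp rfl (mor i) (p.eval C mor)

/-- A set of generating morphisms of a semifree dg category `C`: a well-ordered family of
homogeneous morphisms `mor i`, such that the words in the `mor i` form a basis of the morphisms
of `C`, and such that `d (mor i)` is generated by the `mor j` with `j < i`. -/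
structure GeneratingSet (C : DGCat.{u, u, u} k) where
  I : Type u
  lt : I → I → Prop
  [wellOrder : IsWellOrder I lt]
  src : I → C.Obj
  tgt : I → C.Obj
  deg : I → ℤ
  mor : ∀ i, C.Hom (src i) (tgt i) (deg i)
  free : ∀ A B n, Function.Bijective (Finsupp.linearCombination k
    (fun x : Word src tgt deg A B n => x.eval C mor))
  d_mor : ∀ i, C.Generated {x | ∃ j, lt j i ∧ x = C.mor (mor j)} (C.d rfl (mor i))

/-- A dg category is semifree if it has a set of generating morphisms. -/
def IsSemifree : ObjectProperty (DGCat.{u, u, u} k) := fun C => Nonempty C.GeneratingSet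

/-- The morphisms of `D`, as a graded category, are freely generated over those of `C` (along `F`)
by the family `mor`: a functor of graded categories on `D` (with given map `o` on objects) is the
same as a functor on `C` together with an arbitrary choice of images of the morphisms `mor i`. -/
def IsFreeExtension {C D : DGCat.{u, u, u} k} (F : C ⟶ D) {I : Type u} (src tgt : I → D.Obj)
    (deg : I → ℤ) (mor : ∀ i, D.Hom (src i) (tgt i) (deg i)) : Prop :=
  ∀ (E : GrCat.{u, u, u} k) (o : D.Obj → E.Obj)
    (G : GrCat.FunctorOver C.toGrCat E fun A => o (F.obj A))
    (φ : ∀ i, E.Hom (o (src i)) (o (tgt i)) (deg i)),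
    ∃! H : GrCat.FunctorOver D.toGrCat E o,
      (∀ (A B : C.Obj) (n : ℤ) (f : C.Hom A B n), H.map (F.map f) = G.map f) ∧
        ∀ i, H.map (mor i) = φ i

/-- `F : C ⟶ D` is a semifree extension by the set of objects `R` and the family of morphisms
`mor i`. -/
structure IsSemifreeExtensionBy {C D : DGCat.{u, u, u} k} (F : C ⟶ D) (R : Set D.Obj) {I : Type u}
    (src tgt : I → D.Obj) (deg : I → ℤ) (mor : ∀ i, D.Hom (src i) (tgt i) (deg i)) : Prop where
  obj_injective : Function.Injective F.obj
  map_injective : ∀ (A B : C.Obj) (n : ℤ) (f g : C.Hom A B n), F.map f = F.map g → f = g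
  isCompl : IsCompl (Set.range F.obj) R
  free : IsFreeExtension F src tgt deg mor
  d_mor : ∃ lt : I → I → Prop, IsWellOrder I lt ∧ ∀ i, D.Generated
    ({x | ∃ (A B : C.Obj) (n : ℤ) (f : C.Hom A B n), x = D.mor (F.map f)} ∪
      {x | ∃ j, lt j i ∧ x = D.mor (mor j)}) (D.d rfl (mor i))

variable (k) in
/-- The class of semifree extensions. -/
def semifreeExtensions : MorphismProperty (DGCat.{u, u, u} k) := fun _ D F =>
  ∃ (R : Set D.Obj) (I : Type u) (src tgt : I → D.Obj) (deg : I → ℤ)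
    (mor : ∀ i, D.Hom (src i) (tgt i) (deg i)), IsSemifreeExtensionBy F R src tgt deg mor

/-! ### Three model structures -/

variable (k) in
/-- Cofibrations of dg categories: retracts of semifree extensions. -/
def cofibrations : MorphismProperty (DGCat.{u, u, u} k) := (semifreeExtensions k).retracts

/-- The three model structures on dg categories. -/
inductive ModelStructure
  | dwyerKan
  | quasiEquiconic
  | morita

namespace ModelStructure

variable (k) in
/-- Weak equivalences: quasi-equivalences, pretriangulated equivalences, Morita equivalences. -/
def weakEquivalences : ModelStructure → MorphismProperty (DGCat.{u, u, u} k)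
  | dwyerKan => fun _ _ F => DGFunctor.IsQuasiEquivalence F
  | quasiEquiconic => fun _ _ F => (TwMap F).IsQuasiEquivalence
  | morita => fun _ _ F => (PerfMap F).IsQuasiEquivalence

variable (k) in
/-- Fibrations: the dg functors with the right lifting property with respect to all cofibrations
that are weak equivalences. -/
def fibrations (M : ModelStructure) : MorphismProperty (DGCat.{u, u, u} k) :=
  (cofibrations k ⊓ M.weakEquivalences k).rlp

variable (k) in
/-- Acyclic fibrations. -/
def acyclicFibrations (M : ModelStructure) : MorphismProperty (DGCat.{u, u, u} k) :=
  M.fibrations k ⊓ M.weakEquivalences k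

end ModelStructure

variable (k) in
/-- The full subcategory of semifree dg categories. -/
abbrev Semifree := (IsSemifree (k := k)).FullSubcategory

/-- `I`, together with `i` and `p`, is a cylinder functor on semifree dg categories with respect to
the model structure `M`. -/
structure IsCylinderFunctor (M : ModelStructure) (I : Semifree k ⥤ Semifree k)
    (i : ∀ C : Semifree k, coprod C.obj C.obj ⟶ (I.obj C).obj)
    (p : ∀ C : Semifree k, (I.obj C).obj ⟶ C.obj) : Prop where
  cofibration : ∀ C, cofibrations k (i C)
  acyclicFibration : ∀ C, M.acyclicFibrations k (p C)
  codiagonal : ∀ C, i C ≫ p C = DGCat.codiagonal C.obj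
  naturality_i : ∀ {C D : Semifree k} (F : C ⟶ D),
    i C ≫ (I.map F).hom = coprodMap F.hom F.hom ≫ i D
  naturality_p : ∀ {C D : Semifree k} (F : C ⟶ D), (I.map F).hom ≫ p D = p C ≫ F.hom

/-! ### The cylinder -/

section Cylinder

variable {C X : DGCat.{u, u, u} k}

/-- Given `i₁, i₂ : C ⟶ X` and morphisms `t_f : i₁ A ⟶ i₂ B` of degree `|f| - 1` for the generating
morphisms `f : A ⟶ B`, the morphism `t_θ` for a word `θ = f_m ∘ ⋯ ∘ f_1`, namely
`∑ j, (-1)^(|f_{j-1}| + ⋯ + |f_1|) i₂ f_m ⋯ i₂ f_{j+1} ∘ t_{f_j} ∘ i₁ f_{j-1} ⋯ i₁ f_1`. -/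
def tWord (S : GeneratingSet C) (i₁ i₂ : C ⟶ X)
    (t : ∀ i, X.Hom (i₁.obj (S.src i)) (i₂.obj (S.tgt i)) (S.deg i - 1)) :
    ∀ {A B : C.Obj} {n : ℤ}, Word S.src S.tgt S.deg A B n → X.Hom (i₁.obj A) (i₂.obj B) (n - 1)
  | _, _, _, .nil _ => 0
  | _, _, _, .cons (n := n) i p =>
      X.comp (by omega) (i₂.map (S.mor i)) (tWord S i₁ i₂ t p) +
        koszul k n • X.comp (by omega) (t i) (i₁.map (p.eval C S.mor))

/-- The morphism `t_θ` for an arbitrary morphism `θ` of `C`, the linear extension of `tWord`. -/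
noncomputable def tMor (S : GeneratingSet C) (i₁ i₂ : C ⟶ X)
    (t : ∀ i, X.Hom (i₁.obj (S.src i)) (i₂.obj (S.tgt i)) (S.deg i - 1)) {A B : C.Obj} {n : ℤ}
    (θ : C.Hom A B n) : X.Hom (i₁.obj A) (i₂.obj B) (n - 1) :=
  Finsupp.linearCombination k (fun x : Word S.src S.tgt S.deg A B n => tWord S i₁ i₂ t x)
    ((LinearEquiv.ofBijective _ (S.free A B n)).symm θ)

/-- Index set of the generating morphisms that are added to `C ⊔ C` in the cylinder of `C`:
`t_A, t'_A, t̂_A, ť_A, t̄_A` for objects `A`, and `t_f` for generating morphisms `f`. -/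
inductive CylIndex (S : GeneratingSet C) : Type u
  | t (A : C.Obj)
  | t' (A : C.Obj)
  | tHat (A : C.Obj)
  | tCheck (A : C.Obj)
  | tBar (A : C.Obj)
  | tGen (i : S.I)

namespace CylIndex

variable {S : GeneratingSet C}

/-- Sources. -/
def src (i₁ i₂ : C ⟶ X) : CylIndex S → X.Obj
  | t A => i₁.obj A
  | t' A => i₂.obj A
  | tHat A => i₁.obj A
  | tCheck A => i₂.obj A
  | tBar A => i₁.obj A
  | tGen i => i₁.obj (S.src i)

/-- Targets. -/
def tgt (i₁ i₂ : C ⟶ X) : CylIndex S → X.Obj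
  | t A => i₂.obj A
  | t' A => i₁.obj A
  | tHat A => i₁.obj A
  | tCheck A => i₂.obj A
  | tBar A => i₂.obj A
  | tGen i => i₂.obj (S.tgt i)

/-- Degrees. -/
def deg : CylIndex S → ℤ
  | t _ => 0
  | t' _ => 0
  | tHat _ => -1
  | tCheck _ => -1
  | tBar _ => -2
  | tGen i => S.deg i - 1

end CylIndex

/-- The family of all new generating morphisms of a cylinder. -/
def CylIndex.mor {S : GeneratingSet C} {i₁ i₂ : C ⟶ X}
    (t : ∀ A, X.Hom (i₁.obj A) (i₂.obj A) 0) (t' : ∀ A, X.Hom (i₂.obj A) (i₁.obj A) 0)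
    (tHat : ∀ A, X.Hom (i₁.obj A) (i₁.obj A) (-1)) (tCheck : ∀ A, X.Hom (i₂.obj A) (i₂.obj A) (-1))
    (tBar : ∀ A, X.Hom (i₁.obj A) (i₂.obj A) (-2))
    (tGen : ∀ i, X.Hom (i₁.obj (S.src i)) (i₂.obj (S.tgt i)) (S.deg i - 1)) :
    ∀ j : CylIndex S, X.Hom (j.src i₁ i₂) (j.tgt i₁ i₂) j.deg
  | .t A => t A
  | .t' A => t' A
  | .tHat A => tHat A
  | .tCheck A => tCheck A
  | .tBar A => tBar A
  | .tGen i => tGen i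

/-- `Cylinder S i₁ i₂` is the structure on a dg category `X` of being the cylinder `Cyl(C)` of the
semifree dg category `C` with set of generating morphisms `S`, where `i₁, i₂` are the components of
`C ⊔ C ⟶ X`: the dg category `X` is the semifree extension of `C ⊔ C` (with no new objects) by
morphisms `t_A, t'_A, t̂_A, ť_A, t̄_A` for the objects `A` and `t_f` for the generating morphisms `f`,
with the prescribed differentials. -/
structure Cylinder (S : GeneratingSet C) (i₁ i₂ : C ⟶ X) where
  t : ∀ A, X.Hom (i₁.obj A) (i₂.obj A) 0
  t' : ∀ A, X.Hom (i₂.obj A) (i₁.obj A) 0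
  tHat : ∀ A, X.Hom (i₁.obj A) (i₁.obj A) (-1)
  tCheck : ∀ A, X.Hom (i₂.obj A) (i₂.obj A) (-1)
  tBar : ∀ A, X.Hom (i₁.obj A) (i₂.obj A) (-2)
  tGen : ∀ i, X.Hom (i₁.obj (S.src i)) (i₂.obj (S.tgt i)) (S.deg i - 1)
  semifree : IsSemifreeExtensionBy (desc i₁ i₂) ∅ (CylIndex.src i₁ i₂) (CylIndex.tgt i₁ i₂)
    CylIndex.deg (CylIndex.mor t t' tHat tCheck tBar tGen)
  d_t : ∀ A, X.d (zero_add 1) (t A) = 0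
  d_t' : ∀ A, X.d (zero_add 1) (t' A) = 0
  d_tHat : ∀ A, X.d (neg_add_cancel 1) (tHat A) =
    X.id (i₁.obj A) - X.comp (add_zero 0) (t' A) (t A)
  d_tCheck : ∀ A, X.d (neg_add_cancel 1) (tCheck A) =
    X.id (i₂.obj A) - X.comp (add_zero 0) (t A) (t' A)
  d_tBar : ∀ A, X.d (show (-2 : ℤ) + 1 = -1 by norm_num) (tBar A) =
    X.comp (zero_add (-1)) (t A) (tHat A) - X.comp (add_zero (-1)) (tCheck A) (t A)
  /-- `d t_f = (-1)^|f| (i₂ f ∘ t_A - t_B ∘ i₁ f) + t_{df}` for `f : A ⟶ B` -/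
  d_tGen : ∀ i, X.d (show S.deg i - 1 + 1 = S.deg i + 1 - 1 by omega) (tGen i) =
    koszul k (S.deg i) •
      (X.comp (by omega) (i₂.map (S.mor i)) (t (S.src i)) -
        X.comp (by omega) (t (S.tgt i)) (i₁.map (S.mor i))) +
    tMor S i₁ i₂ tGen (C.d rfl (S.mor i))

namespace Cylinder

/-- `G` is the dg functor `Cyl(F) : Cyl(C) ⟶ Cyl(D)`: it extends `F ⊔ F` and maps
`t_A, t'_A, t̂_A, ť_A, t̄_A` to `t_{FA}, t'_{FA}, t̂_{FA}, ť_{FA}, t̄_{FA}` and `t_f` to `t_{F(f)}`. -/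
structure IsMap {D Y : DGCat.{u, u, u} k} {S : GeneratingSet C} {i₁ i₂ : C ⟶ X}
    {T : GeneratingSet D} {j₁ j₂ : D ⟶ Y} (P : Cylinder S i₁ i₂) (Q : Cylinder T j₁ j₂)
    (F : C ⟶ D) (G : X ⟶ Y) : Prop where
  comp_i₁ : i₁ ≫ G = F ≫ j₁
  comp_i₂ : i₂ ≫ G = F ≫ j₂
  map_t : ∀ A, Y.mor (G.map (P.t A)) = Y.mor (Q.t (F.obj A))
  map_t' : ∀ A, Y.mor (G.map (P.t' A)) = Y.mor (Q.t' (F.obj A))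
  map_tHat : ∀ A, Y.mor (G.map (P.tHat A)) = Y.mor (Q.tHat (F.obj A))
  map_tCheck : ∀ A, Y.mor (G.map (P.tCheck A)) = Y.mor (Q.tCheck (F.obj A))
  map_tBar : ∀ A, Y.mor (G.map (P.tBar A)) = Y.mor (Q.tBar (F.obj A))
  map_tGen : ∀ i, Y.mor (G.map (P.tGen i)) = Y.mor (tMor T j₁ j₂ Q.tGen (F.map (S.mor i)))

/-- `q` is the projection `p : Cyl(C) ⟶ C`: it restricts to the identity on both copies of `C`, maps
`t_A, t'_A` to `1_A`, and maps `t̂_A, ť_A, t̄_A` and `t_f` to `0`. -/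
structure IsProjection {S : GeneratingSet C} {i₁ i₂ : C ⟶ X} (P : Cylinder S i₁ i₂)
    (q : X ⟶ C) : Prop where
  comp_i₁ : i₁ ≫ q = 𝟙 C
  comp_i₂ : i₂ ≫ q = 𝟙 C
  map_t : ∀ A, C.mor (q.map (P.t A)) = C.mor (C.id A)
  map_t' : ∀ A, C.mor (q.map (P.t' A)) = C.mor (C.id A)
  map_tHat : ∀ A, q.map (P.tHat A) = 0
  map_tCheck : ∀ A, q.map (P.tCheck A) = 0
  map_tBar : ∀ A, q.map (P.tBar A) = 0
  map_tGen : ∀ i, q.map (P.tGen i) = 0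

end Cylinder

end Cylinder

end DGCat

/-! A functor or a derivation on a free graded category is determined by arbitrary values on
generators, so identities between such maps, compatibility with differentials and d² = 0 can all be
checked on generators.

The operation θ ↦ t_θ is the derivation with t_{gf} = i₂(g) t_f + (-1)^{|f|} t_g i₁(f) and
prescribed values on the generating morphisms (`tMor_eq`). Being characterised this way, it commutes
with dg functors on both sides (`map_tMor`, `tMor_map`), which makes Cyl(F) compatible with
composition although F need not preserve generators. The formula for dt_f extends to dt_θ for all θ
(`GrCat.IsFreeOn.d_homotopy`). On the free graded category spanned by all the generators, d² t_f = 0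
is this formula applied to θ = df, so the cylinder exists (`cylCylinder`).

A dg functor out of a cylinder is the same as two dg functors out of C together with morphisms t,
t', t̂, ť, t̄, t_f that satisfy the prescribed equations (`Cylinder.exists_isMap`,
`Cylinder.isMap_unique`). This gives Cyl(F), p, functoriality, naturality, and an isomorphism
between any two cylinders for the same generating set; properties of p may therefore be proved for
the constructed cylinder.

The central point is that p is surjective on morphism complexes with acyclic kernels
(`isAcyclicSurjective_cylP`). Let r = i₁p, and let T_Z : rZ → Z be the identity on the first copy of
C and t_A on the second. There is a derivation s of degree -1 from r to the identity with d s(f) =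
(-1)^{|f|} (f T - T r(f)) + s(df), determined by s(i₂f) = t_f, s(t') = -t̂, s(ť) = t̄ and zero on
the other generators (`isContracted`). The relation for dt̄ is what makes s(ť) = t̄ possible. If df
= 0 and p(f) = 0, then f T is a boundary; since T has a right inverse up to the homotopy ť, so is f,
and the bounding morphism lies in the kernel of p.

Two consequences give the statement for all three model structures. Such a p lifts against semifree
extensions, generator by generator along their well-ordering, hence against all cofibrations
(`rlp_semifreeExtensions`). Surjectivity with acyclic kernels also passes to one-sided twisted
objects by well-founded recursion over the summands (`FormalSum.exists_twD_eq`). As p has the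
section i₁, the functors p, Tw p and Perf p are surjective on objects, hence quasi-equivalences. -/

/-! ### Functors of graded categories and freely generated graded categories. -/

namespace GrCat

variable {k : Type u} [CommRing k]

namespace FunctorOver

variable {C : GrCat.{w, v} k} {D : GrCat.{w', v'} k} {E : GrCat.{w'', v''} k}

lemma ext {o : C.Obj → D.Obj} {F G : FunctorOver C D o}
    (h : ∀ (A B : C.Obj) (n : ℤ) (f : C.Hom A B n), F.map f = G.map f) : F = G := by
  obtain ⟨F, _, _⟩ := F
  obtain ⟨G, _, _⟩ := G
  have : @F = @G := by
    funext A B n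
    exact LinearMap.ext (h A B n)
  subst this
  rfl

/-- The identity functor. -/
def id (C : GrCat.{w, v} k) : FunctorOver C C fun A => A where
  map := LinearMap.id
  map_id _ := rfl
  map_comp _ _ _ := rfl

/-- Composition of functors of graded categories. -/
def comp {o : C.Obj → D.Obj} {o' : D.Obj → E.Obj} (F : FunctorOver C D o)
    (G : FunctorOver D E o') : FunctorOver C E fun A => o' (o A) where
  map := G.map ∘ₗ F.map
  map_id A := by simp [F.map_id, G.map_id]
  map_comp h g f := by simp [F.map_comp, G.map_comp]

@[simp]
lemma comp_map {o : C.Obj → D.Obj} {o' : D.Obj → E.Obj} (F : FunctorOver C D o)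
    (G : FunctorOver D E o') {A B : C.Obj} {n : ℤ} (f : C.Hom A B n) :
    (F.comp G).map f = G.map (F.map f) := rfl

end FunctorOver

lemma Generated.trans {C : GrCat.{w, v} k} {S T : Set C.Mor}
    (h : ∀ {A B : C.Obj} {n : ℤ} (f : C.Hom A B n), C.mor f ∈ S → C.Generated T f)
    {A B : C.Obj} {n : ℤ} {f : C.Hom A B n} (hf : C.Generated S f) : C.Generated T f := by
  induction hf with
  | of f hf => exact h f hf
  | id A => exact .id A
  | zero A B n => exact .zero A B n
  | add f g _ _ hf hg => exact .add f g hf hg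
  | smul c f _ hf => exact .smul c f hf
  | comp h g f _ _ hg hf => exact .comp h g f hg hf

lemma Generated.map {C : GrCat.{w, v} k} {D : GrCat.{w', v'} k} {o : C.Obj → D.Obj}
    (F : FunctorOver C D o) {S : Set C.Mor} {T : Set D.Mor}
    (h : ∀ {A B : C.Obj} {n : ℤ} (f : C.Hom A B n), C.mor f ∈ S → D.Generated T (F.map f))
    {A B : C.Obj} {n : ℤ} {f : C.Hom A B n} (hf : C.Generated S f) :
    D.Generated T (F.map f) := by
  induction hf with
  | of f hf => exact h f hf
  | id A => exact F.map_id A ▸ .id _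
  | zero A B n => exact F.map.map_zero ▸ .zero _ _ n
  | add f g _ _ hf hg => exact F.map.map_add f g ▸ .add _ _ hf hg
  | smul c f _ hf => exact F.map.map_smul c f ▸ .smul c _ hf
  | comp h g f _ _ hg hf => exact F.map_comp h g f ▸ .comp h _ _ hg hf

lemma FunctorOver.eq_of_generated {C : GrCat.{w, v} k} {D : GrCat.{w', v'} k} {o : C.Obj → D.Obj}
    {F G : FunctorOver C D o} {S : Set C.Mor}
    (h : ∀ {A B : C.Obj} {n : ℤ} (f : C.Hom A B n), C.mor f ∈ S → F.map f = G.map f)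
    {A B : C.Obj} {n : ℤ} {f : C.Hom A B n} (hf : C.Generated S f) : F.map f = G.map f := by
  induction hf with
  | of f hf => exact h f hf
  | id A => rw [F.map_id, G.map_id]
  | zero A B n => rw [map_zero, map_zero]
  | add f g _ _ hf hg => rw [map_add, map_add, hf, hg]
  | smul c f _ hf => rw [map_smul, map_smul, hf]
  | comp h g f _ _ hg hf => rw [F.map_comp, G.map_comp, hf, hg]

lemma mor_inj {C : GrCat.{w, v} k} {A B : C.Obj} {n : ℤ} {f g : C.Hom A B n}
    (h : C.mor f = C.mor g) : f = g := by
  cases h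
  rfl

/-- The morphisms generated by a set of homogeneous morphisms, as a submodule. -/
def generatedSubmodule (C : GrCat.{w, v} k) (S : Set C.Mor) (A B : C.Obj) (n : ℤ) :
    Submodule k (C.Hom A B n) where
  carrier := {f | C.Generated S f}
  add_mem' hf hg := .add _ _ hf hg
  zero_mem' := .zero _ _ _
  smul_mem' c f hf := .smul c f hf

/-- The subcategory generated by a set of homogeneous morphisms. -/
abbrev generatedSub (C : GrCat.{w, v} k) (S : Set C.Mor) : GrCat.{w, v} k where
  Obj := C.Obj
  Hom A B n := C.generatedSubmodule S A B n
  id A := ⟨C.id A, .id A⟩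
  comp h := LinearMap.mk₂ k (fun g f => ⟨C.comp h g.1 f.1, .comp h _ _ g.2 f.2⟩)
    (fun _ _ _ => Subtype.ext (by simp)) (fun _ _ _ => Subtype.ext (by simp))
    (fun _ _ _ => Subtype.ext (by simp)) (fun _ _ _ => Subtype.ext (by simp))
  id_comp h f := Subtype.ext (C.id_comp h f.1)
  comp_id h f := Subtype.ext (C.comp_id h f.1)
  assoc h₁ h₂ h₃ h₄ h g f := Subtype.ext (C.assoc h₁ h₂ h₃ h₄ h.1 g.1 f.1)

/-- The inclusion of the subcategory generated by a set of homogeneous morphisms. -/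
def generatedSubIncl (C : GrCat.{w, v} k) (S : Set C.Mor) :
    FunctorOver (C.generatedSub S) C fun A => A where
  map := (C.generatedSubmodule S _ _ _).subtype
  map_id _ := rfl
  map_comp _ _ _ := rfl

/-- The graded category `C` is freely generated by the morphisms `mor i`. -/
def IsFreeOn (C : GrCat.{u, u} k) {I : Type u} {src tgt : I → C.Obj}
    {deg : I → ℤ} (mor : ∀ i, C.Hom (src i) (tgt i) (deg i)) : Prop :=
  ∀ (E : GrCat.{u, u} k) (o : C.Obj → E.Obj) (φ : ∀ i, E.Hom (o (src i)) (o (tgt i)) (deg i)),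
    ∃! H : FunctorOver C E o, ∀ i, H.map (mor i) = φ i

/-- Freeness gives a functor from C to the subcategory generated by the `mor i`. Followed by the
inclusion it fixes the generators, so by uniqueness it is the identity, and every morphism lies in
the subcategory. -/
lemma IsFreeOn.generated {C : GrCat.{u, u} k} {I : Type u} {src tgt : I → C.Obj}
    {deg : I → ℤ} {mor : ∀ i, C.Hom (src i) (tgt i) (deg i)} (hC : C.IsFreeOn mor)
    {A B : C.Obj} {n : ℤ} (f : C.Hom A B n) :
    C.Generated (Set.range fun i => C.mor (mor i)) f := by
  obtain ⟨r, hr, -⟩ := hC (C.generatedSub (Set.range fun i => C.mor (mor i))) (fun A => A)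
    (fun i => ⟨mor i, .of _ ⟨i, rfl⟩⟩)
  have h : r.comp (C.generatedSubIncl _) = FunctorOver.id C := by
    refine (hC C (fun A => A) mor).unique (fun i => ?_) (fun i => rfl)
    rw [FunctorOver.comp_map, hr]
    rfl
  have h' : (r.comp (C.generatedSubIncl _)).map f = f := by
    rw [h]
    rfl
  rw [← h']
  exact (r.map f).2

/-- Induction principle for morphisms of a freely generated graded category. -/
lemma IsFreeOn.induction {C : GrCat.{u, u} k} {I : Type u} {src tgt : I → C.Obj}
    {deg : I → ℤ} {mor : ∀ i, C.Hom (src i) (tgt i) (deg i)} (hC : C.IsFreeOn mor)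
    {P : ∀ {A B : C.Obj} {n : ℤ}, C.Hom A B n → Prop} (of : ∀ i, P (mor i))
    (id : ∀ A, P (C.id A)) (zero : ∀ A B n, P (0 : C.Hom A B n))
    (add : ∀ {A B : C.Obj} {n : ℤ} (f g : C.Hom A B n), P f → P g → P (f + g))
    (smul : ∀ {A B : C.Obj} {n : ℤ} (c : k) (f : C.Hom A B n), P f → P (c • f))
    (comp : ∀ {A B D : C.Obj} {q p n : ℤ} (h : q + p = n) (g : C.Hom B D q) (f : C.Hom A B p),
      P g → P f → P (C.comp h g f)) {A B : C.Obj} {n : ℤ} (f : C.Hom A B n) : P f := by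
  induction hC.generated f with
  | of f hf =>
    obtain ⟨i, hi⟩ := hf
    cases hi
    exact of i
  | id A => exact id A
  | zero A B n => exact zero A B n
  | add f g _ _ hf hg => exact add f g hf hg
  | smul c f _ hf => exact smul c f hf
  | comp h g f _ _ hg hf => exact comp h g f hg hf

/-- Uniqueness in `IsFreeOn` is tested only against targets in the universe `u`; deduced from
generation, it holds for targets in every universe. -/
lemma IsFreeOn.functor_ext {C : GrCat.{u, u} k} {I : Type u} {src tgt : I → C.Obj}
    {deg : I → ℤ} {mor : ∀ i, C.Hom (src i) (tgt i) (deg i)} (hC : C.IsFreeOn mor)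
    {E : GrCat.{w, v} k} {o : C.Obj → E.Obj} {F G : FunctorOver C E o}
    (h : ∀ i, F.map (mor i) = G.map (mor i)) : F = G := by
  refine FunctorOver.ext fun A B n f => ?_
  refine FunctorOver.eq_of_generated (fun f hf => ?_) (hC.generated f)
  obtain ⟨i, hi⟩ := hf
  cases hi
  exact h i

end GrCat

/-! ### Words, free graded categories, and the equivalence of word bases with the universal
property. -/

namespace DGCat

variable {k : Type u} [CommRing k]

namespace Word

variable {O : Type w} {I : Type v} {src tgt : I → O} {deg : I → ℤ}

/-- Transport of a word along an equality of degrees. -/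
def castDeg {A B : O} {m n : ℤ} (h : m = n) (x : Word src tgt deg A B m) :
    Word src tgt deg A B n := h ▸ x

/-- Concatenation of words. -/
def append {B : O} : ∀ {D : O} {q : ℤ}, Word src tgt deg B D q →
    ∀ {A : O} {p n : ℤ}, q + p = n → Word src tgt deg A B p → Word src tgt deg A D n
  | _, _, .nil _, _, _, _, h, x => castDeg (by omega) x
  | _, _, .cons i y, _, _, _, h, x => castDeg (by omega) (.cons i (append y rfl x))

lemma nil_append {A B : O} {p : ℤ} (h : 0 + p = p) (x : Word src tgt deg A B p) :
    append (.nil B) h x = x := rfl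

lemma castDeg_append {A B D : O} {q q' p n : ℤ} (e : q = q') (y : Word src tgt deg B D q)
    (h : q' + p = n) (x : Word src tgt deg A B p) :
    append (castDeg e y) h x = append y (e ▸ h) x := by
  subst e
  rfl

lemma cons_append {A B : O} {i : I} {q p m n : ℤ} (y : Word src tgt deg B (src i) q)
    (h : deg i + q + p = n) (h' : q + p = m) (h'' : deg i + m = n) (x : Word src tgt deg A B p) :
    append (.cons i y) h x = castDeg h'' (.cons i (append y h' x)) := by
  subst h' h''
  rfl

lemma append_nil {A B : O} {p : ℤ} (h : p + 0 = p) (x : Word src tgt deg A B p) :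
    append x h (.nil A) = x := by
  induction x with
  | nil => rfl
  | cons i y ih =>
    rw [cons_append y _ (add_zero _) rfl, ih]
    rfl

lemma append_assoc {B D : O} {q p qp n : ℤ} (h₂ : q + p = qp) {A : O}
    (y : Word src tgt deg B D q) (z : Word src tgt deg A B p) :
    ∀ {E : O} {r rq : ℤ} (x : Word src tgt deg D E r) (h₁ : r + q = rq)
    (h₃ : rq + p = n) (h₄ : r + qp = n),
    append (append x h₁ y) h₃ z = append x h₄ (append y h₂ z) := by
  intro E r rq x
  induction x generalizing n rq with
  | nil =>
    intro h₁ h₃ h₄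
    obtain rfl : q = rq := by omega
    obtain rfl : qp = n := by omega
    rfl
  | @cons m i x ih =>
    intro h₁ h₃ h₄
    rw [cons_append x h₁ rfl (by omega), cons_append x h₄ rfl (by omega), castDeg_append,
      cons_append _ _ (show m + q + p = m + qp by omega) (by omega), ih _ _ rfl]

/-- The composite of the images of the letters of a word. -/
def lift (E : GrCat.{w', v'} k) (o : O → E.Obj) (φ : ∀ i, E.Hom (o (src i)) (o (tgt i)) (deg i))
    {A : O} : ∀ {B : O} {n : ℤ}, Word src tgt deg A B n → E.Hom (o A) (o B) n
  | _, _, .nil _ => E.id (o A)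
  | _, _, .cons i x => E.comp rfl (φ i) (lift E o φ x)

lemma lift_castDeg_cons (E : GrCat.{w', v'} k) (o : O → E.Obj)
    (φ : ∀ i, E.Hom (o (src i)) (o (tgt i)) (deg i)) {A : O} {i : I} {m n : ℤ}
    (e : deg i + m = n) (x : Word src tgt deg A (src i) m) :
    lift E o φ (castDeg e (.cons i x)) = E.comp e (φ i) (lift E o φ x) := by
  subst e
  rfl

lemma lift_append (E : GrCat.{w', v'} k) (o : O → E.Obj)
    (φ : ∀ i, E.Hom (o (src i)) (o (tgt i)) (deg i)) {A B D : O} {q p n : ℤ}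
    (y : Word src tgt deg B D q) (h : q + p = n) (x : Word src tgt deg A B p) :
    lift E o φ (append y h x) = E.comp h (lift E o φ y) (lift E o φ x) := by
  induction y generalizing n with
  | nil =>
    obtain rfl : p = n := by omega
    exact (E.id_comp h _).symm
  | cons i y ih =>
    rw [cons_append y h rfl (by omega), lift_castDeg_cons, ih, lift, E.assoc]

lemma eval_eq_lift (C : DGCat.{w, v} k) {I : Type v'} {src tgt : I → C.Obj} {deg : I → ℤ}
    (mor : ∀ i, C.Hom (src i) (tgt i) (deg i)) {A B : C.Obj} {n : ℤ}
    (x : Word src tgt deg A B n) : x.eval C mor = x.lift C.toGrCat (fun A => A) mor := by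
  induction x with
  | nil => rw [eval, lift]
  | cons i x ih => rw [eval, lift, ih]

end Word

section Free

variable {O I : Type u} (src tgt : I → O) (deg : I → ℤ)

variable (k) in
/-- The free graded category on a graded quiver. -/
noncomputable abbrev freeGr : GrCat.{u, u} k where
  Obj := O
  Hom A B n := Word src tgt deg A B n →₀ k
  id A := Finsupp.single (.nil A) 1
  comp h := Finsupp.linearCombination k fun y => Finsupp.lmapDomain k k fun x => y.append h x
  id_comp h f := by
    simp only [Finsupp.linearCombination_single, one_smul, Finsupp.lmapDomain_apply]
    exact Finsupp.mapDomain_id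
  comp_id h f := by
    induction f using Finsupp.induction_linear with
    | zero => simp
    | add f g hf hg => rw [map_add, LinearMap.add_apply, hf, hg]
    | single x c => simp [Finsupp.mapDomain_single, Word.append_nil]
  assoc h₁ h₂ h₃ h₄ h g f := by
    induction h using Finsupp.induction_linear with
    | zero => simp
    | add h h' ih ih' => simp only [map_add, LinearMap.add_apply, ih, ih']
    | single x a =>
    induction g using Finsupp.induction_linear with
    | zero => simp
    | add g g' ih ih' => simp only [map_add, LinearMap.add_apply, ih, ih']
    | single y b =>
    induction f using Finsupp.induction_linear with
    | zero => simp
    | add f f' ih ih' => simp only [map_add, ih, ih']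
    | single z c =>
      simp [-Finsupp.single_mul, Word.append_assoc h₂ y z x h₁ h₃ h₄, mul_assoc]

/-- The generators of the free graded category. -/
noncomputable def freeGen (i : I) : (freeGr k src tgt deg).Hom (src i) (tgt i) (deg i) :=
  Finsupp.single (Word.castDeg (add_zero _) (.cons i (.nil (src i)))) (1 : k)

variable {src tgt deg}

/-- The functor on a free graded category that is determined by the images of the generators. -/
noncomputable def freeLift (E : GrCat.{w, v} k) (o : O → E.Obj)
    (φ : ∀ i, E.Hom (o (src i)) (o (tgt i)) (deg i)) :
    GrCat.FunctorOver (freeGr k src tgt deg) E o where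
  map := Finsupp.linearCombination k fun x => x.lift E o φ
  map_id A := by simp [freeGr, Word.lift]
  map_comp h g f := by
    induction g using Finsupp.induction_linear with
    | zero => simp
    | add g g' ih ih' => simp only [map_add, LinearMap.add_apply, ih, ih']
    | single y b =>
    induction f using Finsupp.induction_linear with
    | zero => simp
    | add f f' ih ih' => simp only [map_add, ih, ih']
    | single z c =>
      simp [-Finsupp.single_mul, Word.lift_append, mul_smul, smul_comm c b]

lemma freeLift_gen (E : GrCat.{w, v} k) (o : O → E.Obj)
    (φ : ∀ i, E.Hom (o (src i)) (o (tgt i)) (deg i)) (i : I) :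
    (freeLift E o φ).map (freeGen src tgt deg i) = φ i := by
  simp [freeLift, freeGen, Word.lift_castDeg_cons, Word.lift, E.comp_id]

lemma single_cons {A : O} {n : ℤ} (i : I) (x : Word src tgt deg A (src i) n) :
    (Finsupp.single (.cons i x) 1 : Word src tgt deg A (tgt i) (deg i + n) →₀ k) =
      (freeGr k src tgt deg).comp rfl (freeGen src tgt deg i) (Finsupp.single x 1) := by
  simp [freeGr, freeGen, Finsupp.mapDomain_single, Word.castDeg_append,
    Word.cons_append _ _ (zero_add n) rfl, Word.nil_append]
  rfl

/-- Words span the morphisms, and by `single_cons` a nonempty word is a generator composed with a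
shorter word; functoriality then fixes the value on every word. -/
lemma freeGr_functor_map {E : GrCat.{w, v} k} {o : O → E.Obj}
    (F : GrCat.FunctorOver (freeGr k src tgt deg) E o) {A B : O} {n : ℤ}
    (f : (freeGr k src tgt deg).Hom A B n) :
    F.map f = (freeLift E o fun i => F.map (freeGen src tgt deg i)).map f := by
  induction f using Finsupp.induction_linear with
  | zero => simp
  | add g g' ih ih' => simp only [map_add, ih, ih']
  | single x c =>
    have e : (Finsupp.single x c : Word src tgt deg A B n →₀ k) = c • Finsupp.single x 1 := by simp
    rw [e]
    erw [map_smul, map_smul]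
    congr 1
    clear e
    induction x with
    | nil => exact (F.map_id _).trans ((freeLift E o fun i => F.map (freeGen src tgt deg i)).map_id _).symm
    | cons i x ih =>
      rw [single_cons]
      erw [F.map_comp, GrCat.FunctorOver.map_comp, freeLift_gen, ih]

variable (src tgt deg) in
lemma isFreeOn_freeGr : (freeGr k src tgt deg).IsFreeOn (freeGen src tgt deg) := fun E o φ =>
  ⟨freeLift E o φ, freeLift_gen E o φ, fun F hF => GrCat.FunctorOver.ext fun A B n f => by
    rw [freeGr_functor_map F f]
    simp only [hF]⟩

end Free

section WordBasis

variable {C : DGCat.{u, u} k} {I : Type u} {src tgt : I → C.Obj} {deg : I → ℤ}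
  {mor : ∀ i, C.Hom (src i) (tgt i) (deg i)}

lemma freeLift_id_map {A B : C.Obj} {n : ℤ} (f : Word src tgt deg A B n →₀ k) :
    (freeLift C.toGrCat (fun A => A) mor).map f =
      Finsupp.linearCombination k (fun x : Word src tgt deg A B n => x.eval C mor) f := by
  simp only [Word.eval_eq_lift]
  rfl

/-- A basis of words says that the functor `L` from the free graded category to C, which is the
identity on objects, is bijective on morphisms. The universal property is transported along its
inverse. -/
lemma isFreeOn_of_bijective (h : ∀ A B n, Function.Bijective (Finsupp.linearCombination k
    (fun x : Word src tgt deg A B n => x.eval C mor))) : C.toGrCat.IsFreeOn mor := by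
  intro E o φ
  let L := freeLift C.toGrCat (fun A => A) mor
  have hL : ∀ A B n, Function.Bijective (L.map (A := A) (B := B) (n := n)) := by
    intro A B n
    refine Eq.mpr ?_ (h A B n)
    congr 1
    funext f
    exact freeLift_id_map f
  let e := fun A B n => LinearEquiv.ofBijective _ (hL A B n)
  have he : ∀ A B n f, L.map ((e A B n).symm f) = f := fun A B n f => (e A B n).apply_symm_apply f
  have he' : ∀ A B n f, (e A B n).symm (L.map f) = f := fun A B n f =>
    (e A B n).symm_apply_apply f
  refine ⟨⟨(freeLift E o φ).map ∘ₗ (e _ _ _).symm.toLinearMap, fun A => ?_, fun h g f => ?_⟩,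
    fun i => ?_, fun F hF => GrCat.FunctorOver.ext fun A B n f => ?_⟩
  · change (freeLift E o φ).map ((e _ _ _).symm (C.id A)) = _
    rw [← L.map_id A, he', GrCat.FunctorOver.map_id]
  · change (freeLift E o φ).map ((e _ _ _).symm (C.comp h g f)) = E.comp h
      ((freeLift E o φ).map ((e _ _ _).symm g)) ((freeLift E o φ).map ((e _ _ _).symm f))
    obtain ⟨g, rfl⟩ := (hL _ _ _).2 g
    obtain ⟨f, rfl⟩ := (hL _ _ _).2 f
    rw [← L.map_comp h, he', he', he', GrCat.FunctorOver.map_comp]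
  · change (freeLift E o φ).map ((e _ _ _).symm (mor i)) = φ i
    rw [← freeLift_gen C.toGrCat (fun A => A) mor i, he', freeLift_gen]
  · change F.map f = (freeLift E o φ).map ((e _ _ _).symm f)
    obtain ⟨f, rfl⟩ := (hL _ _ _).2 f
    rw [he', ← GrCat.FunctorOver.comp_map L F, freeGr_functor_map]
    have hφ : (fun i => (L.comp F).map (freeGen src tgt deg i)) = φ := funext fun i =>
      (congrArg F.map (freeLift_gen C.toGrCat (fun A => A) mor i)).trans (hF i)
    exact congrArg (fun ψ => (freeLift E o ψ).map f) hφ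

/-- C and the free graded category on the same quiver have the same universal property, so the
functors between them that match the generators are mutually inverse. -/
lemma bijective_of_isFreeOn (hC : C.toGrCat.IsFreeOn mor) (A B : C.Obj) (n : ℤ) :
    Function.Bijective (Finsupp.linearCombination k
      (fun x : Word src tgt deg A B n => x.eval C mor)) := by
  obtain ⟨r, hr, -⟩ := hC (freeGr k src tgt deg) (fun A => A) (freeGen src tgt deg)
  have h₁ : (freeLift C.toGrCat (fun A => A) mor).comp r = GrCat.FunctorOver.id _ :=
    (isFreeOn_freeGr src tgt deg).functor_ext fun i => by
      rw [GrCat.FunctorOver.comp_map, freeLift_gen, hr]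
      rfl
  have h₂ : r.comp (freeLift C.toGrCat (fun A => A) mor) = GrCat.FunctorOver.id _ :=
    hC.functor_ext fun i => by
      rw [GrCat.FunctorOver.comp_map, hr, freeLift_gen]
      rfl
  refine Function.bijective_iff_has_inverse.2 ⟨r.map, fun f => ?_, fun f => ?_⟩
  · rw [← freeLift_id_map]
    exact congrArg (fun F => GrCat.FunctorOver.map F f) h₁
  · rw [← freeLift_id_map]
    exact congrArg (fun F => GrCat.FunctorOver.map F f) h₂

end WordBasis

lemma GeneratingSet.isFreeOn {C : DGCat.{u, u} k} (S : GeneratingSet C) :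
    C.toGrCat.IsFreeOn S.mor := isFreeOn_of_bijective S.free

end DGCat

/-! ### Derivations and differentials on free graded categories. -/

namespace GrCat

variable {k : Type u} [CommRing k]

/-- The union of two families of morphisms. -/
def sumMor {C : GrCat.{w, v} k} {I J : Type*} {src tgt : I → C.Obj} {deg : I → ℤ}
    {src' tgt' : J → C.Obj} {deg' : J → ℤ} (mor : ∀ i, C.Hom (src i) (tgt i) (deg i))
    (mor' : ∀ j, C.Hom (src' j) (tgt' j) (deg' j)) :
    ∀ i : I ⊕ J, C.Hom (Sum.elim src src' i) (Sum.elim tgt tgt' i) (Sum.elim deg deg' i)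
  | .inl i => mor i
  | .inr j => mor' j

/-- A multiplicative sign rule. -/
structure IsSign (a : ℤ → k) : Prop where
  zero : a 0 = 1
  add : ∀ m n, a (m + n) = a m * a n

lemma isSign_koszul : IsSign (koszul k) := ⟨koszul_zero k, koszul_add k⟩

lemma isSign_one : IsSign (fun _ => (1 : k)) := ⟨rfl, fun _ _ => (mul_one 1).symm⟩

/-- The graded category whose functors from `C` are the pairs of functors `F₁, F₂` from `C` to `X`
together with a derivation of degree `e` from `F₁` to `F₂`. -/
abbrev derivationCat {O : Type w} (X : GrCat.{w', v'} k) (o₁ o₂ : O → X.Obj) (e : ℤ) {a b : ℤ → k}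
    (ha : IsSign a) (hb : IsSign b) : GrCat.{w, v'} k where
  Obj := O
  Hom A B n := X.Hom (o₁ A) (o₁ B) n × X.Hom (o₂ A) (o₂ B) n × X.Hom (o₁ A) (o₂ B) (n + e)
  id A := (X.id (o₁ A), X.id (o₂ A), 0)
  comp {A B D q p n} h := LinearMap.mk₂ k (fun g f => (X.comp h g.1 f.1, X.comp h g.2.1 f.2.1,
      a q • X.comp (by omega) g.2.1 f.2.2 + b p • X.comp (by omega) g.2.2 f.1))
    (fun _ _ _ => by simp; abel) (fun c _ _ => by simp [smul_comm _ c])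
    (fun _ _ _ => by simp; abel) (fun c _ _ => by simp [smul_comm _ c])
  id_comp h f := by simp [X.id_comp, ha.zero]
  comp_id h f := by simp [X.comp_id, hb.zero]
  assoc {A B D E r q p rq qp n} h₁ h₂ h₃ h₄ h g f := by
    refine Prod.ext (X.assoc h₁ h₂ h₃ h₄ _ _ _) (Prod.ext (X.assoc h₁ h₂ h₃ h₄ _ _ _) ?_)
    simp only [LinearMap.mk₂_apply, map_add, map_smul, LinearMap.add_apply, LinearMap.smul_apply,
      smul_add, smul_smul]
    rw [X.assoc h₁ (show q + (p + e) = qp + e by omega) _ (by omega),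
      X.assoc (show r + (q + e) = rq + e by omega) (show q + e + p = qp + e by omega) _ (by omega),
      X.assoc (show r + e + q = rq + e by omega) h₂ _ (by omega), show a rq = a r * a q from h₁ ▸ ha.add r q,
      show b qp = b q * b p from h₂ ▸ hb.add q p,      mul_comm (b p) (a r), mul_comm (b p) (b q)]
    abel

/-- A derivation of degree `e` from `F₁` to `F₂`, with sign rule given by `a` and `b`. -/
structure Derivation {C : GrCat.{w, v} k} {X : GrCat.{w', v'} k} {o₁ o₂ : C.Obj → X.Obj}
    (F₁ : FunctorOver C X o₁) (F₂ : FunctorOver C X o₂) (e : ℤ) (a b : ℤ → k) where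
  map : ∀ {A B : C.Obj} {n m : ℤ}, n + e = m → (C.Hom A B n →ₗ[k] X.Hom (o₁ A) (o₂ B) m)
  map_id : ∀ (A : C.Obj) {m : ℤ} (h : 0 + e = m), map h (C.id A) = 0
  map_comp : ∀ {A B D : C.Obj} {q p n q' p' n' : ℤ} (h : q + p = n) (hq : q + e = q')
    (hp : p + e = p') (hn : n + e = n') (h₁ : q' + p = n') (h₂ : q + p' = n')
    (g : C.Hom B D q) (f : C.Hom A B p),
    map hn (C.comp h g f) = a q • X.comp h₂ (F₂.map g) (map hp f) +
      b p • X.comp h₁ (map hq g) (F₁.map f)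

lemma Derivation.eq_of_generated {C : GrCat.{w, v} k} {X : GrCat.{w', v'} k}
    {o₁ o₂ : C.Obj → X.Obj} {F₁ : FunctorOver C X o₁} {F₂ : FunctorOver C X o₂} {e : ℤ}
    {a b : ℤ → k} {τ τ' : Derivation F₁ F₂ e a b} {S : Set C.Mor}
    (hS : ∀ {A B : C.Obj} {n : ℤ} (f : C.Hom A B n), C.mor f ∈ S →
      ∀ {m : ℤ} (h : n + e = m), τ.map h f = τ'.map h f)
    {A B : C.Obj} {n : ℤ} {f : C.Hom A B n} (hf : C.Generated S f) {m : ℤ} (h : n + e = m) :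
    τ.map h f = τ'.map h f := by
  induction hf generalizing m with
  | of f hf => exact hS f hf h
  | id A => rw [τ.map_id, τ'.map_id]
  | zero A B n => rw [map_zero, map_zero]
  | add f g _ _ hf hg => rw [map_add, map_add, hf, hg]
  | smul c f _ hf => rw [map_smul, map_smul, hf]
  | comp h' g f _ _ hg hf =>
    rw [τ.map_comp h' rfl rfl h (by omega) (by omega), τ'.map_comp h' rfl rfl h (by omega) (by omega),
      hf, hg]

section

variable {C : GrCat.{u, u} k} {I : Type u} {src tgt : I → C.Obj} {deg : I → ℤ}
  {mor : ∀ i, C.Hom (src i) (tgt i) (deg i)} (hC : C.IsFreeOn mor)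

include hC in
lemma IsFreeOn.derivation_ext {X : GrCat.{w', v'} k}
    {o₁ o₂ : C.Obj → X.Obj} {F₁ : FunctorOver C X o₁} {F₂ : FunctorOver C X o₂} {e : ℤ}
    {a b : ℤ → k} {τ τ' : Derivation F₁ F₂ e a b}
    (hS : ∀ i {m : ℤ} (h : deg i + e = m), τ.map h (mor i) = τ'.map h (mor i))
    {A B : C.Obj} {n : ℤ} (f : C.Hom A B n) {m : ℤ} (h : n + e = m) :
    τ.map h f = τ'.map h f := by
  refine Derivation.eq_of_generated (fun f hf m h => ?_) (hC.generated f) h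
  obtain ⟨i, hi⟩ := hf
  cases hi
  exact hS i h

/-- The degree `e` component of a functor to `derivationCat`. -/
def derivationCatPart {O : Type w} {X : GrCat.{w', v'} k} {o₁ o₂ : O → X.Obj} {e : ℤ}
    {A B : O} {n m : ℤ} (h : n + e = m) : (X.Hom (o₁ A) (o₁ B) n × X.Hom (o₂ A) (o₂ B) n ×
      X.Hom (o₁ A) (o₂ B) (n + e)) →ₗ[k] X.Hom (o₁ A) (o₂ B) m :=
  h ▸ LinearMap.snd k _ _ ∘ₗ LinearMap.snd k _ _

include hC in
-- In `derivationCat` morphisms multiply like triangular matrices with diagonal in X, so the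
-- off-diagonal entry of a functor into it obeys a Leibniz rule. Freeness yields a functor with
-- given entries on generators. Separate degrees `deg'` let the values keep the form in which their
-- degrees are written, such as `S.deg i - 1`.
lemma IsFreeOn.exists_derivation {X : GrCat.{u, u} k} {o₁ o₂ : C.Obj → X.Obj}
    (F₁ : FunctorOver C X o₁) (F₂ : FunctorOver C X o₂) (e : ℤ) {a b : ℤ → k}
    (ha : IsSign a) (hb : IsSign b) (deg' : I → ℤ) (hdeg : ∀ i, deg i + e = deg' i)
    (s : ∀ i, X.Hom (o₁ (src i)) (o₂ (tgt i)) (deg' i)) :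
    ∃ τ : Derivation F₁ F₂ e a b, ∀ i, τ.map (hdeg i) (mor i) = s i := by
  obtain rfl : (fun i => deg i + e) = deg' := funext hdeg
  obtain ⟨Φ, hΦ, -⟩ := hC (derivationCat X o₁ o₂ e ha hb) (fun A => A)
    (fun i => (F₁.map (mor i), F₂.map (mor i), s i))
  let π₁ : FunctorOver (derivationCat X o₁ o₂ e ha hb) X o₁ :=
    { map := LinearMap.fst k _ _
      map_id := fun _ => rfl
      map_comp := fun _ _ _ => rfl }
  let π₂ : FunctorOver (derivationCat X o₁ o₂ e ha hb) X o₂ :=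
    { map := LinearMap.fst k _ _ ∘ₗ LinearMap.snd k _ _
      map_id := fun _ => rfl
      map_comp := fun _ _ _ => rfl }
  -- The diagonal entries of Φ agree with F₁ and F₂ on generators, hence everywhere; the Leibniz
  -- rule of the third entry is therefore taken with respect to F₁ and F₂.
  have h₁ : Φ.comp π₁ = F₁ := hC.functor_ext fun i => congrArg Prod.fst (hΦ i)
  have h₂ : Φ.comp π₂ = F₂ := hC.functor_ext fun i => congrArg (fun x => x.2.1) (hΦ i)
  have h₁' {A B : C.Obj} {n : ℤ} (f : C.Hom A B n) : (Φ.map f).1 = F₁.map f := by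
    rw [← h₁]
    rfl
  have h₂' {A B : C.Obj} {n : ℤ} (f : C.Hom A B n) : (Φ.map f).2.1 = F₂.map f := by
    rw [← h₂]
    rfl
  refine ⟨⟨fun h => derivationCatPart h ∘ₗ Φ.map, fun A m h => ?_, ?_⟩, fun i => ?_⟩
  · subst h
    exact congrArg (fun x => x.2.2) (Φ.map_id A)
  · intro A B D q p n q' p' n' h hq hp hn h₁ h₂ g f
    subst hq hp hn
    refine (congrArg (fun x => x.2.2) (Φ.map_comp h g f)).trans ?_
    rw [← h₁' f, ← h₂' g]
    rfl
  · exact congrArg (fun x => x.2.2) (hΦ i)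

end

/-- A map of degree `1` on a graded category that satisfies the Leibniz rule. -/
structure Differential (X : GrCat.{w, v} k) where
  d : ∀ {A B : X.Obj} {m n : ℤ}, m + 1 = n → (X.Hom A B m →ₗ[k] X.Hom A B n)
  leibniz : ∀ {A B C : X.Obj} {q p n q' p' n' : ℤ} (h : q + p = n) (hq : q + 1 = q')
    (hp : p + 1 = p') (hn : n + 1 = n') (h₁ : q' + p = n') (h₂ : q + p' = n')
    (g : X.Hom B C q) (f : X.Hom A B p),
    d hn (X.comp h g f) = X.comp h₁ (d hq g) f + koszul k q • X.comp h₂ g (d hp f)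

namespace Differential

variable {X : GrCat.{w, v} k} (δ : X.Differential)

lemma d_id (A : X.Obj) {n : ℤ} (h : 0 + 1 = n) : δ.d h (X.id A) = 0 := by
  subst h
  have := δ.leibniz (A := A) (add_zero 0) rfl rfl rfl (by norm_num) (by norm_num) (X.id A) (X.id A)
  simpa [X.id_comp, X.comp_id, koszul_zero] using this

/-- The differential determined by a derivation. -/
def ofDerivation
    (D : Derivation (FunctorOver.id X) (FunctorOver.id X) 1 (koszul k) (fun _ => 1)) :
    X.Differential where
  d := D.map
  leibniz h hq hp hn h₁ h₂ g f := by
    rw [D.map_comp h hq hp hn h₁ h₂, one_smul, add_comm]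
    rfl

end Differential

/-- Two functors that commute with differentials on generators commute with differentials. -/
lemma FunctorOver.map_d_of_generated {C : GrCat.{w, v} k} {X : GrCat.{w', v'} k}
    {o : C.Obj → X.Obj} (F : FunctorOver C X o) (δ : C.Differential) (δ' : X.Differential)
    {S : Set C.Mor} (hS : ∀ {A B : C.Obj} {n : ℤ} (f : C.Hom A B n), C.mor f ∈ S →
      ∀ {m : ℤ} (h : n + 1 = m), F.map (δ.d h f) = δ'.d h (F.map f))
    {A B : C.Obj} {n : ℤ} {f : C.Hom A B n} (hf : C.Generated S f) {m : ℤ} (h : n + 1 = m) :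
    F.map (δ.d h f) = δ'.d h (F.map f) := by
  induction hf generalizing m with
  | of f hf => exact hS f hf h
  | id A => rw [δ.d_id, F.map_id, δ'.d_id, map_zero]
  | zero A B n => simp only [map_zero]
  | add f g _ _ hf hg => rw [map_add, map_add, map_add, map_add, hf, hg]
  | smul c f _ hf => rw [map_smul, map_smul, map_smul, map_smul, hf]
  | comp h' g f _ _ hg hf =>
    rw [δ.leibniz h' rfl rfl h (by omega) (by omega), F.map_comp,
      δ'.leibniz h' rfl rfl h (by omega) (by omega), map_add, map_smul, F.map_comp, F.map_comp,
      hf, hg]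

/-- In d²(gf) the two terms dg · df carry the signs (-1)^{|g|+1} and (-1)^{|g|} and cancel, so the
vanishing of d² is inherited by composites. -/
lemma IsFreeOn.d_d {C : GrCat.{u, u} k} {I : Type u} {src tgt : I → C.Obj} {deg : I → ℤ}
    {mor : ∀ i, C.Hom (src i) (tgt i) (deg i)} (hC : C.IsFreeOn mor) (δ : C.Differential)
    (h : ∀ i {m n : ℤ} (h : deg i + 1 = m) (h' : m + 1 = n), δ.d h' (δ.d h (mor i)) = 0)
    {A B : C.Obj} {l m n : ℤ} (hm : l + 1 = m) (hn : m + 1 = n) (f : C.Hom A B l) :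
    δ.d hn (δ.d hm f) = 0 := by
  refine hC.induction (P := fun {A B l} f => ∀ (m n : ℤ) (hm : l + 1 = m) (hn : m + 1 = n),
    δ.d hn (δ.d hm f) = 0) (fun i m n => h i) ?_ ?_ ?_ ?_ ?_ f m n hm hn
  · intro A m n hm hn
    rw [δ.d_id, map_zero]
  · intro A B l m n hm hn
    rw [map_zero, map_zero]
  · intro A B l f g hf hg m n hm hn
    rw [map_add, map_add, hf, hg, add_zero]
  · intro A B l c f hf m n hm hn
    rw [map_smul, map_smul, hf, smul_zero]
  · intro A B D q p l h g f hg hf m n hm hn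
    rw [δ.leibniz h rfl rfl hm (by omega) (by omega), map_add, map_smul,
      δ.leibniz (q' := q + 1 + 1) (p' := p + 1) _ rfl rfl hn (by omega) (by omega),
      δ.leibniz (q' := q + 1) (p' := p + 1 + 1) _ rfl rfl hn (by omega) (by omega),
      hg _ _ rfl rfl, hf _ _ rfl rfl, koszul_add, koszul_one]
    simp

/-- If `T` is natural up to the homotopy `τ` on generators, then on all morphisms. -/
lemma IsFreeOn.d_homotopy {C : GrCat.{u, u} k} {I : Type u} {src tgt : I → C.Obj} {deg : I → ℤ}
    {mor : ∀ i, C.Hom (src i) (tgt i) (deg i)} (hC : C.IsFreeOn mor) (δ : C.Differential)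
    {X : GrCat.{w, v} k} (δ' : X.Differential) {o₁ o₂ : C.Obj → X.Obj} {F₁ : FunctorOver C X o₁}
    {F₂ : FunctorOver C X o₂}
    (h₁ : ∀ {A B : C.Obj} {n m : ℤ} (h : n + 1 = m) (f : C.Hom A B n),
      F₁.map (δ.d h f) = δ'.d h (F₁.map f))
    (h₂ : ∀ {A B : C.Obj} {n m : ℤ} (h : n + 1 = m) (f : C.Hom A B n),
      F₂.map (δ.d h f) = δ'.d h (F₂.map f))
    (T : ∀ A, X.Hom (o₁ A) (o₂ A) 0)
    (τ : Derivation F₁ F₂ (-1) (fun _ => 1) (koszul k))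
    (h : ∀ i {m l n' : ℤ} (hm : deg i + -1 = m) (hl : deg i + 1 = l) (hmn : m + 1 = n')
      (hln : l + -1 = n') (hn : deg i + 0 = n') (hn' : 0 + deg i = n'),
      δ'.d hmn (τ.map hm (mor i)) = koszul k (deg i) • (X.comp hn (F₂.map (mor i)) (T (src i)) -
        X.comp hn' (T (tgt i)) (F₁.map (mor i))) + τ.map hln (δ.d hl (mor i)))
    {A B : C.Obj} {n : ℤ} (f : C.Hom A B n) {m l n' : ℤ} (hm : n + -1 = m) (hl : n + 1 = l)
    (hmn : m + 1 = n') (hln : l + -1 = n') (hn : n + 0 = n') (hn' : 0 + n = n') :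
    δ'.d hmn (τ.map hm f) = koszul k n • (X.comp hn (F₂.map f) (T A) -
        X.comp hn' (T B) (F₁.map f)) + τ.map hln (δ.d hl f) := by
  refine hC.induction (P := fun {A B n} f => ∀ (m l n' : ℤ) (hm : n + -1 = m) (hl : n + 1 = l)
    (hmn : m + 1 = n') (hln : l + -1 = n') (hn : n + 0 = n') (hn' : 0 + n = n'),
    δ'.d hmn (τ.map hm f) = koszul k n • (X.comp hn (F₂.map f) (T A) -
        X.comp hn' (T B) (F₁.map f)) + τ.map hln (δ.d hl f))
    (fun i m l n' => h i) ?_ ?_ ?_ ?_ ?_ f m l n' hm hl hmn hln hn hn'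
  · intro A m l n' hm hl hmn hln hn hn'
    obtain rfl : n' = 0 := by omega
    rw [δ.d_id, F₁.map_id, F₂.map_id, τ.map_id, X.id_comp, X.comp_id]
    simp
  · intro A B l m l n' hm hl hmn hln hn hn'
    simp
  · intro A B l f g hf hg m l n' hm hl hmn hln hn hn'
    simp only [map_add, hf _ _ _ hm hl hmn hln hn hn', hg _ _ _ hm hl hmn hln hn hn',
      LinearMap.add_apply, smul_sub, smul_add]
    abel
  · intro A B l c f hf m l n' hm hl hmn hln hn hn'
    simp only [map_smul, hf _ _ _ hm hl hmn hln hn hn', LinearMap.smul_apply, smul_sub, smul_add,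
      smul_comm c]
  -- The mixed term F₂(g) T F₁(f) arises from both summands of τ(gf), with opposite signs, and
  -- cancels. The outer terms give the naturality defect of T at gf, and the others assemble to
  -- τ(d(gf)).
  · intro A B D q p n h g f hg hf m l n' hm hl hmn hln hn hn'
    rw [τ.map_comp h (show q + -1 = q - 1 by omega) (show p + -1 = p - 1 by omega) hm (by omega)
      (by omega), map_add, map_smul, map_smul,
      δ'.leibniz (q' := q + 1) (p' := p) _ rfl (by omega) hmn (by omega) (by omega),
      δ'.leibniz (q' := q) (p' := p + 1) _ (by omega) rfl hmn (by omega) (by omega),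
      hf _ (p + 1) p (by omega) rfl (by omega) (by omega) (by omega) (by omega),
      hg _ (q + 1) q (by omega) rfl (by omega) (by omega) (by omega) (by omega),
      δ.leibniz h rfl rfl hl (by omega) (by omega), map_add (τ.map hln), map_smul (τ.map hln),
      τ.map_comp (q' := q) (p' := p - 1) _ (by omega) (by omega) hln (by omega) (by omega),
      τ.map_comp (q' := q - 1) (p' := p) _ (by omega) (by omega) hln (by omega) (by omega),
      F₁.map_comp, F₂.map_comp, ← h₁, ← h₂]
    simp only [map_add, map_sub, map_smul, LinearMap.add_apply, LinearMap.sub_apply,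
      LinearMap.smul_apply, smul_add, smul_sub, smul_smul, one_smul, one_mul]
    rw [X.assoc (rq := n) (qp := p) h (by omega) hn (by omega),
      X.assoc (rq := q) (qp := p) (by omega) (by omega) (by omega) (by omega),
      X.assoc (rq := q) (qp := n) (by omega) h (by omega) (by omega),
      show koszul k n = koszul k q * koszul k p from h ▸ koszul_add k q p,
      show koszul k (q - 1) = -koszul k q by rw [koszul_sub, koszul_one, mul_neg_one],
      show koszul k (p + 1) = -koszul k p by rw [koszul_add, koszul_one, mul_neg_one]]
    simp only [mul_comm (koszul k p), neg_mul, neg_smul, mul_neg]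
    abel

end GrCat

namespace GrCat.Derivation

variable {k : Type u} [CommRing k] {C : GrCat.{w, v} k} {X : GrCat.{w', v'} k}
  {Y : GrCat.{w'', v''} k} {e : ℤ} {a b : ℤ → k}

/-- The composite of a derivation with a functor on the target. -/
def postcomp {o₁ o₂ : C.Obj → X.Obj} {F₁ : FunctorOver C X o₁} {F₂ : FunctorOver C X o₂}
    (τ : Derivation F₁ F₂ e a b) {o : X.Obj → Y.Obj} (G : FunctorOver X Y o) :
    Derivation (F₁.comp G) (F₂.comp G) e a b where
  map h := G.map ∘ₗ τ.map h
  map_id A _ h := by simp [τ.map_id]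
  map_comp h hq hp hn h₁ h₂ g f := by
    simp [τ.map_comp h hq hp hn h₁ h₂, G.map_comp]

/-- The composite of a derivation with a functor on the source. -/
def precomp {o : C.Obj → X.Obj} (G : FunctorOver C X o) {o₁ o₂ : X.Obj → Y.Obj}
    {F₁ : FunctorOver X Y o₁} {F₂ : FunctorOver X Y o₂} (τ : Derivation F₁ F₂ e a b) :
    Derivation (G.comp F₁) (G.comp F₂) e a b where
  map h := τ.map h ∘ₗ G.map
  map_id A _ h := by simp [G.map_id, τ.map_id]
  map_comp h hq hp hn h₁ h₂ g f := by
    simp [τ.map_comp h hq hp hn h₁ h₂, G.map_comp]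

/-- The zero derivation. -/
def zero {o₁ o₂ : C.Obj → X.Obj} (F₁ : FunctorOver C X o₁) (F₂ : FunctorOver C X o₂) (e : ℤ)
    (a b : ℤ → k) : Derivation F₁ F₂ e a b where
  map _ := 0
  map_id _ _ _ := rfl
  map_comp _ _ _ _ _ _ _ _ := by simp

end GrCat.Derivation

namespace GrCat

variable {k : Type u} [CommRing k]

lemma FunctorOver.congr_map {C : GrCat.{w, v} k} {D : GrCat.{w', v'} k} {o : C.Obj → D.Obj}
    {F G : FunctorOver C D o} (h : F = G) {A B : C.Obj} {n : ℤ} (f : C.Hom A B n) :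
    F.map f = G.map f := by
  rw [h]

lemma comp_id_sub_id_comp (C : GrCat.{w, v} k) {A B : C.Obj} {n m : ℤ} (f : C.Hom A B n)
    (h : n + 0 = m) (h' : 0 + n = m) : C.comp h f (C.id A) - C.comp h' (C.id B) f = 0 := by
  obtain rfl : n = m := by omega
  rw [C.comp_id, C.id_comp, sub_self]

/-- An equality in `Mor` also compares sources and targets, whereas `IsProjection` only asks that
values vanish in their own morphism spaces. The equalities of objects reconcile the two forms. -/
lemma mor_eq_mor_zero {C : GrCat.{w, v} k} {A B A' B' : C.Obj} {n : ℤ} {f : C.Hom A B n}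
    (hA : A = A') (hB : B = B') : C.mor f = C.mor (0 : C.Hom A' B' n) ↔ f = 0 := by
  subst hA hB
  exact ⟨mor_inj, fun h => congrArg C.mor h⟩

end GrCat

namespace DGFunctor

variable {k : Type u} [CommRing k] {C : DGCat.{w, v} k} {D : DGCat.{w', v'} k}

/-- The action of a dg functor on the type of all homogeneous morphisms. -/
def mapMor (F : DGFunctor C D) (f : C.Mor) : D.Mor := D.mor (F.map f.2.2.2)

lemma map_heq {F G : DGFunctor C D} (h : F = G) {A B : C.Obj} {n : ℤ} (f : C.Hom A B n) :
    HEq (F.map f) (G.map f) := by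
  subst h
  rfl

end DGFunctor

namespace DGCat

variable {k : Type u} [CommRing k]

/-- The differential of a dg category. -/
def differential (C : DGCat.{w, v} k) : C.toGrCat.Differential where
  d := C.d
  leibniz := C.leibniz

section Coprod

variable {C D : DGCat.{w, v} k} {E : GrCat.{w', v'} k} {o : C.Obj ⊕ D.Obj → E.Obj}

/-- The action on morphisms of the functor on a coproduct with given components. -/
def grDescMap (F : GrCat.FunctorOver C.toGrCat E fun A => o (.inl A))
    (G : GrCat.FunctorOver D.toGrCat E fun A => o (.inr A)) : ∀ (A B : C.Obj ⊕ D.Obj) (n : ℤ),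
    CoprodHom C D A B n →ₗ[k] E.Hom (o A) (o B) n
  | .inl _, .inl _, _ => F.map
  | .inr _, .inr _, _ => G.map
  | .inl _, .inr _, _ => 0
  | .inr _, .inl _, _ => 0

/-- The functor of graded categories on a coproduct with given components. -/
def grDesc (F : GrCat.FunctorOver C.toGrCat E fun A => o (.inl A))
    (G : GrCat.FunctorOver D.toGrCat E fun A => o (.inr A)) :
    GrCat.FunctorOver (coprod C D).toGrCat E o where
  map := grDescMap F G _ _ _
  map_id := by
    rintro (A | A)
    exacts [F.map_id A, G.map_id A]
  map_comp := by
    rintro (A | A) (B | B) (X | X) q p n h g f <;>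
      first
        | exact F.map_comp h g f
        | exact G.map_comp h g f
        | exact (LinearMap.map_zero (E.comp h _)).symm
        | exact (LinearMap.map_zero₂ (E.comp h) _).symm
        | exact F.map.map_zero.trans (LinearMap.map_zero (E.comp h _)).symm
        | exact G.map.map_zero.trans (LinearMap.map_zero (E.comp h _)).symm

lemma desc_map_mem_range {X : DGCat.{w, v} k} (i₁ : C ⟶ X) (i₂ : D ⟶ X)
    {A B : (coprod C D).Obj} {n : ℤ} (f : (coprod C D).Hom A B n) {P : Set X.Mor}
    (h₁ : ∀ {A B : C.Obj} {n : ℤ} (f : C.Hom A B n), X.Generated P (i₁.map f))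
    (h₂ : ∀ {A B : D.Obj} {n : ℤ} (f : D.Hom A B n), X.Generated P (i₂.map f)) :
    X.Generated P ((desc i₁ i₂).map f) := by
  rcases A with A | A <;> rcases B with B | B
  exacts [h₁ f, .zero _ _ _, .zero _ _ _, h₂ f]

end Coprod

/-! ### The operation θ ↦ t_θ as a derivation, and cylinder data. -/

section Cylinder

variable {C X : DGCat.{u, u, u} k}

section tMor

variable (S : GeneratingSet C) (i₁ i₂ : C ⟶ X)
    (t : ∀ i, X.Hom (i₁.obj (S.src i)) (i₂.obj (S.tgt i)) (S.deg i - 1))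

lemma exists_tDerivation : ∃ τ : GrCat.Derivation i₁.toGr i₂.toGr (-1) (fun _ => 1) (koszul k),
    ∀ i, τ.map (sub_eq_add_neg _ _).symm (S.mor i) = t i :=
  S.isFreeOn.exists_derivation i₁.toGr i₂.toGr (-1) GrCat.isSign_one GrCat.isSign_koszul
    (fun i => S.deg i - 1) (fun _ => (sub_eq_add_neg _ _).symm) t

/-- The operation `θ ↦ t_θ` as a derivation. -/
noncomputable def tDerivation :
    GrCat.Derivation i₁.toGr i₂.toGr (-1) (fun _ => (1 : k)) (koszul k) :=
  (exists_tDerivation S i₁ i₂ t).choose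

lemma tDerivation_mor (i : S.I) :
    (tDerivation S i₁ i₂ t).map (sub_eq_add_neg _ _).symm (S.mor i) = t i :=
  (exists_tDerivation S i₁ i₂ t).choose_spec i

lemma tDerivation_eval {A B : C.Obj} {n : ℤ} (x : Word S.src S.tgt S.deg A B n) :
    (tDerivation S i₁ i₂ t).map (sub_eq_add_neg _ _).symm (x.eval C S.mor) =
      tWord S i₁ i₂ t x := by
  induction x with
  | nil => rw [Word.eval, tWord, GrCat.Derivation.map_id]
  | cons i x ih =>
    rw [Word.eval, tWord, GrCat.Derivation.map_comp _ _ (sub_eq_add_neg _ _).symm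
      (sub_eq_add_neg _ _).symm _ (by omega) (by omega), ih, tDerivation_mor, one_smul]

/-- The recursion defining `tWord` is the Leibniz rule for splitting off the last letter of a word.
Consequently the formula also holds for composites of arbitrary morphisms, not only of generators.
-/
lemma tMor_eq {A B : C.Obj} {n : ℤ} (θ : C.Hom A B n) :
    tMor S i₁ i₂ t θ = (tDerivation S i₁ i₂ t).map (sub_eq_add_neg _ _).symm θ := by
  obtain ⟨x, rfl⟩ := (S.free A B n).2 θ
  rw [tMor]
  have : (LinearEquiv.ofBijective _ (S.free A B n)).symm (Finsupp.linearCombination k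
      (fun x : Word S.src S.tgt S.deg A B n => x.eval C S.mor) x) = x :=
    (LinearEquiv.ofBijective _ (S.free A B n)).symm_apply_apply x
  rw [this]
  clear this
  induction x using Finsupp.induction_linear with
  | zero => simp
  | add f g hf hg => rw [map_add, map_add, map_add, hf, hg]
  | single x c =>
    rw [Finsupp.linearCombination_single, Finsupp.linearCombination_single, map_smul,
      tDerivation_eval]

lemma tMor_mor (i : S.I) : tMor S i₁ i₂ t (S.mor i) = t i := by
  rw [tMor_eq, tDerivation_mor]

variable {S i₁ i₂ t} in
-- This is how t_θ is recognised in other guises: any derivation with the same sign rule and the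
-- same values on the generators computes it.
lemma tMor_eq_of_derivation
    {τ : GrCat.Derivation i₁.toGr i₂.toGr (-1) (fun _ => (1 : k)) (koszul k)}
    (h : ∀ i, τ.map (sub_eq_add_neg _ _).symm (S.mor i) = t i) {A B : C.Obj} {n : ℤ}
    (θ : C.Hom A B n) : tMor S i₁ i₂ t θ = τ.map (sub_eq_add_neg _ _).symm θ := by
  rw [tMor_eq]
  refine S.isFreeOn.derivation_ext (fun i m hm => ?_) θ _
  obtain rfl : S.deg i - 1 = m := by omega
  exact (tDerivation_mor S i₁ i₂ t i).trans (h i).symm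

lemma tMor_zero {A B : C.Obj} {n : ℤ} (θ : C.Hom A B n) :
    tMor S i₁ i₂ (fun _ => 0) θ = 0 :=
  tMor_eq_of_derivation (τ := GrCat.Derivation.zero _ _ _ _ _) (fun _ => rfl) θ

lemma map_tMor {Y : DGCat.{u, u, u} k} (G : X ⟶ Y) {A B : C.Obj} {n : ℤ} (θ : C.Hom A B n) :
    G.map (tMor S i₁ i₂ t θ) = tMor S (i₁ ≫ G) (i₂ ≫ G) (fun i => G.map (t i)) θ := by
  refine (congrArg G.map (tMor_eq S i₁ i₂ t θ)).trans (Eq.symm ?_)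
  exact tMor_eq_of_derivation (i₁ := i₁ ≫ G) (i₂ := i₂ ≫ G)
    (τ := (tDerivation S i₁ i₂ t).postcomp G.toGr)
    (fun i => congrArg G.map (tDerivation_mor S i₁ i₂ t i)) θ

/-- The left side is a derivation in θ along F, so its values on the generators of C determine it. F
may send a generator to any morphism of D, so nothing links the words of S with those of T. -/
lemma tMor_map {D : DGCat.{u, u, u} k} (T : GeneratingSet D) (j₁ j₂ : D ⟶ X)
    (s : ∀ i, X.Hom (j₁.obj (T.src i)) (j₂.obj (T.tgt i)) (T.deg i - 1)) (F : C ⟶ D)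
    {A B : C.Obj} {n : ℤ} (θ : C.Hom A B n) :
    tMor T j₁ j₂ s (F.map θ) =
      tMor S (F ≫ j₁) (F ≫ j₂) (fun i => tMor T j₁ j₂ s (F.map (S.mor i))) θ := by
  refine (tMor_eq T j₁ j₂ s (F.map θ)).trans (Eq.symm ?_)
  exact tMor_eq_of_derivation (i₁ := F ≫ j₁) (i₂ := F ≫ j₂)
    (τ := (tDerivation T j₁ j₂ s).precomp F.toGr)
    (fun i => (tMor_eq T j₁ j₂ s (F.map (S.mor i))).symm) θ

variable {S i₁ i₂ t} in
lemma tMor_congr {a₁ a₂ : C ⟶ X} (h₁ : i₁ = a₁) (h₂ : i₂ = a₂)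
    {s : ∀ i, X.Hom (a₁.obj (S.src i)) (a₂.obj (S.tgt i)) (S.deg i - 1)}
    (h : ∀ i, X.mor (t i) = X.mor (s i)) {A B : C.Obj} {n : ℤ} (θ : C.Hom A B n) :
    X.mor (tMor S i₁ i₂ t θ) = X.mor (tMor S a₁ a₂ s θ) := by
  subst h₁ h₂
  obtain rfl : t = s := funext fun i => GrCat.mor_inj (h i)
  rfl

end tMor

/-- The morphisms of a cylinder together with their differentials, without freeness. -/
structure CylinderData (S : GeneratingSet C) (i₁ i₂ : C ⟶ X) where
  t : ∀ A, X.Hom (i₁.obj A) (i₂.obj A) 0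
  t' : ∀ A, X.Hom (i₂.obj A) (i₁.obj A) 0
  tHat : ∀ A, X.Hom (i₁.obj A) (i₁.obj A) (-1)
  tCheck : ∀ A, X.Hom (i₂.obj A) (i₂.obj A) (-1)
  tBar : ∀ A, X.Hom (i₁.obj A) (i₂.obj A) (-2)
  tGen : ∀ i, X.Hom (i₁.obj (S.src i)) (i₂.obj (S.tgt i)) (S.deg i - 1)
  d_t : ∀ A, X.d (zero_add 1) (t A) = 0
  d_t' : ∀ A, X.d (zero_add 1) (t' A) = 0
  d_tHat : ∀ A, X.d (neg_add_cancel 1) (tHat A) =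
    X.id (i₁.obj A) - X.comp (add_zero 0) (t' A) (t A)
  d_tCheck : ∀ A, X.d (neg_add_cancel 1) (tCheck A) =
    X.id (i₂.obj A) - X.comp (add_zero 0) (t A) (t' A)
  d_tBar : ∀ A, X.d (show (-2 : ℤ) + 1 = -1 by norm_num) (tBar A) =
    X.comp (zero_add (-1)) (t A) (tHat A) - X.comp (add_zero (-1)) (tCheck A) (t A)
  d_tGen : ∀ i, X.d (show S.deg i - 1 + 1 = S.deg i + 1 - 1 by omega) (tGen i) =
    koszul k (S.deg i) •
      (X.comp (by omega) (i₂.map (S.mor i)) (t (S.src i)) -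
        X.comp (by omega) (t (S.tgt i)) (i₁.map (S.mor i))) +
    tMor S i₁ i₂ tGen (C.d rfl (S.mor i))

/-- The cylinder data underlying a cylinder. -/
def Cylinder.data {S : GeneratingSet C} {i₁ i₂ : C ⟶ X} (P : Cylinder S i₁ i₂) :
    CylinderData S i₁ i₂ := { P with }

/-- A dg functor is compatible with cylinder data. -/
structure CylinderData.IsMap {Y : DGCat.{u, u, u} k} {S : GeneratingSet C} {i₁ i₂ : C ⟶ X}
    {a₁ a₂ : C ⟶ Y} (K : CylinderData S i₁ i₂) (L : CylinderData S a₁ a₂) (G : X ⟶ Y) : Prop where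
  comp_i₁ : i₁ ≫ G = a₁
  comp_i₂ : i₂ ≫ G = a₂
  map_t : ∀ A, Y.mor (G.map (K.t A)) = Y.mor (L.t A)
  map_t' : ∀ A, Y.mor (G.map (K.t' A)) = Y.mor (L.t' A)
  map_tHat : ∀ A, Y.mor (G.map (K.tHat A)) = Y.mor (L.tHat A)
  map_tCheck : ∀ A, Y.mor (G.map (K.tCheck A)) = Y.mor (L.tCheck A)
  map_tBar : ∀ A, Y.mor (G.map (K.tBar A)) = Y.mor (L.tBar A)
  map_tGen : ∀ i, Y.mor (G.map (K.tGen i)) = Y.mor (L.tGen i)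

namespace CylinderData

variable {S : GeneratingSet C} {i₁ i₂ : C ⟶ X} (K : CylinderData S i₁ i₂)

/-- The prescribed dt_f says that t is natural up to the homotopy t_f on generators; this property
is stable under composition and linear combinations. -/
lemma d_tMor {A B : C.Obj} {n : ℤ} (θ : C.Hom A B n) :
    X.d (show n - 1 + 1 = n + 1 - 1 by omega) (tMor S i₁ i₂ K.tGen θ) = koszul k n •
      (X.comp (by omega) (i₂.map θ) (K.t A) - X.comp (by omega) (K.t B) (i₁.map θ)) +
      tMor S i₁ i₂ K.tGen (C.d rfl θ) := by
  rw [tMor_eq, tMor_eq]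
  refine S.isFreeOn.d_homotopy C.differential X.differential i₁.map_d i₂.map_d
    K.t (tDerivation S i₁ i₂ K.tGen) ?_ θ _ _ _ _ _ _
  intro i m l n' hm hl hmn hln hn hn'
  subst hl
  obtain rfl : S.deg i - 1 = m := by omega
  obtain rfl : S.deg i + 1 - 1 = n' := by omega
  have h := K.d_tGen i
  rw [tMor_eq] at h
  rw [tDerivation_mor]
  exact h

/-- The cylinder data obtained from the cylinder of `D` and a dg functor `C ⟶ D`. -/
noncomputable def pullback {D : DGCat.{u, u, u} k} {T : GeneratingSet D} {j₁ j₂ : D ⟶ X}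
    (L : CylinderData T j₁ j₂) (S : GeneratingSet C) (F : C ⟶ D) :
    CylinderData S (F ≫ j₁) (F ≫ j₂) where
  t A := L.t (F.obj A)
  t' A := L.t' (F.obj A)
  tHat A := L.tHat (F.obj A)
  tCheck A := L.tCheck (F.obj A)
  tBar A := L.tBar (F.obj A)
  tGen i := tMor T j₁ j₂ L.tGen (F.map (S.mor i))
  d_t A := L.d_t _
  d_t' A := L.d_t' _
  d_tHat A := L.d_tHat _
  d_tCheck A := L.d_tCheck _
  d_tBar A := L.d_tBar _
  d_tGen i := by
    -- The element F(f) need not be a generator of D, so the formula for dt_θ with arbitrary θ is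
    -- required.
    refine (L.d_tMor (F.map (S.mor i))).trans ?_
    congr 1
    rw [← F.map_d]
    exact tMor_map S T j₁ j₂ L.tGen F _

variable (S) in
/-- The cylinder data that defines the projection of a cylinder. -/
def proj : CylinderData S (𝟙 C) (𝟙 C) where
  t A := C.id A
  t' A := C.id A
  tHat _ := 0
  tCheck _ := 0
  tBar _ := 0
  tGen _ := 0
  d_t A := C.d_id A _
  d_t' A := C.d_id A _
  d_tHat A := ((C.d _).map_zero).trans (sub_eq_zero.2 (C.id_comp _ _).symm).symm
  d_tCheck A := ((C.d _).map_zero).trans (sub_eq_zero.2 (C.id_comp _ _).symm).symm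
  d_tBar A := by
    refine ((C.d _).map_zero).trans ?_
    exact (sub_eq_zero.2 ((C.comp _ _).map_zero.trans
      (LinearMap.map_zero₂ (C.comp _) _).symm)).symm
  d_tGen i := by
    refine ((C.d _).map_zero).trans ?_
    rw [tMor_zero, add_zero]
    exact (smul_eq_zero_of_right _ (C.comp_id_sub_id_comp (S.mor i) _ _)).symm

end CylinderData

/-! ### Objects, free generators and semifreeness of a cylinder. -/

namespace Cylinder

variable {S : GeneratingSet C} {i₁ i₂ : C ⟶ X} (P : Cylinder S i₁ i₂)

/-- The generating morphisms of a cylinder that are not in the copies of `C`. -/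
abbrev mor : ∀ j : CylIndex S, X.Hom (j.src i₁ i₂) (j.tgt i₁ i₂) j.deg :=
  CylIndex.mor P.t P.t' P.tHat P.tCheck P.tBar P.tGen

/-- All generating morphisms of a cylinder. -/
abbrev gen := GrCat.sumMor (GrCat.sumMor (fun i => i₁.map (S.mor i)) fun i => i₂.map (S.mor i))
  P.mor

include P in
lemma obj_surjective : Function.Surjective (desc i₁ i₂).obj := by
  have h := P.semifree.isCompl.sup_eq_top
  rw [Set.bot_eq_empty.symm, sup_bot_eq] at h
  exact Set.range_eq_univ.1 h

include P in
lemma obj_cases (Z : X.Obj) : (∃ A, Z = i₁.obj A) ∨ ∃ A, Z = i₂.obj A := by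
  obtain ⟨A | A, rfl⟩ := P.obj_surjective Z
  exacts [.inl ⟨A, rfl⟩, .inr ⟨A, rfl⟩]

include P in
-- With no added objects, the inclusions identify the objects with two disjoint copies of those of
-- C. The prescribed maps are recovered as equalities of functions, so that they can be substituted
-- later.
lemma exists_obj {O : Type*} (o₁ o₂ : C.Obj → O) :
    ∃ o : X.Obj → O, (fun A => o (i₁.obj A)) = o₁ ∧ (fun A => o (i₂.obj A)) = o₂ := by
  have h := Function.leftInverse_surjInv ⟨P.semifree.obj_injective, P.obj_surjective⟩
  refine ⟨fun Z => Sum.elim o₁ o₂ (Function.surjInv P.obj_surjective Z), ?_, ?_⟩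
  · funext A
    exact congrArg (Sum.elim o₁ o₂) (h (.inl A))
  · funext A
    exact congrArg (Sum.elim o₁ o₂) (h (.inr A))

lemma exists_functor (E : GrCat.{u, u, u} k) (o : X.Obj → E.Obj)
    (G₁ : GrCat.FunctorOver C.toGrCat E fun A => o (i₁.obj A))
    (G₂ : GrCat.FunctorOver C.toGrCat E fun A => o (i₂.obj A))
    (φ : ∀ j : CylIndex S, E.Hom (o (j.src i₁ i₂)) (o (j.tgt i₁ i₂)) j.deg) :
    ∃ H : GrCat.FunctorOver X.toGrCat E o,
      i₁.toGr.comp H = G₁ ∧ i₂.toGr.comp H = G₂ ∧ ∀ j, H.map (P.mor j) = φ j := by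
  obtain ⟨H, ⟨h, hφ⟩, -⟩ := P.semifree.free E o
    (grDesc (o := fun A => o ((desc i₁ i₂).obj A)) G₁ G₂) φ
  exact ⟨H, GrCat.FunctorOver.ext fun A B n f => h (.inl A) (.inl B) n f,
    GrCat.FunctorOver.ext fun A B n f => h (.inr A) (.inr B) n f, hφ⟩

/-- Freeness of X over C ⊔ C is combined with freeness of each copy of C over S; the morphisms
between the two copies inside C ⊔ C are zero and impose no condition. -/
lemma isFreeOn : X.toGrCat.IsFreeOn P.gen := by
  intro E o φ
  obtain ⟨G₁, hG₁, h₁⟩ := S.isFreeOn E (fun A => o (i₁.obj A)) fun i => φ (.inl (.inl i))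
  obtain ⟨G₂, hG₂, h₂⟩ := S.isFreeOn E (fun A => o (i₂.obj A)) fun i => φ (.inl (.inr i))
  obtain ⟨H, ⟨h, hφ⟩, h'⟩ := P.semifree.free E o
    (grDesc (o := fun A => o ((desc i₁ i₂).obj A)) G₁ G₂) fun j => φ (.inr j)
  refine ⟨H, ?_, fun H' hH' => h' H' ⟨?_, fun j => hH' (.inr j)⟩⟩
  · rintro ((i | i) | j)
    · exact (h (.inl _) (.inl _) _ (S.mor i)).trans (hG₁ i)
    · exact (h (.inr _) (.inr _) _ (S.mor i)).trans (hG₂ i)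
    · exact hφ j
  · have e₁ : i₁.toGr.comp H' = G₁ := h₁ _ fun i => hH' (.inl (.inl i))
    have e₂ : i₂.toGr.comp H' = G₂ := h₂ _ fun i => hH' (.inl (.inr i))
    rintro (A | A) (B | B) n f
    · exact GrCat.FunctorOver.congr_map e₁ f
    · exact H'.map.map_zero
    · exact H'.map.map_zero
    · exact GrCat.FunctorOver.congr_map e₂ f

include P in
lemma isSemifree : IsSemifree X := by
  obtain ⟨lt, hlt, hd⟩ := P.semifree.d_mor
  have := S.wellOrder
  refine ⟨{ I := (S.I ⊕ S.I) ⊕ CylIndex S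
            -- All generators of both copies of C precede all the added ones: the differential of an
            -- added generator may involve arbitrary morphisms of the two copies.
            lt := Sum.Lex (Sum.Lex S.lt S.lt) lt
            src := _
            tgt := _
            deg := _
            mor := P.gen
            free := bijective_of_isFreeOn P.isFreeOn
            d_mor := ?_ }⟩
  rintro ((i | i) | j)
  · change X.Generated _ (X.d rfl (i₁.map (S.mor i)))
    rw [← i₁.map_d]
    refine (S.d_mor i).map i₁.toGr fun f hf => .of _ ?_
    obtain ⟨j, hj, h⟩ := hf
    cases h
    exact ⟨.inl (.inl j), .inl (.inl hj), rfl⟩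
  · change X.Generated _ (X.d rfl (i₂.map (S.mor i)))
    rw [← i₂.map_d]
    refine (S.d_mor i).map i₂.toGr fun f hf => .of _ ?_
    obtain ⟨j, hj, h⟩ := hf
    cases h
    exact ⟨.inl (.inr j), .inl (.inr hj), rfl⟩
  · refine (hd j).trans fun f hf => ?_
    rcases hf with ⟨A, B, n, g, h⟩ | ⟨j', hj', h⟩
    · cases h
      refine desc_map_mem_range i₁ i₂ g (fun f => ?_) fun f => ?_
      · refine (S.isFreeOn.generated f).map i₁.toGr fun f hf => .of _ ?_
        obtain ⟨j, h⟩ := hf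
        cases h
        exact ⟨.inl (.inl j), .sep _ _, rfl⟩
      · refine (S.isFreeOn.generated f).map i₂.toGr fun f hf => .of _ ?_
        obtain ⟨j, h⟩ := hf
        cases h
        exact ⟨.inl (.inr j), .sep _ _, rfl⟩
    · cases h
      exact .of _ ⟨.inr j', .inr hj', rfl⟩

end Cylinder

end Cylinder

end DGCat

/-! ### The universal property of the cylinder: the functors Cyl(F) and the projections. -/

namespace DGCat

variable {k : Type u} [CommRing k] {C X : DGCat.{u, u, u} k} {S : GeneratingSet C}
  {i₁ i₂ : C ⟶ X}

/-- A functor of graded categories commutes with the differentials if it does so on free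
generators. -/
lemma _root_.GrCat.IsFreeOn.map_d {C : GrCat.{u, u} k} {I : Type u} {src tgt : I → C.Obj}
    {deg : I → ℤ} {mor : ∀ i, C.Hom (src i) (tgt i) (deg i)} (hC : C.IsFreeOn mor)
    {Y : GrCat.{w, v} k} {o : C.Obj → Y.Obj} (H : GrCat.FunctorOver C Y o)
    (δ : C.Differential) (δ' : Y.Differential)
    (h : ∀ i {m : ℤ} (h : deg i + 1 = m), H.map (δ.d h (mor i)) = δ'.d h (H.map (mor i)))
    {A B : C.Obj} {n m : ℤ} (hm : n + 1 = m) (f : C.Hom A B n) :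
    H.map (δ.d hm f) = δ'.d hm (H.map f) := by
  refine H.map_d_of_generated δ δ' (fun f hf m hm => ?_) (hC.generated f) hm
  obtain ⟨i, h'⟩ := hf
  cases h'
  exact h i hm

namespace Cylinder

variable (P : Cylinder S i₁ i₂)

/-- The graded functor exists by freeness. Compatibility with d is needed only on generators, where
the equations of the two families of cylinder data correspond to each other. -/
lemma exists_isMap {Y : DGCat.{u, u, u} k} {a₁ a₂ : C ⟶ Y} (L : CylinderData S a₁ a₂) :
    ∃ G : X ⟶ Y, P.data.IsMap L G := by
  obtain ⟨o₁, G₁, hG₁⟩ := a₁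
  obtain ⟨o₂, G₂, hG₂⟩ := a₂
  obtain ⟨o, h₁, h₂⟩ := P.exists_obj o₁ o₂
  -- After this substitution, and that of the functors below, the targets a₁ and a₂ are literally i₁
  -- and i₂ followed by the new functor; the values of L then have the required types without
  -- transport.
  subst h₁ h₂
  obtain ⟨H, h₁, h₂, h⟩ := P.exists_functor Y.toGrCat o G₁ G₂
    (fun
      | .t A => L.t A
      | .t' A => L.t' A
      | .tHat A => L.tHat A
      | .tCheck A => L.tCheck A
      | .tBar A => L.tBar A
      | .tGen i => L.tGen i)
  subst h₁ h₂
  have ht (A) : H.map (P.t A) = L.t A := h (.t A)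
  have ht' (A) : H.map (P.t' A) = L.t' A := h (.t' A)
  have htHat (A) : H.map (P.tHat A) = L.tHat A := h (.tHat A)
  have htCheck (A) : H.map (P.tCheck A) = L.tCheck A := h (.tCheck A)
  have htBar (A) : H.map (P.tBar A) = L.tBar A := h (.tBar A)
  have htGen (i) : H.map (P.tGen i) = L.tGen i := h (.tGen i)
  -- `map_tMor` does not apply, since H is not yet known to commute with d; the characterisation of
  -- t_θ by derivations only needs a graded functor.
  have hθ {A B : C.Obj} {n : ℤ} (θ : C.Hom A B n) :
      H.map (tMor S i₁ i₂ P.tGen θ) = tMor S ⟨_, i₁.toGr.comp H, hG₁⟩ ⟨_, i₂.toGr.comp H, hG₂⟩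
        L.tGen θ := by
    refine (congrArg H.map (tMor_eq S i₁ i₂ P.tGen θ)).trans (Eq.symm ?_)
    exact tMor_eq_of_derivation (i₁ := ⟨_, i₁.toGr.comp H, hG₁⟩) (i₂ := ⟨_, i₂.toGr.comp H, hG₂⟩)
      (τ := (tDerivation S i₁ i₂ P.tGen).postcomp H)
      (fun i => (congrArg H.map (tDerivation_mor S i₁ i₂ P.tGen i)).trans (htGen i)) θ
  have hd : ∀ {A B : X.Obj} {n m : ℤ} (hm : n + 1 = m) (f : X.Hom A B n),
      H.map (X.d hm f) = Y.d hm (H.map f) := by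
    refine P.isFreeOn.map_d H X.differential Y.differential ?_
    rintro ((i | i) | (A | A | A | A | A | i)) m hm
    · exact (congrArg H.map (i₁.map_d hm (S.mor i)).symm).trans (hG₁ hm (S.mor i))
    · exact (congrArg H.map (i₂.map_d hm (S.mor i)).symm).trans (hG₂ hm (S.mor i))
    · obtain rfl : 1 = m := by
        change (0 : ℤ) + 1 = m at hm
        omega
      change H.map (X.d (zero_add 1) (P.t A)) = Y.d (zero_add 1) (H.map (P.t A))
      rw [P.d_t, ht, L.d_t, map_zero]
    · obtain rfl : 1 = m := by
        change (0 : ℤ) + 1 = m at hm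
        omega
      change H.map (X.d (zero_add 1) (P.t' A)) = Y.d (zero_add 1) (H.map (P.t' A))
      rw [P.d_t', ht', L.d_t', map_zero]
    · obtain rfl : 0 = m := by
        change (-1 : ℤ) + 1 = m at hm
        omega
      change H.map (X.d (neg_add_cancel 1) (P.tHat A)) =
        Y.d (neg_add_cancel 1) (H.map (P.tHat A))
      rw [P.d_tHat, htHat, L.d_tHat, map_sub, H.map_id, H.map_comp, ht, ht']
    · obtain rfl : 0 = m := by
        change (-1 : ℤ) + 1 = m at hm
        omega
      change H.map (X.d (neg_add_cancel 1) (P.tCheck A)) =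
        Y.d (neg_add_cancel 1) (H.map (P.tCheck A))
      rw [P.d_tCheck, htCheck, L.d_tCheck, map_sub, H.map_id, H.map_comp, ht, ht']
    · obtain rfl : -1 = m := by
        change (-2 : ℤ) + 1 = m at hm
        omega
      change H.map (X.d _ (P.tBar A)) = Y.d _ (H.map (P.tBar A))
      rw [P.d_tBar, htBar, L.d_tBar, map_sub, H.map_comp, H.map_comp, ht, htHat, htCheck]
    · obtain rfl : S.deg i + 1 - 1 = m := by
        change S.deg i - 1 + 1 = m at hm
        omega
      change H.map (X.d _ (P.tGen i)) = Y.d _ (H.map (P.tGen i))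
      rw [P.d_tGen, htGen, L.d_tGen, map_add, map_smul, map_sub, H.map_comp, H.map_comp, ht, ht, hθ]
      rfl
  exact ⟨⟨o, H, hd⟩, rfl, rfl, fun A => congrArg Y.mor (ht A), fun A => congrArg Y.mor (ht' A),
    fun A => congrArg Y.mor (htHat A), fun A => congrArg Y.mor (htCheck A),
    fun A => congrArg Y.mor (htBar A), fun i => congrArg Y.mor (htGen i)⟩

variable {P} in
lemma isMap_unique {Y : DGCat.{u, u, u} k} {a₁ a₂ : C ⟶ Y} {L : CylinderData S a₁ a₂}
    {G G' : X ⟶ Y} (h : P.data.IsMap L G) (h' : P.data.IsMap L G') : G = G' := by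
  have h₁ : i₁ ≫ G = i₁ ≫ G' := h.comp_i₁.trans h'.comp_i₁.symm
  have h₂ : i₂ ≫ G = i₂ ≫ G' := h.comp_i₂.trans h'.comp_i₂.symm
  have ht (A) := (h.map_t A).trans (h'.map_t A).symm
  have ht' (A) := (h.map_t' A).trans (h'.map_t' A).symm
  have htHat (A) := (h.map_tHat A).trans (h'.map_tHat A).symm
  have htCheck (A) := (h.map_tCheck A).trans (h'.map_tCheck A).symm
  have htBar (A) := (h.map_tBar A).trans (h'.map_tBar A).symm
  have htGen (i) := (h.map_tGen i).trans (h'.map_tGen i).symm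
  clear h h'
  obtain ⟨o, H, hH⟩ := G
  obtain ⟨o', H', hH'⟩ := G'
  obtain rfl : o = o' := by
    funext Z
    rcases P.obj_cases Z with ⟨A, rfl⟩ | ⟨A, rfl⟩
    exacts [congrFun (congrArg DGFunctor.obj h₁) A, congrFun (congrArg DGFunctor.obj h₂) A]
  obtain rfl : H = H' := by
    refine P.isFreeOn.functor_ext ?_
    rintro ((i | i) | (A | A | A | A | A | i))
    · exact eq_of_heq (DGFunctor.map_heq h₁ (S.mor i))
    · exact eq_of_heq (DGFunctor.map_heq h₂ (S.mor i))
    · exact GrCat.mor_inj (ht A)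
    · exact GrCat.mor_inj (ht' A)
    · exact GrCat.mor_inj (htHat A)
    · exact GrCat.mor_inj (htCheck A)
    · exact GrCat.mor_inj (htBar A)
    · exact GrCat.mor_inj (htGen i)
  rfl

section

variable {D Y : DGCat.{u, u, u} k} {T : GeneratingSet D} {j₁ j₂ : D ⟶ Y} (Q : Cylinder T j₁ j₂)

/-- The conditions on Cyl(F) are, field by field, those of a map to the cylinder data pulled back
along F, so the universal property applies. -/
lemma isMap_iff (F : C ⟶ D) (G : X ⟶ Y) :
    P.IsMap Q F G ↔ P.data.IsMap (Q.data.pullback S F) G :=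
  ⟨fun h => ⟨h.1, h.2, h.3, h.4, h.5, h.6, h.7, h.8⟩, fun h => ⟨h.1, h.2, h.3, h.4, h.5, h.6, h.7, h.8⟩⟩

lemma exists_map (F : C ⟶ D) : ∃ G : X ⟶ Y, P.IsMap Q F G := by
  obtain ⟨G, hG⟩ := P.exists_isMap (Q.data.pullback S F)
  exact ⟨G, (P.isMap_iff Q F G).2 hG⟩

variable {P Q}

lemma IsMap.unique {F : C ⟶ D} {G G' : X ⟶ Y} (h : P.IsMap Q F G) (h' : P.IsMap Q F G') :
    G = G' :=
  isMap_unique ((P.isMap_iff Q F G).1 h) ((P.isMap_iff Q F G').1 h')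

/-- Compatibility with t_f is only required for generators f. Its extension to all morphisms is what
makes `IsMap` stable under composition. -/
lemma IsMap.map_tMor {F : C ⟶ D} {G : X ⟶ Y} (h : P.IsMap Q F G) {A B : C.Obj} {n : ℤ}
    (θ : C.Hom A B n) :
    Y.mor (G.map (tMor S i₁ i₂ P.tGen θ)) = Y.mor (tMor T j₁ j₂ Q.tGen (F.map θ)) := by
  refine (congrArg Y.mor (DGCat.map_tMor S i₁ i₂ P.tGen G θ)).trans ?_
  refine Eq.trans ?_ (congrArg Y.mor (tMor_map S T j₁ j₂ Q.tGen F θ)).symm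
  exact tMor_congr h.comp_i₁ h.comp_i₂ h.map_tGen θ

lemma isMap_id (P : Cylinder S i₁ i₂) : P.IsMap P (𝟙 C) (𝟙 X) where
  comp_i₁ := rfl
  comp_i₂ := rfl
  map_t _ := rfl
  map_t' _ := rfl
  map_tHat _ := rfl
  map_tCheck _ := rfl
  map_tBar _ := rfl
  map_tGen i := congrArg X.mor (tMor_mor S i₁ i₂ P.tGen i).symm

lemma IsMap.comp {E Z : DGCat.{u, u, u} k} {U : GeneratingSet E} {l₁ l₂ : E ⟶ Z}
    {R : Cylinder U l₁ l₂} {F : C ⟶ D} {G : X ⟶ Y} (h : P.IsMap Q F G) {F' : D ⟶ E} {G' : Y ⟶ Z}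
    (h' : Q.IsMap R F' G') : P.IsMap R (F ≫ F') (G ≫ G') where
  comp_i₁ := by
    rw [← Category.assoc, h.comp_i₁, Category.assoc, h'.comp_i₁, Category.assoc]
  comp_i₂ := by
    rw [← Category.assoc, h.comp_i₂, Category.assoc, h'.comp_i₂, Category.assoc]
  map_t A := (congrArg G'.mapMor (h.map_t A)).trans (h'.map_t _)
  map_t' A := (congrArg G'.mapMor (h.map_t' A)).trans (h'.map_t' _)
  map_tHat A := (congrArg G'.mapMor (h.map_tHat A)).trans (h'.map_tHat _)
  map_tCheck A := (congrArg G'.mapMor (h.map_tCheck A)).trans (h'.map_tCheck _)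
  map_tBar A := (congrArg G'.mapMor (h.map_tBar A)).trans (h'.map_tBar _)
  map_tGen i := (congrArg G'.mapMor (h.map_tGen i)).trans (h'.map_tMor _)

end

lemma isProjection_iff (q : X ⟶ C) :
    P.IsProjection q ↔ P.data.IsMap (CylinderData.proj S) q := by
  constructor
  · rintro ⟨h₁, h₂, ht, ht', htHat, htCheck, htBar, htGen⟩
    have o₁ (A) : q.obj (i₁.obj A) = A := congrFun (congrArg DGFunctor.obj h₁) A
    have o₂ (A) : q.obj (i₂.obj A) = A := congrFun (congrArg DGFunctor.obj h₂) A
    exact ⟨h₁, h₂, ht, ht', fun A => (GrCat.mor_eq_mor_zero (o₁ A) (o₁ A)).2 (htHat A),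
      fun A => (GrCat.mor_eq_mor_zero (o₂ A) (o₂ A)).2 (htCheck A),
      fun A => (GrCat.mor_eq_mor_zero (o₁ A) (o₂ A)).2 (htBar A),
      fun i => (GrCat.mor_eq_mor_zero (o₁ _) (o₂ _)).2 (htGen i)⟩
  · rintro ⟨h₁, h₂, ht, ht', htHat, htCheck, htBar, htGen⟩
    have o₁ (A) : q.obj (i₁.obj A) = A := congrFun (congrArg DGFunctor.obj h₁) A
    have o₂ (A) : q.obj (i₂.obj A) = A := congrFun (congrArg DGFunctor.obj h₂) A
    exact ⟨h₁, h₂, ht, ht', fun A => (GrCat.mor_eq_mor_zero (o₁ A) (o₁ A)).1 (htHat A),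
      fun A => (GrCat.mor_eq_mor_zero (o₂ A) (o₂ A)).1 (htCheck A),
      fun A => (GrCat.mor_eq_mor_zero (o₁ A) (o₂ A)).1 (htBar A),
      fun i => (GrCat.mor_eq_mor_zero (o₁ _) (o₂ _)).1 (htGen i)⟩

lemma exists_projection : ∃ q : X ⟶ C, P.IsProjection q := by
  obtain ⟨q, hq⟩ := P.exists_isMap (CylinderData.proj S)
  exact ⟨q, (P.isProjection_iff q).2 hq⟩

variable {P}

lemma IsProjection.unique {q q' : X ⟶ C} (h : P.IsProjection q) (h' : P.IsProjection q') :
    q = q' :=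
  isMap_unique ((P.isProjection_iff q).1 h) ((P.isProjection_iff q').1 h')

/-- The projections of cylinders are natural. -/
lemma IsMap.comp_projection {D Y : DGCat.{u, u, u} k} {T : GeneratingSet D} {j₁ j₂ : D ⟶ Y}
    {Q : Cylinder T j₁ j₂} {F : C ⟶ D} {G : X ⟶ Y} (h : P.IsMap Q F G) {p : X ⟶ C} {q : Y ⟶ D}
    (hp : P.IsProjection p) (hq : Q.IsProjection q) : G ≫ q = p ≫ F := by
  rw [isProjection_iff] at hp hq
  -- Both composites are compatible with the same cylinder data in D: t and t' go to identities and
  -- all other added generators to zero.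
  refine isMap_unique (P := P) (L := (CylinderData.proj T).pullback S F)
    ⟨?_, ?_, fun A => (congrArg q.mapMor (h.map_t A)).trans (hq.map_t _),
      fun A => (congrArg q.mapMor (h.map_t' A)).trans (hq.map_t' _),
      fun A => (congrArg q.mapMor (h.map_tHat A)).trans (hq.map_tHat _),
      fun A => (congrArg q.mapMor (h.map_tCheck A)).trans (hq.map_tCheck _),
      fun A => (congrArg q.mapMor (h.map_tBar A)).trans (hq.map_tBar _),
      fun i => (congrArg q.mapMor (h.map_tGen i)).trans ?_⟩
    ⟨?_, ?_, fun A => (congrArg F.mapMor (hp.map_t A)).trans (congrArg D.mor (F.toGr.map_id A)),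
      fun A => (congrArg F.mapMor (hp.map_t' A)).trans (congrArg D.mor (F.toGr.map_id A)),
      fun A => (congrArg F.mapMor (hp.map_tHat A)).trans (congrArg D.mor (map_zero F.toGr.map)),
      fun A => (congrArg F.mapMor (hp.map_tCheck A)).trans (congrArg D.mor (map_zero F.toGr.map)),
      fun A => (congrArg F.mapMor (hp.map_tBar A)).trans (congrArg D.mor (map_zero F.toGr.map)),
      fun i => (congrArg F.mapMor (hp.map_tGen i)).trans ?_⟩
  · rw [← Category.assoc, h.comp_i₁, Category.assoc, hq.comp_i₁]
  · rw [← Category.assoc, h.comp_i₂, Category.assoc, hq.comp_i₂]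
  · refine (congrArg D.mor (DGCat.map_tMor T j₁ j₂ Q.tGen q (F.map (S.mor i)))).trans ?_
    exact tMor_congr hq.comp_i₁ hq.comp_i₂ hq.map_tGen _
  · rw [← Category.assoc, hp.comp_i₁, Category.id_comp, Category.comp_id]
  · rw [← Category.assoc, hp.comp_i₂, Category.id_comp, Category.comp_id]
  · refine (congrArg D.mor (map_zero F.toGr.map)).trans (congrArg D.mor ?_)
    exact (tMor_zero T (𝟙 D) (𝟙 D) (F.map (S.mor i))).symm

end Cylinder

end DGCat

/-! ### The well-ordering of the added generators. -/

namespace GrCat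

variable {k : Type u} [CommRing k]

lemma Generated.sub {C : GrCat.{w, v} k} {S : Set C.Mor} {A B : C.Obj} {n : ℤ} {f g : C.Hom A B n}
    (hf : C.Generated S f) (hg : C.Generated S g) : C.Generated S (f - g) := by
  rw [sub_eq_add_neg, ← neg_one_smul k g]
  exact .add _ _ hf (.smul _ _ hg)

/-- Applied to df, which is generated by smaller generators, this shows that t_{df} involves only
the two copies of C and the t_g with g smaller than f. -/
lemma Derivation.generated {C : GrCat.{w, v} k} {X : GrCat.{w', v'} k}
    {o₁ o₂ : C.Obj → X.Obj} {F₁ : FunctorOver C X o₁} {F₂ : FunctorOver C X o₂} {e : ℤ}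
    {a b : ℤ → k} (τ : Derivation F₁ F₂ e a b) {S : Set C.Mor} {T : Set X.Mor}
    (h₁ : ∀ {A B : C.Obj} {n : ℤ} (f : C.Hom A B n), X.Generated T (F₁.map f))
    (h₂ : ∀ {A B : C.Obj} {n : ℤ} (f : C.Hom A B n), X.Generated T (F₂.map f))
    (hS : ∀ {A B : C.Obj} {n : ℤ} (f : C.Hom A B n), C.mor f ∈ S →
      ∀ {m : ℤ} (h : n + e = m), X.Generated T (τ.map h f))
    {A B : C.Obj} {n : ℤ} {f : C.Hom A B n} (hf : C.Generated S f) {m : ℤ} (h : n + e = m) :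
    X.Generated T (τ.map h f) := by
  induction hf generalizing m with
  | of f hf => exact hS f hf h
  | id A => exact (τ.map_id A h).symm ▸ .zero _ _ _
  | zero A B n => exact (τ.map h).map_zero.symm ▸ .zero _ _ _
  | add f g _ _ hf hg => exact ((τ.map h).map_add f g).symm ▸ .add _ _ (hf h) (hg h)
  | smul c f _ hf => exact ((τ.map h).map_smul c f).symm ▸ .smul _ _ (hf h)
  | comp h' g f _ _ hg hf =>
    rw [τ.map_comp h' rfl rfl h (by omega) (by omega)]
    exact .add _ _ (.smul _ _ (.comp _ _ _ (h₂ g) (hf rfl)))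
      (.smul _ _ (.comp _ _ _ (hg rfl) (h₁ f)))

end GrCat

namespace DGCat

variable {k : Type u} [CommRing k] {C : DGCat.{u, u, u} k}

section Order

variable (S : GeneratingSet C)

/-- The position of a new generating morphism of the cylinder. -/
def CylIndex.rank : CylIndex S → (Fin 3 × (C.Obj ⊕ C.Obj)) ⊕ S.I
  | .t A => .inl (0, .inl A)
  | .t' A => .inl (0, .inr A)
  | .tHat A => .inl (1, .inl A)
  | .tCheck A => .inl (1, .inr A)
  | .tBar A => .inl (2, .inl A)
  | .tGen i => .inr i

lemma CylIndex.rank_injective : Function.Injective (CylIndex.rank S) := by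
  rintro (_ | _ | _ | _ | _ | _) (_ | _ | _ | _ | _ | _) h <;> simp_all [CylIndex.rank]

/-- The order on the new generating morphisms of the cylinder. -/
def CylIndex.lt : CylIndex S → CylIndex S → Prop :=
  CylIndex.rank S ⁻¹'o Sum.Lex (Prod.Lex (· < ·) WellOrderingRel) S.lt

/-- The order is pulled back along the injective rank. It has the layers t and t', then t̂ and ť,
then t̄, and finally the t_f in the order of S; inside the first three layers an arbitrary
well-ordering of the objects is used. -/
lemma CylIndex.isWellOrder_lt : IsWellOrder (CylIndex S) (CylIndex.lt S) := by
  have := S.wellOrder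
  exact (RelEmbedding.preimage ⟨_, CylIndex.rank_injective S⟩
    (Sum.Lex (Prod.Lex (· < ·) WellOrderingRel) S.lt)).isWellOrder

end Order

lemma generated_d {X : DGCat.{w, v} k} {T : Set X.Mor} {A B : X.Obj} {m n n' : ℤ}
    (f : X.Hom A B m) (h : m + 1 = n) (h' : m + 1 = n') (hf : X.Generated T (X.d h f)) :
    X.Generated T (X.d h' f) := by
  subst h h'
  exact hf

/-- Each differential uses only earlier layers: dt̂ and dť involve t and t', dt̄ involves t, t̂ and
ť, and dt_f involves t and the t_g with g smaller than f. -/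
lemma CylinderData.generated_d_mor {X : DGCat.{u, u, u} k} {S : GeneratingSet C} {i₁ i₂ : C ⟶ X}
    (K : CylinderData S i₁ i₂) (i : CylIndex S) : X.Generated
      ({x | ∃ (A B : (coprod C C).Obj) (n : ℤ) (f : (coprod C C).Hom A B n),
          x = X.mor ((desc i₁ i₂).map f)} ∪
        {x | ∃ j, CylIndex.lt S j i ∧
          x = X.mor (CylIndex.mor K.t K.t' K.tHat K.tCheck K.tBar K.tGen j)})
      (X.d rfl (CylIndex.mor K.t K.t' K.tHat K.tCheck K.tBar K.tGen i)) := by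
  set T := {x | ∃ (A B : (coprod C C).Obj) (n : ℤ) (f : (coprod C C).Hom A B n),
          x = X.mor ((desc i₁ i₂).map f)} ∪
        {x | ∃ j, CylIndex.lt S j i ∧
          x = X.mor (CylIndex.mor K.t K.t' K.tHat K.tCheck K.tBar K.tGen j)} with hT
  have h₁ {A B : C.Obj} {n : ℤ} (f : C.Hom A B n) : X.Generated T (i₁.map f) :=
    .of _ (.inl ⟨.inl A, .inl B, n, f, rfl⟩)
  have h₂ {A B : C.Obj} {n : ℤ} (f : C.Hom A B n) : X.Generated T (i₂.map f) :=
    .of _ (.inl ⟨.inr A, .inr B, n, f, rfl⟩)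
  have hmor (j) (h : CylIndex.lt S j i) :
      X.Generated T (CylIndex.mor K.t K.t' K.tHat K.tCheck K.tBar K.tGen j) :=
    .of _ (.inr ⟨j, h, rfl⟩)
  clear_value T
  rcases i with A | A | A | A | A | i
  · refine generated_d _ (zero_add 1) _ ?_
    exact (K.d_t A).symm ▸ .zero _ _ _
  · refine generated_d _ (zero_add 1) _ ?_
    exact (K.d_t' A).symm ▸ .zero _ _ _
  · refine generated_d _ (neg_add_cancel 1) _ ?_
    refine (K.d_tHat A).symm ▸ .sub (.id _) (.comp _ _ _ (hmor (.t' A) ?_) (hmor (.t A) ?_)) <;>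
    exact .inl (.left _ _ (by decide))
  · refine generated_d _ (neg_add_cancel 1) _ ?_
    refine (K.d_tCheck A).symm ▸ .sub (.id _) (.comp _ _ _ (hmor (.t A) ?_) (hmor (.t' A) ?_)) <;>
    exact .inl (.left _ _ (by decide))
  · refine generated_d _ (show (-2 : ℤ) + 1 = -1 by norm_num) _ ?_
    refine (K.d_tBar A).symm ▸ .sub (.comp _ _ _ (hmor (.t A) ?_) (hmor (.tHat A) ?_))
      (.comp _ _ _ (hmor (.tCheck A) ?_) (hmor (.t A) ?_)) <;>
    exact .inl (.left _ _ (by decide))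
  · refine generated_d _ (show S.deg i - 1 + 1 = S.deg i + 1 - 1 by omega) _ ?_
    refine (K.d_tGen i).symm ▸ .add _ _ (.smul _ _ (.sub (.comp _ _ _ (h₂ _) (hmor (.t _) ?_))
      (.comp _ _ _ (hmor (.t _) ?_) (h₁ _)))) ?_
    · exact .sep _ _
    · exact .sep _ _
    · rw [tMor_eq]
      refine (tDerivation S i₁ i₂ K.tGen).generated h₁ h₂ ?_ (S.d_mor i) _
      rintro A B n f ⟨j, hj, h⟩ m hm
      cases h
      obtain rfl : S.deg j - 1 = m := by omega
      rw [tDerivation_mor]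
      exact hmor (.tGen j) (.inr hj)

/-! ### Construction of the cylinder. -/

section Construction

variable (S : GeneratingSet C)

/-- Sources of the generating morphisms of the cylinder. -/
def cylSrc : (S.I ⊕ S.I) ⊕ CylIndex S → C.Obj ⊕ C.Obj
  | .inl (.inl i) => .inl (S.src i)
  | .inl (.inr i) => .inr (S.src i)
  | .inr (.t A) => .inl A
  | .inr (.t' A) => .inr A
  | .inr (.tHat A) => .inl A
  | .inr (.tCheck A) => .inr A
  | .inr (.tBar A) => .inl A
  | .inr (.tGen i) => .inl (S.src i)

/-- Targets of the generating morphisms of the cylinder. -/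
def cylTgt : (S.I ⊕ S.I) ⊕ CylIndex S → C.Obj ⊕ C.Obj
  | .inl (.inl i) => .inl (S.tgt i)
  | .inl (.inr i) => .inr (S.tgt i)
  | .inr (.t A) => .inr A
  | .inr (.t' A) => .inl A
  | .inr (.tHat A) => .inl A
  | .inr (.tCheck A) => .inr A
  | .inr (.tBar A) => .inr A
  | .inr (.tGen i) => .inr (S.tgt i)

/-- Degrees of the generating morphisms of the cylinder. -/
def cylDeg : (S.I ⊕ S.I) ⊕ CylIndex S → ℤ
  | .inl (.inl i) => S.deg i
  | .inl (.inr i) => S.deg i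
  | .inr j => j.deg

/-- Degrees of the differentials of the generating morphisms of the cylinder. -/
def cylDegSucc : (S.I ⊕ S.I) ⊕ CylIndex S → ℤ
  | .inl (.inl i) => S.deg i + 1
  | .inl (.inr i) => S.deg i + 1
  | .inr (.t _) => 1
  | .inr (.t' _) => 1
  | .inr (.tHat _) => 0
  | .inr (.tCheck _) => 0
  | .inr (.tBar _) => -1
  | .inr (.tGen i) => S.deg i + 1 - 1

/-- Tabulating the successor degrees gives each prescribed differential the degree in which its
formula is written, such as 1 or `S.deg i + 1 - 1`. -/
lemma cylDeg_add_one (x) : cylDeg S x + 1 = cylDegSucc S x := by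
  rcases x with (i | i) | A | A | A | A | A | i
  case inr.tGen =>
    change S.deg i - 1 + 1 = S.deg i + 1 - 1
    omega
  all_goals rfl

/-- The graded category underlying the cylinder. -/
noncomputable abbrev cylGr : GrCat.{u, u} k := freeGr k (cylSrc S) (cylTgt S) (cylDeg S)

/-- The generating morphisms of the cylinder. -/
noncomputable abbrev cylGen (x : (S.I ⊕ S.I) ⊕ CylIndex S) :
    (cylGr S).Hom (cylSrc S x) (cylTgt S x) (cylDeg S x) :=
  freeGen (cylSrc S) (cylTgt S) (cylDeg S) x

/-- The first copy of `C` in the cylinder. -/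
noncomputable def cylIncl₁ : GrCat.FunctorOver C.toGrCat (cylGr S) Sum.inl :=
  (S.isFreeOn (cylGr S) Sum.inl fun i => cylGen S (.inl (.inl i))).choose

/-- The second copy of `C` in the cylinder. -/
noncomputable def cylIncl₂ : GrCat.FunctorOver C.toGrCat (cylGr S) Sum.inr :=
  (S.isFreeOn (cylGr S) Sum.inr fun i => cylGen S (.inl (.inr i))).choose

lemma cylIncl₁_mor (i : S.I) : (cylIncl₁ S).map (S.mor i) = cylGen S (.inl (.inl i)) :=
  (S.isFreeOn (cylGr S) Sum.inl fun i => cylGen S (.inl (.inl i))).choose_spec.1 i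

lemma cylIncl₂_mor (i : S.I) : (cylIncl₂ S).map (S.mor i) = cylGen S (.inl (.inr i)) :=
  (S.isFreeOn (cylGr S) Sum.inr fun i => cylGen S (.inl (.inr i))).choose_spec.1 i

/-- The generator `t_A`. -/
noncomputable abbrev cylT (A : C.Obj) : (cylGr S).Hom (.inl A) (.inr A) 0 := cylGen S (.inr (.t A))

/-- The generator `t'_A`. -/
noncomputable abbrev cylT' (A : C.Obj) : (cylGr S).Hom (.inr A) (.inl A) 0 :=
  cylGen S (.inr (.t' A))

/-- The generator `t̂_A`. -/
noncomputable abbrev cylHat (A : C.Obj) : (cylGr S).Hom (.inl A) (.inl A) (-1) :=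
  cylGen S (.inr (.tHat A))

/-- The generator `ť_A`. -/
noncomputable abbrev cylCheck (A : C.Obj) : (cylGr S).Hom (.inr A) (.inr A) (-1) :=
  cylGen S (.inr (.tCheck A))

/-- The generator `t̄_A`. -/
noncomputable abbrev cylBar (A : C.Obj) : (cylGr S).Hom (.inl A) (.inr A) (-2) :=
  cylGen S (.inr (.tBar A))

/-- The generator `t_f`. -/
noncomputable abbrev cylTGen (i : S.I) :
    (cylGr S).Hom (.inl (S.src i)) (.inr (S.tgt i)) (S.deg i - 1) :=
  cylGen S (.inr (.tGen i))

lemma exists_cylDerivation :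
    ∃ τ : GrCat.Derivation (cylIncl₁ S) (cylIncl₂ S) (-1) (fun _ => 1) (koszul k),
      ∀ i, τ.map (sub_eq_add_neg _ _).symm (S.mor i) = cylTGen S i :=
  S.isFreeOn.exists_derivation (cylIncl₁ S) (cylIncl₂ S) (-1) GrCat.isSign_one
    GrCat.isSign_koszul (fun i => S.deg i - 1) (fun _ => (sub_eq_add_neg _ _).symm) (cylTGen S)

/-- The operation `θ ↦ t_θ` in the cylinder. -/
noncomputable def cylDerivation :
    GrCat.Derivation (cylIncl₁ S) (cylIncl₂ S) (-1) (fun _ => (1 : k)) (koszul k) :=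
  (exists_cylDerivation S).choose

lemma cylDerivation_mor (i : S.I) :
    (cylDerivation S).map (sub_eq_add_neg _ _).symm (S.mor i) = cylTGen S i :=
  (exists_cylDerivation S).choose_spec i

/-- The differentials of the generating morphisms of the cylinder. -/
noncomputable def cylDGen : ∀ x : (S.I ⊕ S.I) ⊕ CylIndex S,
    (cylGr S).Hom (cylSrc S x) (cylTgt S x) (cylDegSucc S x)
  | .inl (.inl i) => (cylIncl₁ S).map (C.d rfl (S.mor i))
  | .inl (.inr i) => (cylIncl₂ S).map (C.d rfl (S.mor i))
  | .inr (.t _) => 0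
  | .inr (.t' _) => 0
  | .inr (.tHat A) => (cylGr S).id (.inl A) - (cylGr S).comp (add_zero 0) (cylT' S A) (cylT S A)
  | .inr (.tCheck A) => (cylGr S).id (.inr A) - (cylGr S).comp (add_zero 0) (cylT S A) (cylT' S A)
  | .inr (.tBar A) => (cylGr S).comp (zero_add (-1)) (cylT S A) (cylHat S A) -
      (cylGr S).comp (add_zero (-1)) (cylCheck S A) (cylT S A)
  | .inr (.tGen i) => koszul k (S.deg i) •
      ((cylGr S).comp (show S.deg i + 0 = S.deg i + 1 - 1 by omega)
          ((cylIncl₂ S).map (S.mor i)) (cylT S (S.src i)) -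
        (cylGr S).comp (show 0 + S.deg i = S.deg i + 1 - 1 by omega)
          (cylT S (S.tgt i)) ((cylIncl₁ S).map (S.mor i))) +
      (cylDerivation S).map (sub_eq_add_neg _ _).symm (C.d rfl (S.mor i))

lemma exists_cylD : ∃ τ : GrCat.Derivation (GrCat.FunctorOver.id (cylGr S))
    (GrCat.FunctorOver.id (cylGr S)) 1 (koszul k) (fun _ => 1),
      ∀ x, τ.map (cylDeg_add_one S x) (cylGen S x) = cylDGen S x :=
  (isFreeOn_freeGr (cylSrc S) (cylTgt S) (cylDeg S)).exists_derivation
    (GrCat.FunctorOver.id (cylGr S)) (GrCat.FunctorOver.id (cylGr S)) 1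
    GrCat.isSign_koszul GrCat.isSign_one (cylDegSucc S) (cylDeg_add_one S) (cylDGen S)

/-- The differential of the cylinder. -/
noncomputable def cylD : (cylGr S).Differential :=
  .ofDerivation (exists_cylD S).choose

lemma cylD_gen (x) : (cylD S).d (cylDeg_add_one S x) (cylGen S x) = cylDGen S x :=
  (exists_cylD S).choose_spec x

lemma cylD_incl₁ {A B : C.Obj} {n m : ℤ} (hm : n + 1 = m) (f : C.Hom A B n) :
    (cylIncl₁ S).map (C.d hm f) = (cylD S).d hm ((cylIncl₁ S).map f) := by
  refine S.isFreeOn.map_d (cylIncl₁ S) C.differential (cylD S) (fun i m hm => ?_) hm f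
  subst hm
  rw [cylIncl₁_mor]
  exact (cylD_gen S (.inl (.inl i))).symm

lemma cylD_incl₂ {A B : C.Obj} {n m : ℤ} (hm : n + 1 = m) (f : C.Hom A B n) :
    (cylIncl₂ S).map (C.d hm f) = (cylD S).d hm ((cylIncl₂ S).map f) := by
  refine S.isFreeOn.map_d (cylIncl₂ S) C.differential (cylD S) (fun i m hm => ?_) hm f
  subst hm
  rw [cylIncl₂_mor]
  exact (cylD_gen S (.inl (.inr i))).symm

lemma cylD_t (A : C.Obj) : (cylD S).d (zero_add 1) (cylT S A) = 0 := cylD_gen S (.inr (.t A))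

lemma cylD_t' (A : C.Obj) : (cylD S).d (zero_add 1) (cylT' S A) = 0 := cylD_gen S (.inr (.t' A))

lemma cylD_tHat (A : C.Obj) : (cylD S).d (neg_add_cancel 1) (cylHat S A) =
    (cylGr S).id (.inl A) - (cylGr S).comp (add_zero 0) (cylT' S A) (cylT S A) :=
  cylD_gen S (.inr (.tHat A))

lemma cylD_tCheck (A : C.Obj) : (cylD S).d (neg_add_cancel 1) (cylCheck S A) =
    (cylGr S).id (.inr A) - (cylGr S).comp (add_zero 0) (cylT S A) (cylT' S A) :=
  cylD_gen S (.inr (.tCheck A))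

lemma cylD_tBar (A : C.Obj) :
    (cylD S).d (show (-2 : ℤ) + 1 = -1 by norm_num) (cylBar S A) =
      (cylGr S).comp (zero_add (-1)) (cylT S A) (cylHat S A) -
        (cylGr S).comp (add_zero (-1)) (cylCheck S A) (cylT S A) :=
  cylD_gen S (.inr (.tBar A))

lemma cylD_tGen (i : S.I) :
    (cylD S).d (show S.deg i - 1 + 1 = S.deg i + 1 - 1 by omega) (cylTGen S i) =
      koszul k (S.deg i) •
      ((cylGr S).comp (show S.deg i + 0 = S.deg i + 1 - 1 by omega)
          ((cylIncl₂ S).map (S.mor i)) (cylT S (S.src i)) -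
        (cylGr S).comp (show 0 + S.deg i = S.deg i + 1 - 1 by omega)
          (cylT S (S.tgt i)) ((cylIncl₁ S).map (S.mor i))) +
      (cylDerivation S).map (sub_eq_add_neg _ _).symm (C.d rfl (S.mor i)) :=
  cylD_gen S (.inr (.tGen i))

/-- This precedes the proof that d² = 0, in which it is applied to the morphism df. The homotopy
lemma therefore works with a `Differential`, which need not square to zero. -/
lemma cylD_cylDerivation {A B : C.Obj} {n : ℤ} (f : C.Hom A B n) {m l n' : ℤ} (hm : n + -1 = m)
    (hl : n + 1 = l) (hmn : m + 1 = n') (hln : l + -1 = n') (hn : n + 0 = n') (hn' : 0 + n = n') :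
    (cylD S).d hmn ((cylDerivation S).map hm f) = koszul k n •
      ((cylGr S).comp hn ((cylIncl₂ S).map f) (cylT S A) -
        (cylGr S).comp hn' (cylT S B) ((cylIncl₁ S).map f)) +
      (cylDerivation S).map hln (C.d hl f) := by
  refine S.isFreeOn.d_homotopy C.differential (cylD S) (cylD_incl₁ S) (cylD_incl₂ S) (cylT S)
    (cylDerivation S) ?_ f hm hl hmn hln hn hn'
  intro i m l n' hm hl hmn hln hn hn'
  subst hl
  obtain rfl : S.deg i - 1 = m := by omega
  obtain rfl : S.deg i + 1 - 1 = n' := by omega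
  rw [cylDerivation_mor]
  exact cylD_tGen S i

/-- For t̄ this is the identity t(1 - t't) = (1 - tt')t. For t_f, the differential of (-1)^{|f|}
(i₂(f) t - t i₁(f)) cancels the naturality term of d t_{df}, whose sign is (-1)^{|f|+1}, and t_{ddf}
= 0. -/
lemma cylD_d_gen (x) : (cylD S).d rfl ((cylD S).d (cylDeg_add_one S x) (cylGen S x)) = 0 := by
  rw [cylD_gen]
  rcases x with (i | i) | A | A | A | A | A | i
  · refine (cylD_incl₁ S rfl (C.d rfl (S.mor i))).symm.trans ?_
    exact (congrArg (cylIncl₁ S).map (C.d_d _ _ _)).trans (map_zero _)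
  · refine (cylD_incl₂ S rfl (C.d rfl (S.mor i))).symm.trans ?_
    exact (congrArg (cylIncl₂ S).map (C.d_d _ _ _)).trans (map_zero _)
  · exact map_zero _
  · exact map_zero _
  · change (cylD S).d (zero_add 1) ((cylGr S).id (.inl A) -
      (cylGr S).comp (add_zero 0) (cylT' S A) (cylT S A)) = 0
    rw [map_sub, (cylD S).d_id, (cylD S).leibniz _ (zero_add 1) (zero_add 1) _ (add_zero 1)
      (zero_add 1), cylD_t, cylD_t']
    simp
  · change (cylD S).d (zero_add 1) ((cylGr S).id (.inr A) -
      (cylGr S).comp (add_zero 0) (cylT S A) (cylT' S A)) = 0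
    rw [map_sub, (cylD S).d_id, (cylD S).leibniz _ (zero_add 1) (zero_add 1) _ (add_zero 1)
      (zero_add 1), cylD_t, cylD_t']
    simp
  · change (cylD S).d (neg_add_cancel 1) ((cylGr S).comp (zero_add (-1)) (cylT S A) (cylHat S A) -
        (cylGr S).comp (add_zero (-1)) (cylCheck S A) (cylT S A)) = 0
    rw [map_sub, (cylD S).leibniz _ (zero_add 1) (neg_add_cancel 1) _ (by norm_num) (add_zero 0),
      (cylD S).leibniz _ (neg_add_cancel 1) (zero_add 1) _ (add_zero 0) (by norm_num),
      cylD_t, cylD_tHat, cylD_tCheck]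
    simp only [map_sub, LinearMap.sub_apply, map_zero, LinearMap.zero_apply, smul_zero, zero_add,
      add_zero, koszul_zero, one_smul, (cylGr S).id_comp, (cylGr S).comp_id]
    rw [(cylGr S).assoc (add_zero 0) (add_zero 0) (add_zero 0) (add_zero 0)]
    simp
  · change (cylD S).d rfl (koszul k (S.deg i) •
      ((cylGr S).comp (show S.deg i + 0 = S.deg i + 1 - 1 by omega)
          ((cylIncl₂ S).map (S.mor i)) (cylT S (S.src i)) -
        (cylGr S).comp (show 0 + S.deg i = S.deg i + 1 - 1 by omega)
          (cylT S (S.tgt i)) ((cylIncl₁ S).map (S.mor i))) +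
      (cylDerivation S).map (sub_eq_add_neg _ _).symm (C.d rfl (S.mor i))) = 0
    rw [map_add, map_smul, map_sub,
      (cylD S).leibniz _ rfl (zero_add 1) rfl (by omega) (by omega),
      (cylD S).leibniz _ (zero_add 1) rfl rfl (by omega) (by omega),
      cylD_cylDerivation S (C.d rfl (S.mor i)) _ rfl _ (by omega) (by omega) (by omega),
      cylD_t, cylD_t, C.d_d, ← cylD_incl₁, ← cylD_incl₂, koszul_add, koszul_one, koszul_zero]
    simp

/-- The cylinder of `C`. -/
noncomputable def cylCat : DGCat.{u, u, u} k where
  toGrCat := cylGr S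
  d := (cylD S).d
  leibniz := (cylD S).leibniz
  d_d := (isFreeOn_freeGr (cylSrc S) (cylTgt S) (cylDeg S)).d_d (cylD S) fun x m n h h' => by
    subst h'
    obtain rfl := (cylDeg_add_one S x).symm.trans h
    exact cylD_d_gen S x

/-- The first inclusion of `C` into the cylinder. -/
noncomputable def cylI₁ : C ⟶ cylCat S where
  obj := Sum.inl
  toGr := cylIncl₁ S
  map_d := cylD_incl₁ S

/-- The second inclusion of `C` into the cylinder. -/
noncomputable def cylI₂ : C ⟶ cylCat S where
  obj := Sum.inr
  toGr := cylIncl₂ S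
  map_d := cylD_incl₂ S

lemma cylDerivation_eq {A B : C.Obj} {n : ℤ} (θ : C.Hom A B n) :
    tMor S (cylI₁ S) (cylI₂ S) (cylTGen S) θ =
      (cylDerivation S).map (sub_eq_add_neg _ _).symm θ :=
  tMor_eq_of_derivation (i₁ := cylI₁ S) (i₂ := cylI₂ S) (τ := cylDerivation S)
    (cylDerivation_mor S) θ

/-- The morphisms `t_A, t'_A, t̂_A, ť_A, t̄_A, t_f` in the cylinder. -/
noncomputable def cylData : CylinderData S (cylI₁ S) (cylI₂ S) where
  t := cylT S
  t' := cylT' S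
  tHat := cylHat S
  tCheck := cylCheck S
  tBar := cylBar S
  tGen := cylTGen S
  d_t := cylD_t S
  d_t' := cylD_t' S
  d_tHat := cylD_tHat S
  d_tCheck := cylD_tCheck S
  d_tBar := cylD_tBar S
  d_tGen i := by
    rw [cylDerivation_eq]
    exact cylD_tGen S i

/-- The codiagonal on objects. -/
abbrev cylFold {O : Type*} : O ⊕ O → O
  | .inl A => A
  | .inr A => A

/-- The projection of the cylinder on graded categories. -/
noncomputable def cylGrProj : GrCat.FunctorOver (cylGr S) C.toGrCat cylFold :=
  freeLift _ _ fun
    | .inl (.inl i) => S.mor i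
    | .inl (.inr i) => S.mor i
    | .inr (.t A) => C.id A
    | .inr (.t' A) => C.id A
    | .inr (.tHat _) => 0
    | .inr (.tCheck _) => 0
    | .inr (.tBar _) => 0
    | .inr (.tGen _) => 0

/-- A left inverse shows that the inclusion is injective on morphisms. A graded functor suffices, so
the projection is available before the constructed category is known to be a cylinder. -/
lemma cylGrProj_incl₁ {A B : C.Obj} {n : ℤ} (f : C.Hom A B n) :
    (cylGrProj S).map ((cylIncl₁ S).map f) = f := by
  have : (cylIncl₁ S).comp (cylGrProj S) = GrCat.FunctorOver.id C.toGrCat :=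
    S.isFreeOn.functor_ext fun i =>
      (congrArg (cylGrProj S).map (cylIncl₁_mor S i)).trans (freeLift_gen _ _ _ _)
  exact GrCat.FunctorOver.congr_map this f

lemma cylGrProj_incl₂ {A B : C.Obj} {n : ℤ} (f : C.Hom A B n) :
    (cylGrProj S).map ((cylIncl₂ S).map f) = f := by
  have : (cylIncl₂ S).comp (cylGrProj S) = GrCat.FunctorOver.id C.toGrCat :=
    S.isFreeOn.functor_ext fun i =>
      (congrArg (cylGrProj S).map (cylIncl₂_mor S i)).trans (freeLift_gen _ _ _ _)
  exact GrCat.FunctorOver.congr_map this f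

/-- The constructed graded category is free on the generators of both copies and the added ones. A
functor on C ⊔ C is determined by its values on the generators of the copies, so prescribing it
together with φ amounts to prescribing the values ψ. -/
lemma cyl_isFreeExtension : IsFreeExtension (desc (cylI₁ S) (cylI₂ S))
    (CylIndex.src (cylI₁ S) (cylI₂ S)) (CylIndex.tgt (cylI₁ S) (cylI₂ S)) CylIndex.deg
    (CylIndex.mor (cylT S) (cylT' S) (cylHat S) (cylCheck S) (cylBar S) (cylTGen S)) := by
  intro E o G φ
  let ψ : ∀ x, E.Hom (o (cylSrc S x)) (o (cylTgt S x)) (cylDeg S x) := fun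
    | .inl (.inl i) => G.map (A := .inl (S.src i)) (B := .inl (S.tgt i)) (S.mor i)
    | .inl (.inr i) => G.map (A := .inr (S.src i)) (B := .inr (S.tgt i)) (S.mor i)
    | .inr (.t A) => φ (.t A)
    | .inr (.t' A) => φ (.t' A)
    | .inr (.tHat A) => φ (.tHat A)
    | .inr (.tCheck A) => φ (.tCheck A)
    | .inr (.tBar A) => φ (.tBar A)
    | .inr (.tGen i) => φ (.tGen i)
  have h (x) : (freeLift E o ψ).map (cylGen S x) = ψ x := freeLift_gen E o ψ x
  refine ⟨freeLift E o ψ, ⟨?_, ?_⟩, ?_⟩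
  · have h₁ : (cylIncl₁ S).comp (freeLift E o ψ) = (inl C C).toGr.comp G :=
      S.isFreeOn.functor_ext fun i =>
        (congrArg (freeLift E o ψ).map (cylIncl₁_mor S i)).trans (h (.inl (.inl i)))
    have h₂ : (cylIncl₂ S).comp (freeLift E o ψ) = (inr C C).toGr.comp G :=
      S.isFreeOn.functor_ext fun i =>
        (congrArg (freeLift E o ψ).map (cylIncl₂_mor S i)).trans (h (.inl (.inr i)))
    rintro (A | A) (B | B) n f
    · exact GrCat.FunctorOver.congr_map h₁ f
    · exact (map_zero (freeLift E o ψ).map).trans G.map.map_zero.symm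
    · exact (map_zero (freeLift E o ψ).map).trans G.map.map_zero.symm
    · exact GrCat.FunctorOver.congr_map h₂ f
  · rintro (A | A | A | A | A | i)
    exacts [h (.inr (.t A)), h (.inr (.t' A)), h (.inr (.tHat A)), h (.inr (.tCheck A)),
      h (.inr (.tBar A)), h (.inr (.tGen i))]
  · rintro H ⟨h₁, h₂⟩
    refine (isFreeOn_freeGr (cylSrc S) (cylTgt S) (cylDeg S)).functor_ext fun x => ?_
    refine Eq.trans ?_ (h x).symm
    rcases x with (i | i) | A | A | A | A | A | i
    · exact (congrArg H.map (cylIncl₁_mor S i)).symm.trans (h₁ (.inl _) (.inl _) _ (S.mor i))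
    · exact (congrArg H.map (cylIncl₂_mor S i)).symm.trans (h₁ (.inr _) (.inr _) _ (S.mor i))
    exacts [h₂ (.t A), h₂ (.t' A), h₂ (.tHat A), h₂ (.tCheck A), h₂ (.tBar A), h₂ (.tGen i)]

/-- The constructed cylinder is a cylinder. -/
noncomputable def cylCylinder : Cylinder S (cylI₁ S) (cylI₂ S) :=
  { cylData S with
    semifree :=
      { obj_injective := by
          rintro (A | A) (B | B) h
          exacts [h, (by cases h), (by cases h), h]
        map_injective := by
          rintro (A | A) (B | B) n f g h
          · exact (cylGrProj_incl₁ S f).symm.trans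
              ((congrArg (cylGrProj S).map h).trans (cylGrProj_incl₁ S g))
          · rfl
          · rfl
          · exact (cylGrProj_incl₂ S f).symm.trans
              ((congrArg (cylGrProj S).map h).trans (cylGrProj_incl₂ S g))
        isCompl := by
          have : Set.range (desc (cylI₁ S) (cylI₂ S)).obj = Set.univ :=
            Set.range_eq_univ.2 (by
              rintro (A | A)
              exacts [⟨.inl A, rfl⟩, ⟨.inr A, rfl⟩])
          rw [this]
          exact isCompl_top_bot
        free := cyl_isFreeExtension S
        d_mor := ⟨CylIndex.lt S, CylIndex.isWellOrder_lt S, (cylData S).generated_d_mor⟩ } }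

end Construction

end DGCat

/-- A dg functor that is surjective on morphism complexes, with acyclic kernels. -/
structure DGFunctor.IsAcyclicSurjective {k : Type u} [CommRing k] {C : DGCat.{w, v} k}
    {D : DGCat.{w', v'} k} (F : DGFunctor C D) : Prop where
  surjective : ∀ {A B : C.Obj} {n : ℤ} (f : D.Hom (F.obj A) (F.obj B) n), ∃ g, F.map g = f
  acyclic : ∀ {A B : C.Obj} {l m n : ℤ} (hl : l + 1 = m) (hm : m + 1 = n) (f : C.Hom A B m),
    C.d hm f = 0 → F.map f = 0 → ∃ g, F.map g = 0 ∧ C.d hl g = f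

namespace GrCat

variable {k : Type u} [CommRing k]

lemma comp_zero (X : GrCat.{w, v} k) {A B D : X.Obj} {q p n : ℤ} (h : q + p = n)
    (g : X.Hom B D q) : X.comp h g (0 : X.Hom A B p) = 0 := map_zero _

lemma zero_comp (X : GrCat.{w, v} k) {A B D : X.Obj} {q p n : ℤ} (h : q + p = n)
    (f : X.Hom A B p) : X.comp h (0 : X.Hom B D q) f = 0 := LinearMap.map_zero₂ _ _

/-- The derivations s ∘ i₂ and t to be compared start from r ∘ i₂ and i₁, which are equal functors
but not the same expression. -/
lemma IsFreeOn.derivation_congr {C : GrCat.{u, u} k} {I : Type u} {src tgt : I → C.Obj}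
    {deg : I → ℤ} {mor : ∀ i, C.Hom (src i) (tgt i) (deg i)} (hC : C.IsFreeOn mor)
    {X : GrCat.{w', v'} k} {o₁ o₂ : C.Obj → X.Obj} {F₁ F₁' : FunctorOver C X o₁}
    {F₂ F₂' : FunctorOver C X o₂} {e : ℤ} {a b : ℤ → k} {τ : Derivation F₁ F₂ e a b}
    {τ' : Derivation F₁' F₂' e a b} (h₁ : F₁ = F₁') (h₂ : F₂ = F₂')
    (hS : ∀ i {m : ℤ} (h : deg i + e = m), τ.map h (mor i) = τ'.map h (mor i))
    {A B : C.Obj} {n : ℤ} (f : C.Hom A B n) {m : ℤ} (h : n + e = m) :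
    τ.map h f = τ'.map h f := by
  subst h₁ h₂
  exact hC.derivation_ext hS f h

end GrCat

lemma koszul_neg_one (k : Type u) [CommRing k] : koszul k (-1) = -1 := by simp [koszul]

lemma koszul_neg_two (k : Type u) [CommRing k] : koszul k (-2) = 1 := by
  rw [show (-2 : ℤ) = -1 + -1 by norm_num, koszul_add, koszul_neg_one]; norm_num

/-! ### The contracting homotopy: the projection is surjective with acyclic kernels. -/

namespace DGCat

variable {k : Type u} [CommRing k] {C : DGCat.{u, u, u} k} (S : GeneratingSet C)

lemma cylGrProj_t (A : C.Obj) : (cylGrProj S).map (cylT S A) = C.id A := freeLift_gen _ _ _ _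

lemma cylGrProj_t' (A : C.Obj) : (cylGrProj S).map (cylT' S A) = C.id A := freeLift_gen _ _ _ _

lemma cylGrProj_tHat (A : C.Obj) : (cylGrProj S).map (cylHat S A) = 0 := freeLift_gen _ _ _ _

lemma cylGrProj_tCheck (A : C.Obj) : (cylGrProj S).map (cylCheck S A) = 0 := freeLift_gen _ _ _ _

lemma cylGrProj_tBar (A : C.Obj) : (cylGrProj S).map (cylBar S A) = 0 := freeLift_gen _ _ _ _

lemma cylGrProj_tGen (i : S.I) : (cylGrProj S).map (cylTGen S i) = 0 := freeLift_gen _ _ _ _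

/-- The universal property provides some projection, and its graded functor can only be `cylGrProj`.
Extracting just the compatibility with d keeps the object map definitionally equal to `cylFold`. -/
lemma exists_cylP : ∃ h : ∀ {A B : (cylCat S).Obj} {m n : ℤ} (h : m + 1 = n)
    (f : (cylCat S).Hom A B m), (cylGrProj S).map ((cylCat S).d h f) = C.d h ((cylGrProj S).map f),
    (cylCylinder S).IsProjection (⟨cylFold, cylGrProj S, h⟩ : cylCat S ⟶ C) := by
  obtain ⟨⟨o, H, hd⟩, hp⟩ := (cylCylinder S).exists_projection
  obtain rfl : o = cylFold := by
    funext Z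
    rcases Z with A | A
    exacts [congrFun (congrArg DGFunctor.obj hp.comp_i₁) A,
      congrFun (congrArg DGFunctor.obj hp.comp_i₂) A]
  have : H = cylGrProj S := by
    refine (isFreeOn_freeGr (cylSrc S) (cylTgt S) (cylDeg S)).functor_ext fun x => ?_
    refine Eq.trans ?_ (freeLift_gen _ _ _ _).symm
    rcases x with (i | i) | A | A | A | A | A | i
    · exact (congrArg H.map (cylIncl₁_mor S i)).symm.trans
        (eq_of_heq (DGFunctor.map_heq hp.comp_i₁ (S.mor i)))
    · exact (congrArg H.map (cylIncl₂_mor S i)).symm.trans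
        (eq_of_heq (DGFunctor.map_heq hp.comp_i₂ (S.mor i)))
    exacts [GrCat.mor_inj (hp.map_t A), GrCat.mor_inj (hp.map_t' A), hp.map_tHat A,
      hp.map_tCheck A, hp.map_tBar A, hp.map_tGen i]
  subst this
  exact ⟨hd, hp⟩

/-- The projection of the cylinder. -/
noncomputable def cylP : cylCat S ⟶ C := ⟨cylFold, cylGrProj S, (exists_cylP S).choose⟩

lemma isProjection_cylP : (cylCylinder S).IsProjection (cylP S) := (exists_cylP S).choose_spec

lemma cylGrProj_cylDerivation {A B : C.Obj} {n m : ℤ} (h : n + -1 = m) (θ : C.Hom A B n) :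
    (cylGrProj S).map ((cylDerivation S).map h θ) = 0 := by
  refine S.isFreeOn.derivation_ext (τ := (cylDerivation S).postcomp (cylGrProj S))
    (τ' := .zero _ _ _ _ _) (fun i m hm => ?_) θ h
  obtain rfl : S.deg i - 1 = m := by omega
  exact (congrArg (cylGrProj S).map (cylDerivation_mor S i)).trans (cylGrProj_tGen S i)

/-- The closed morphism from the first copy of an object of `C` in the cylinder. -/
noncomputable def cylTrans : ∀ Z : C.Obj ⊕ C.Obj, (cylGr S).Hom (.inl (cylFold Z)) Z 0
  | .inl A => (cylGr S).id (.inl A)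
  | .inr A => cylT S A

/-- The homotopy inverse of `cylTrans`. -/
noncomputable def cylTransInv : ∀ Z : C.Obj ⊕ C.Obj, (cylGr S).Hom Z (.inl (cylFold Z)) 0
  | .inl A => (cylGr S).id (.inl A)
  | .inr A => cylT' S A

/-- The homotopy between the identity and the composite of `cylTransInv` and `cylTrans`. -/
noncomputable def cylTransHomotopy : ∀ Z : C.Obj ⊕ C.Obj, (cylGr S).Hom Z Z (-1)
  | .inl _ => 0
  | .inr A => cylCheck S A

lemma cylD_transInv (Z) {n : ℤ} (h : 0 + 1 = n) : (cylD S).d h (cylTransInv S Z) = 0 := by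
  obtain rfl : 1 = n := by omega
  rcases Z with A | A
  exacts [(cylD S).d_id _ _, cylD_t' S A]

lemma cylD_transHomotopy (Z) : (cylD S).d (neg_add_cancel 1) (cylTransHomotopy S Z) =
    (cylGr S).id Z - (cylGr S).comp (add_zero 0) (cylTrans S Z) (cylTransInv S Z) := by
  rcases Z with A | A
  · exact (map_zero _).trans (sub_eq_zero.2 ((cylGr S).id_comp _ _).symm).symm
  · exact cylD_tCheck S A

lemma cylGrProj_trans (Z) : (cylGrProj S).map (cylTrans S Z) = C.id _ := by
  rcases Z with A | A
  exacts [(cylGrProj S).map_id _, cylGrProj_t S A]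

lemma cylGrProj_transInv (Z) : (cylGrProj S).map (cylTransInv S Z) = C.id _ := by
  rcases Z with A | A
  exacts [(cylGrProj S).map_id _, cylGrProj_t' S A]

lemma cylGrProj_transHomotopy (Z) : (cylGrProj S).map (cylTransHomotopy S Z) = 0 := by
  rcases Z with A | A
  exacts [map_zero _, cylGrProj_tCheck S A]

/-- The retraction of the cylinder onto the first copy of `C`. -/
noncomputable def cylRetr :
    GrCat.FunctorOver (cylGr S) (cylGr S) fun Z => Sum.inl (cylFold Z) :=
  (cylGrProj S).comp (cylIncl₁ S)

lemma cylRetr_incl₁ {A B : C.Obj} {n : ℤ} (f : C.Hom A B n) :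
    (cylRetr S).map ((cylIncl₁ S).map f) = (cylIncl₁ S).map f :=
  congrArg (cylIncl₁ S).map (cylGrProj_incl₁ S f)

lemma cylRetr_incl₂ {A B : C.Obj} {n : ℤ} (f : C.Hom A B n) :
    (cylRetr S).map ((cylIncl₂ S).map f) = (cylIncl₁ S).map f :=
  congrArg (cylIncl₁ S).map (cylGrProj_incl₂ S f)

lemma cylRetr_t (A : C.Obj) : (cylRetr S).map (cylT S A) = (cylGr S).id (.inl A) :=
  (congrArg (cylIncl₁ S).map (cylGrProj_t S A)).trans ((cylIncl₁ S).map_id A)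

lemma cylRetr_t' (A : C.Obj) : (cylRetr S).map (cylT' S A) = (cylGr S).id (.inl A) :=
  (congrArg (cylIncl₁ S).map (cylGrProj_t' S A)).trans ((cylIncl₁ S).map_id A)

lemma cylRetr_eq_zero {A B : C.Obj ⊕ C.Obj} {n : ℤ} {f : (cylGr S).Hom A B n}
    (h : (cylGrProj S).map f = 0) : (cylRetr S).map f = 0 :=
  (congrArg (cylIncl₁ S).map h).trans (cylIncl₁ S).map.map_zero

/-- Degrees of the values of the contracting homotopy on generators. -/
def cylDegPred : (S.I ⊕ S.I) ⊕ CylIndex S → ℤ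
  | .inl (.inl i) => S.deg i - 1
  | .inl (.inr i) => S.deg i - 1
  | .inr (.t _) => -1
  | .inr (.t' _) => -1
  | .inr (.tHat _) => -2
  | .inr (.tCheck _) => -2
  | .inr (.tBar _) => -3
  | .inr (.tGen i) => S.deg i - 1 - 1

lemma cylDeg_add_neg_one (x) : cylDeg S x + -1 = cylDegPred S x := by
  rcases x with (i | i) | A | A | A | A | A | i
  all_goals rfl

/-- The values of the contracting homotopy on generators. -/
noncomputable def cylContrGen : ∀ x : (S.I ⊕ S.I) ⊕ CylIndex S,
    (cylGr S).Hom (.inl (cylFold (cylSrc S x))) (cylTgt S x) (cylDegPred S x)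
  -- The values solve d s(x) = (-1)^{|x|} (xT - T r(x)) + s(dx). For i₂(f) this is the equation of
  -- dt_f; for t' the right side is t't - 1 = -dt̂; for ť it is tt̂ - ťt = dt̄. For the remaining
  -- generators it vanishes.
  | .inl (.inl _) => 0
  | .inl (.inr i) => cylTGen S i
  | .inr (.t _) => 0
  | .inr (.t' A) => -cylHat S A
  | .inr (.tHat _) => 0
  | .inr (.tCheck A) => cylBar S A
  | .inr (.tBar _) => 0
  | .inr (.tGen _) => 0

lemma exists_cylContr : ∃ τ : GrCat.Derivation (cylRetr S)
    (GrCat.FunctorOver.id (cylGr S)) (-1) (fun _ => 1) (koszul k),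
      ∀ x, τ.map (cylDeg_add_neg_one S x) (cylGen S x) = cylContrGen S x :=
  (isFreeOn_freeGr (cylSrc S) (cylTgt S) (cylDeg S)).exists_derivation
    (cylRetr S) (GrCat.FunctorOver.id (cylGr S)) (-1)
    GrCat.isSign_one GrCat.isSign_koszul (cylDegPred S) (cylDeg_add_neg_one S) (cylContrGen S)

/-- The homotopy from the retraction onto `C` to the identity of the cylinder. -/
noncomputable def cylContr : GrCat.Derivation (cylRetr S)
    (GrCat.FunctorOver.id (cylGr S)) (-1) (fun _ => 1) (koszul k) := (exists_cylContr S).choose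

lemma cylContr_gen (x) : (cylContr S).map (cylDeg_add_neg_one S x) (cylGen S x) =
    cylContrGen S x := (exists_cylContr S).choose_spec x

lemma cylContr_t (A : C.Obj) : (cylContr S).map (zero_add (-1)) (cylT S A) = 0 :=
  cylContr_gen S (.inr (.t A))

lemma cylContr_t' (A : C.Obj) : (cylContr S).map (zero_add (-1)) (cylT' S A) = -cylHat S A :=
  cylContr_gen S (.inr (.t' A))

lemma cylContr_tHat (A : C.Obj) :
    (cylContr S).map (show (-1 : ℤ) + -1 = -2 by norm_num) (cylHat S A) = 0 :=
  cylContr_gen S (.inr (.tHat A))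

lemma cylContr_tCheck (A : C.Obj) :
    (cylContr S).map (show (-1 : ℤ) + -1 = -2 by norm_num) (cylCheck S A) = cylBar S A :=
  cylContr_gen S (.inr (.tCheck A))

lemma cylContr_tBar (A : C.Obj) :
    (cylContr S).map (show (-2 : ℤ) + -1 = -3 by norm_num) (cylBar S A) = 0 :=
  cylContr_gen S (.inr (.tBar A))

lemma cylContr_tGen (i : S.I) :
    (cylContr S).map (show S.deg i - 1 + -1 = S.deg i - 1 - 1 by omega) (cylTGen S i) = 0 :=
  cylContr_gen S (.inr (.tGen i))

lemma cylContr_incl₁ {A B : C.Obj} {n m : ℤ} (h : n + -1 = m) (f : C.Hom A B n) :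
    (cylContr S).map h ((cylIncl₁ S).map f) = 0 := by
  refine S.isFreeOn.derivation_ext (τ := (cylContr S).precomp (cylIncl₁ S))
    (τ' := .zero _ _ _ _ _) (fun i m hm => ?_) f h
  obtain rfl : S.deg i - 1 = m := by omega
  exact (congrArg ((cylContr S).map _) (cylIncl₁_mor S i)).trans (cylContr_gen S (.inl (.inl i)))

/-- Since r i₂ = i₁, the restriction of s to the second copy is a derivation from i₁ to i₂; it
agrees with t on generators. -/
lemma cylContr_incl₂ {A B : C.Obj} {n m : ℤ} (h : n + -1 = m) (f : C.Hom A B n) :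
    (cylContr S).map h ((cylIncl₂ S).map f) = (cylDerivation S).map h f := by
  refine S.isFreeOn.derivation_congr (τ := (cylContr S).precomp (cylIncl₂ S))
    (τ' := cylDerivation S) (GrCat.FunctorOver.ext fun A B n f => cylRetr_incl₂ S f) rfl
    (fun i m hm => ?_) f h
  obtain rfl : S.deg i - 1 = m := by omega
  refine Eq.trans ?_ (cylDerivation_mor S i).symm
  exact (congrArg ((cylContr S).map _) (cylIncl₂_mor S i)).trans (cylContr_gen S (.inl (.inr i)))

/-- The vanishing is prescribed for generators. In s(t_{gf}) the two terms not of the form s(t)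
vanish as well, because r(t_f) = 0 and s(i₁f) = 0. -/
lemma cylContr_cylDerivation {A B : C.Obj} {n m l : ℤ} (h : n + -1 = m) (hm : m + -1 = l)
    (f : C.Hom A B n) : (cylContr S).map hm ((cylDerivation S).map h f) = 0 := by
  refine S.isFreeOn.induction (P := fun {A B n} f => ∀ (m l : ℤ) (h : n + -1 = m) (hm : m + -1 = l),
    (cylContr S).map hm ((cylDerivation S).map h f) = 0) ?_ ?_ ?_ ?_ ?_ ?_ f m l h hm
  · intro i m l h hm
    obtain rfl : S.deg i - 1 = m := by omega
    obtain rfl : S.deg i - 1 - 1 = l := by omega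
    exact (congrArg ((cylContr S).map _) (cylDerivation_mor S i)).trans (cylContr_tGen S i)
  · intro A m l h hm
    rw [(cylDerivation S).map_id, map_zero]
  · intro A B n m l h hm
    rw [map_zero, map_zero]
  · intro A B n f g hf hg m l h hm
    rw [map_add, map_add, hf, hg, add_zero]
  · intro A B n c f hf m l h hm
    rw [map_smul, map_smul, hf, smul_zero]
  · intro A B D q p n h' g f hg hf m l h hm
    rw [(cylDerivation S).map_comp h' rfl rfl h (by omega) (by omega), map_add, map_smul, map_smul,
      (cylContr S).map_comp _ rfl rfl hm (by omega) (by omega),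
      (cylContr S).map_comp _ rfl rfl hm (by omega) (by omega), hf _ _ rfl rfl, hg _ _ rfl rfl,
      cylContr_incl₁, cylRetr_eq_zero S (cylGrProj_cylDerivation S _ f)]
    rw [GrCat.comp_zero, GrCat.comp_zero, GrCat.comp_zero, GrCat.zero_comp]
    simp only [smul_zero, add_zero]

lemma cylGrProj_cylContr {A B : C.Obj ⊕ C.Obj} {n m : ℤ} (h : n + -1 = m)
    (f : (cylGr S).Hom A B n) : (cylGrProj S).map ((cylContr S).map h f) = 0 := by
  refine (isFreeOn_freeGr (cylSrc S) (cylTgt S) (cylDeg S)).derivation_ext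
    (τ := (cylContr S).postcomp (cylGrProj S)) (τ' := .zero _ _ _ _ _) (fun x m hm => ?_) f h
  obtain rfl : cylDegPred S x = m := (cylDeg_add_neg_one S x).symm.trans hm
  refine (congrArg (cylGrProj S).map (cylContr_gen S x)).trans ?_
  rcases x with (i | i) | A | A | A | A | A | i
  · exact map_zero _
  · exact cylGrProj_tGen S i
  · exact map_zero _
  · exact (map_neg (cylGrProj S).map _).trans (neg_eq_zero.2 (cylGrProj_tHat S A))
  · exact map_zero _
  · exact cylGrProj_tBar S A
  · exact map_zero _
  · exact map_zero _

/-- The contracting homotopy satisfies its defining equation at `f`. -/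
def IsContracted {A B : C.Obj ⊕ C.Obj} {n : ℤ} (f : (cylGr S).Hom A B n) : Prop :=
  ∀ {m l n' : ℤ} (hm : n + -1 = m) (hl : n + 1 = l) (hmn : m + 1 = n') (hln : l + -1 = n')
    (hn : n + 0 = n') (hn' : 0 + n = n'),
    (cylD S).d hmn ((cylContr S).map hm f) = koszul k n •
      ((cylGr S).comp hn f (cylTrans S A) -
        (cylGr S).comp hn' (cylTrans S B) ((cylRetr S).map f)) +
      (cylContr S).map hln ((cylD S).d hl f)

/-- This separates the ingredients of the homotopy equation, so that each generator is handled by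
listing its values in literal degrees. -/
lemma isContracted_of_eq {A B : C.Obj ⊕ C.Obj} {n m l : ℤ} {f : (cylGr S).Hom A B n}
    (hm : n + -1 = m) (hl : n + 1 = l) (hmn : m + 1 = n) (hln : l + -1 = n)
    (w : (cylGr S).Hom (.inl (cylFold A)) B m) (hw : (cylContr S).map hm f = w)
    (w' x y z : (cylGr S).Hom (.inl (cylFold A)) B n) (hw' : (cylD S).d hmn w = w')
    (hx : (cylGr S).comp (add_zero n) f (cylTrans S A) = x)
    (hy : (cylGr S).comp (zero_add n) (cylTrans S B) ((cylRetr S).map f) = y)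
    (v : (cylGr S).Hom A B l) (hv : (cylD S).d hl f = v) (hz : (cylContr S).map hln v = z)
    (h : w' = koszul k n • (x - y) + z) : IsContracted S f := by
  intro m' l' n' hm' hl' hmn' hln' hn hn'
  obtain rfl : m = m' := by omega
  obtain rfl : l = l' := by omega
  obtain rfl : n = n' := by omega
  subst hw hw' hx hy hv hz
  exact h

lemma isContracted_incl₁ {A B : C.Obj} {n : ℤ} (f : C.Hom A B n) :
    IsContracted S ((cylIncl₁ S).map f) :=
  isContracted_of_eq S rfl rfl (by omega) (by omega) 0 (cylContr_incl₁ S _ f) 0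
    ((cylIncl₁ S).map f) ((cylIncl₁ S).map f) 0 (map_zero _) ((cylGr S).comp_id _ _)
    ((congrArg _ (cylRetr_incl₁ S f)).trans ((cylGr S).id_comp _ _))
    ((cylIncl₁ S).map (C.d rfl f)) (cylD_incl₁ S rfl f).symm (cylContr_incl₁ S _ _)
    (by rw [sub_self, smul_zero, add_zero])

lemma isContracted_incl₂ {A B : C.Obj} {n : ℤ} (f : C.Hom A B n) :
    IsContracted S ((cylIncl₂ S).map f) :=
  isContracted_of_eq S rfl rfl (by omega) (by omega) _ (cylContr_incl₂ S _ f) _ _ _ _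
    rfl rfl (congrArg _ (cylRetr_incl₂ S f)) ((cylIncl₂ S).map (C.d rfl f))
    (cylD_incl₂ S rfl f).symm (cylContr_incl₂ S _ _)
    (cylD_cylDerivation S f rfl rfl (by omega) (by omega) (by omega) (by omega))

lemma isContracted_t (A : C.Obj) : IsContracted S (cylT S A) :=
  isContracted_of_eq S (A := .inl A) (B := .inr A) (zero_add (-1)) (zero_add 1) (neg_add_cancel 1) (by omega) 0
    (cylContr_t S A) 0 (cylT S A) (cylT S A) 0 (map_zero _) ((cylGr S).comp_id _ _)
    ((congrArg _ (cylRetr_t S A)).trans ((cylGr S).comp_id _ _)) 0 (cylD_t S A) (map_zero _)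
    (by rw [sub_self, smul_zero, add_zero])

lemma isContracted_t' (A : C.Obj) : IsContracted S (cylT' S A) :=
  isContracted_of_eq S (A := .inr A) (B := .inl A) (zero_add (-1)) (zero_add 1) (neg_add_cancel 1) (by omega) (-cylHat S A)
    (cylContr_t' S A) _ _ ((cylGr S).id (.inl A)) 0
    ((map_neg ((cylD S).d _) _).trans (congrArg Neg.neg (cylD_tHat S A))) rfl
    ((congrArg _ (cylRetr_t' S A)).trans ((cylGr S).comp_id _ _)) 0 (cylD_t' S A) (map_zero _)
    (by rw [koszul_zero, one_smul, add_zero, neg_sub]; rfl)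

/-- Here s(dt̂) = -s(t't) = -s(t') r(t) = t̂, which cancels the term (-1)^{-1} t̂. -/
lemma isContracted_tHat (A : C.Obj) : IsContracted S (cylHat S A) := by
  refine isContracted_of_eq S (A := .inl A) (B := .inl A) (show (-1 : ℤ) + -1 = -2 by norm_num) (neg_add_cancel 1)
    (by norm_num) (by norm_num) 0 (cylContr_tHat S A) 0 (cylHat S A) 0 (cylHat S A)
    (map_zero _) ((cylGr S).comp_id _ _) ?_ _ (cylD_tHat S A) ?_ ?_
  · exact (congrArg _ (cylRetr_eq_zero S (cylGrProj_tHat S A))).trans (GrCat.comp_zero _ _ _)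
  · rw [map_sub, (cylContr S).map_id, zero_sub, (cylContr S).map_comp _ (zero_add (-1))
      (zero_add (-1)) _ (zero_add (-1)) (add_zero (-1)), cylContr_t, cylContr_t', cylRetr_t]
    rw [GrCat.comp_zero, smul_zero, zero_add, koszul_zero, one_smul, (cylGr S).comp_id, neg_neg]
  · rw [koszul_neg_one]
    simp

/-- Here s(dť) = -s(tt') = -t s(t') = tt̂, and T contributes -ťt; their sum is dt̄ = d s(ť). -/
lemma isContracted_tCheck (A : C.Obj) : IsContracted S (cylCheck S A) := by
  refine isContracted_of_eq S (A := .inr A) (B := .inr A) (show (-1 : ℤ) + -1 = -2 by norm_num) (neg_add_cancel 1)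
    (by norm_num) (by norm_num) (cylBar S A) (cylContr_tCheck S A) _
    ((cylGr S).comp (add_zero (-1)) (cylCheck S A) (cylT S A)) 0
    ((cylGr S).comp (zero_add (-1)) (cylT S A) (cylHat S A))
    (cylD_tBar S A) rfl ?_ _ (cylD_tCheck S A) ?_ ?_
  · exact (congrArg _ (cylRetr_eq_zero S (cylGrProj_tCheck S A))).trans (GrCat.comp_zero _ _ _)
  · rw [map_sub, (cylContr S).map_id, zero_sub, (cylContr S).map_comp _ (zero_add (-1))
      (zero_add (-1)) _ (zero_add (-1)) (add_zero (-1)), cylContr_t, cylContr_t', cylRetr_t']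
    rw [one_smul, GrCat.zero_comp, smul_zero, add_zero]
    exact (congrArg Neg.neg (map_neg _ _)).trans (neg_neg _)
  · rw [koszul_neg_one]
    rw [neg_smul, one_smul, sub_zero]
    exact (neg_add_eq_sub _ _).symm

/-- In s(tt̂ - ťt) only -s(ť) r(t) = -t̄ survives, so the homotopy closes up without a further
generator. -/
lemma isContracted_tBar (A : C.Obj) : IsContracted S (cylBar S A) := by
  refine isContracted_of_eq S (A := .inl A) (B := .inr A) (show (-2 : ℤ) + -1 = -3 by norm_num)
    (show (-2 : ℤ) + 1 = -1 by norm_num) (by norm_num) (by norm_num) 0 (cylContr_tBar S A) 0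
    (cylBar S A) 0 (-cylBar S A)
    (map_zero _) ((cylGr S).comp_id _ _) ?_ _ (cylD_tBar S A) ?_ ?_
  · exact (congrArg _ (cylRetr_eq_zero S (cylGrProj_tBar S A))).trans (GrCat.comp_zero _ _ _)
  · rw [map_sub, (cylContr S).map_comp _ (zero_add (-1))
      (show (-1 : ℤ) + -1 = -2 by norm_num) _ (by norm_num) (by norm_num),
      (cylContr S).map_comp _ (show (-1 : ℤ) + -1 = -2 by norm_num) (zero_add (-1)) _
      (by norm_num) (by norm_num), cylContr_t, cylContr_tHat, cylContr_tCheck, cylRetr_t]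
    rw [GrCat.comp_zero, GrCat.zero_comp, GrCat.comp_zero, koszul_zero, (cylGr S).comp_id]
    simp only [smul_zero, add_zero, one_smul, zero_add, zero_sub]
  · rw [koszul_neg_two]
    simp

/-- Of s(dt_f), only (-1)^{|f|} s(i₂f) r(t) = (-1)^{|f|} t_f survives, and it cancels the term
(-1)^{|f|-1} t_f. -/
lemma isContracted_tGen (i : S.I) : IsContracted S (cylTGen S i) := by
  refine isContracted_of_eq S (A := .inl (S.src i)) (B := .inr (S.tgt i)) (show S.deg i - 1 + -1 = S.deg i - 1 - 1 by omega)
    (show S.deg i - 1 + 1 = S.deg i + 1 - 1 by omega) (by omega) (by omega) 0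
    (cylContr_tGen S i) 0 (cylTGen S i) 0 (koszul k (S.deg i) • cylTGen S i)
    (map_zero _) ((cylGr S).comp_id _ _) ?_ _ (cylD_tGen S i) ?_ ?_
  · exact (congrArg _ (cylRetr_eq_zero S (cylGrProj_tGen S i))).trans (GrCat.comp_zero _ _ _)
  · rw [map_add, map_smul, map_sub, cylContr_cylDerivation,
      (cylContr S).map_comp _ (show S.deg i + -1 = S.deg i - 1 by omega) (zero_add (-1)) _
      (by omega) (by omega),
      (cylContr S).map_comp _ (zero_add (-1)) (show S.deg i + -1 = S.deg i - 1 by omega) _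
      (by omega) (by omega), cylContr_t, cylContr_incl₁, cylContr_incl₂, cylDerivation_mor]
    rw [cylContr_t, cylRetr_t, GrCat.comp_zero, GrCat.comp_zero, GrCat.zero_comp, koszul_zero,
      (cylGr S).comp_id]
    simp only [smul_zero, add_zero, one_smul, zero_add, sub_zero]
  · rw [koszul_sub, koszul_one]
    simp

lemma isContracted {A B : C.Obj ⊕ C.Obj} {n : ℤ} (f : (cylGr S).Hom A B n) :
    IsContracted S f := by
  intro m l n' hm hl hmn hln hn hn'
  refine (isFreeOn_freeGr (cylSrc S) (cylTgt S) (cylDeg S)).d_homotopy (cylD S) (cylD S)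
    (F₁ := cylRetr S) (F₂ := GrCat.FunctorOver.id (cylGr S)) ?_ ?_ (cylTrans S) (cylContr S) ?_
    f hm hl hmn hln hn hn'
  · intro A B n m h f
    refine Eq.trans ?_ (cylD_incl₁ S h ((cylGrProj S).map f))
    exact congrArg (cylIncl₁ S).map ((cylP S).map_d h f)
  · intro A B n m h f
    rfl
  rintro ((i | i) | A | A | A | A | A | i)
  · intro m l n' hm hl hmn hln hn hn'
    have := isContracted_incl₁ S (S.mor i) hm hl hmn hln hn hn'
    rw [cylIncl₁_mor] at this
    exact this
  · intro m l n' hm hl hmn hln hn hn'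
    have := isContracted_incl₂ S (S.mor i) hm hl hmn hln hn hn'
    rw [cylIncl₂_mor] at this
    exact this
  exacts [isContracted_t S A, isContracted_t' S A, isContracted_tHat S A,
    isContracted_tCheck S A, isContracted_tBar S A, isContracted_tGen S i]

/-- The copy of f between the objects of the first copy is conjugated by T and its homotopy inverse,
both of which p sends to identities. -/
lemma cylGrProj_surjective {A B : C.Obj ⊕ C.Obj} {n : ℤ} (f : C.Hom (cylFold A) (cylFold B) n) :
    ∃ g : (cylGr S).Hom A B n, (cylGrProj S).map g = f := by
  refine ⟨(cylGr S).comp (zero_add n) (cylTrans S B) ((cylGr S).comp (add_zero n)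
    ((cylIncl₁ S).map f) (cylTransInv S A)), ?_⟩
  rw [(cylGrProj S).map_comp, (cylGrProj S).map_comp, cylGrProj_trans, cylGrProj_transInv,
    cylGrProj_incl₁, C.id_comp, C.comp_id]

/-- Since r(f) = 0 and df = 0, contraction gives d s(f) = (-1)^{|f|} f T. With T' closed and dh = 1
- TT', the boundary of s(f) T' + f h is (-1)^{|f|} (f TT' + f (1 - TT')) = (-1)^{|f|} f. Both
summands lie in the kernel of p. -/
lemma exists_cylD_eq {A B : C.Obj ⊕ C.Obj} {l m n : ℤ} (hl : l + 1 = m) (hm : m + 1 = n)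
    (f : (cylGr S).Hom A B m) (hf : (cylD S).d hm f = 0) (hpf : (cylGrProj S).map f = 0) :
    ∃ g, (cylGrProj S).map g = 0 ∧ (cylD S).d hl g = f := by
  have h₁ := isContracted S f (show m + -1 = l by omega) hm hl (by omega) (add_zero m)
    (zero_add m)
  rw [hf, cylRetr_eq_zero S hpf, GrCat.comp_zero, sub_zero, map_zero, add_zero] at h₁
  refine ⟨koszul k m • ((cylGr S).comp (add_zero l)
    ((cylContr S).map (show m + -1 = l by omega) f) (cylTransInv S A) +
      (cylGr S).comp (show m + -1 = l by omega) f (cylTransHomotopy S A)), ?_, ?_⟩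
  · rw [map_smul, map_add, (cylGrProj S).map_comp, (cylGrProj S).map_comp,
      cylGrProj_cylContr, cylGrProj_transHomotopy, GrCat.zero_comp, GrCat.comp_zero, add_zero,
      smul_zero]
  · rw [map_smul, map_add, (cylD S).leibniz _ hl (zero_add 1) _ (add_zero m) (by omega),
      (cylD S).leibniz _ hm (neg_add_cancel 1) _ (by omega) (add_zero m),
      cylD_transInv, cylD_transHomotopy, hf, h₁, GrCat.comp_zero, GrCat.zero_comp, smul_zero,
      add_zero, zero_add, map_sub, (cylGr S).comp_id, map_smul, LinearMap.smul_apply,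
      (cylGr S).assoc _ (add_zero 0) _ (add_zero m), ← smul_add, smul_smul, koszul_mul_self,
      one_smul, add_sub_cancel]

lemma isAcyclicSurjective_cylP : (cylP S).IsAcyclicSurjective :=
  ⟨cylGrProj_surjective S, exists_cylD_eq S⟩

end DGCat

/-! ### Stability of acyclic surjections, and passage to an arbitrary cylinder. -/

namespace DGFunctor

variable {k : Type u} [CommRing k]

lemma exists_mor_eq {C : GrCat.{w, v} k} {A B A' B' : C.Obj} (hA : A' = A) (hB : B' = B) {n : ℤ}
    (f : C.Hom A' B' n) : ∃ g : C.Hom A B n, C.mor g = C.mor f := by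
  subst hA hB
  exact ⟨f, rfl⟩

lemma IsAcyclicSurjective.comp {C : DGCat.{w, v} k} {D : DGCat.{w', v'} k}
    {E : DGCat.{w'', v''} k} {F : DGFunctor C D} {G : DGFunctor D E}
    (hF : F.IsAcyclicSurjective) (hG : G.IsAcyclicSurjective) :
    (F.comp G).IsAcyclicSurjective where
  surjective f := by
    obtain ⟨g, rfl⟩ := hG.surjective f
    obtain ⟨h, rfl⟩ := hF.surjective g
    exact ⟨h, rfl⟩
  acyclic {A B l m n} hl hm f hf hGF := by
    obtain ⟨g, hg₀, hg⟩ := hG.acyclic hl hm (F.map f)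
      (by rw [← F.map_d, hf, map_zero]) hGF
    obtain ⟨h, rfl⟩ := hF.surjective g
    -- Here h lifts a morphism g in the kernel of G with dg = F(f). Subtracting dh moves f into the
    -- kernel of F, where acyclicity applies again.
    have h₁ : C.d hm (f - C.d hl h) = 0 := by rw [map_sub, hf, C.d_d, sub_zero]
    have h₂ : F.map (f - C.d hl h) = 0 := by
      rw [DGFunctor.map, map_sub, F.map_d, hg, sub_self]
    obtain ⟨x, hx₀, hx⟩ := hF.acyclic hl hm _ h₁ h₂
    refine ⟨h + x, ?_, by rw [map_add, hx, add_sub_cancel]⟩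
    change G.map (F.map (h + x)) = 0
    rw [DGFunctor.map, DGFunctor.map, map_add, show F.toGr.map x = 0 from hx₀, add_zero]
    exact hg₀

/-- The inverse matches objects only up to propositional equality, so the argument takes place in
`Mor`, where no transport is needed. -/
lemma IsAcyclicSurjective.of_isIso {C D : DGCat.{w, v} k} (F : C ⟶ D) [IsIso F] :
    DGFunctor.IsAcyclicSurjective F := by
  have h₁ : ∀ {A B : C.Obj} {n : ℤ} (f : C.Hom A B n), (inv F).mapMor (F.mapMor (C.mor f)) =
      C.mor f := fun f =>
    congrArg (fun H : C ⟶ C => H.mapMor (C.mor f)) (IsIso.hom_inv_id F)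
  have h₂ : ∀ f, F.mapMor ((inv F).mapMor f) = f := fun f =>
    congrArg (fun H : D ⟶ D => H.mapMor f) (IsIso.inv_hom_id F)
  have ho (A) : (inv F).obj (F.obj A) = A :=
    congrFun (congrArg DGFunctor.obj (IsIso.hom_inv_id F)) A
  refine ⟨fun f => ?_, fun hl hm f _ hf => ⟨0, map_zero _, ?_⟩⟩
  · obtain ⟨g, hg⟩ := exists_mor_eq (ho _) (ho _) ((inv F).map f)
    exact ⟨g, GrCat.mor_inj ((congrArg F.mapMor hg).trans (h₂ (D.mor f)))⟩
  · rw [map_zero]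
    refine GrCat.mor_inj (Eq.trans ?_ (h₁ f))
    refine Eq.trans ?_ (congrArg (fun x => (inv F).mapMor (D.mor x)) hf).symm
    refine (h₁ 0).symm.trans ?_
    exact congrArg (fun x => (inv F).mapMor (D.mor x)) (map_zero _)

end DGFunctor

namespace DGCat.Cylinder

variable {k : Type u} [CommRing k] {C X : DGCat.{u, u, u} k} {S : GeneratingSet C}
  {i₁ i₂ : C ⟶ X} {P : Cylinder S i₁ i₂}

/-- The maps over the identity of C between X and the constructed cylinder are mutually inverse by
uniqueness, and compatible with the projections by naturality. -/
lemma IsProjection.isAcyclicSurjective {p : X ⟶ C} (hp : P.IsProjection p) :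
    DGFunctor.IsAcyclicSurjective p := by
  obtain ⟨G, hG⟩ := P.exists_map (cylCylinder S) (𝟙 C)
  obtain ⟨G', hG'⟩ := (cylCylinder S).exists_map P (𝟙 C)
  have : IsIso G := ⟨G', (hG.comp hG').unique P.isMap_id,
    (hG'.comp hG).unique (cylCylinder S).isMap_id⟩
  have h : G ≫ cylP S = p := hG.comp_projection hp (isProjection_cylP S)
  rw [← h]
  exact (DGFunctor.IsAcyclicSurjective.of_isIso G).comp (isAcyclicSurjective_cylP S)

end DGCat.Cylinder

/-! ### Acyclic surjections on twisted objects, and the weak equivalences. -/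

namespace DGCat

variable {k : Type u} [CommRing k]

lemma homotopyEquivalent_refl (C : DGCat.{w, v} k) (A : C.Obj) : C.HomotopyEquivalent A A := by
  have h : C.IsHomotopyRetraction (C.id A) (C.id A) :=
    ⟨C.d_id A _, C.d_id A _, 0, by rw [map_zero, C.id_comp, sub_self]⟩
  exact ⟨_, _, h, h⟩

/-- The long exact sequence argument, done with elements: lifts of bounding or closed morphisms are
corrected by elements of the acyclic kernel. -/
lemma _root_.DGFunctor.IsAcyclicSurjective.isQuasiEquivalence {C : DGCat.{w, v} k}
    {D : DGCat.{w', v'} k} {F : DGFunctor C D} (hF : F.IsAcyclicSurjective)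
    (h : Function.Surjective F.obj) : F.IsQuasiEquivalence where
  injective A B l m n hl hm f hf := by
    rintro ⟨g, hg⟩
    obtain ⟨g, rfl⟩ := hF.surjective g
    obtain ⟨x, -, hx⟩ := hF.acyclic hl hm (f - C.d hl g) (by rw [map_sub, hf, C.d_d, sub_zero])
      (by rw [DGFunctor.map, map_sub, F.map_d, hg, sub_self])
    exact ⟨g + x, by rw [map_add, hx, add_sub_cancel]⟩
  surjective A B l m n hl hm f hf := by
    obtain ⟨g, rfl⟩ := hF.surjective f
    obtain ⟨x, hx₀, hx⟩ := hF.acyclic hm rfl (C.d hm g) (C.d_d _ _ _) (by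
      rw [DGFunctor.map, F.map_d, hf])
    refine ⟨g - x, by rw [map_sub, hx, sub_self], 0, ?_⟩
    rw [map_zero, DGFunctor.map, map_sub, show F.toGr.map x = 0 from hx₀, sub_zero, sub_self]
  essSurj B := by
    obtain ⟨A, rfl⟩ := h B
    exact ⟨A, homotopyEquivalent_refl D _⟩

namespace FormalSum

variable {C : DGCat.{w, v} k} {D : DGCat.{w', v'} k}

lemma compCol_apply_congr {Y Z : C.FormalSum} {q p n : ℤ} (h : q + p = n) (A : C.Obj) (r : ℤ)
    {g g' : Hom Y Z q} (f : Π₀ j : Y.I, C.Hom A (Y.X j) (p + Y.r j - r)) (l : Z.I)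
    (hg : ∀ j, f j ≠ 0 → g j l = g' j l) : compCol h A r g f l = compCol h A r g' f l := by
  classical
  have (f : Π₀ j : Y.I, C.Hom A (Y.X j) (p + Y.r j - r)) (j) (hg : f j ≠ 0 → g j l = g' j l) :
      compCol h A r g (DFinsupp.single j (f j)) l =
        compCol h A r g' (DFinsupp.single j (f j)) l := by
    by_cases hj : f j = 0
    · rw [hj, DFinsupp.single_zero, map_zero, map_zero]
    · rw [compCol_single, compCol_single, hg hj]
  rw [← DFinsupp.sum_single (f := f), DFinsupp.sum, map_sum, map_sum, DFinsupp.finsetSum_apply,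
    DFinsupp.finsetSum_apply]
  exact Finset.sum_congr rfl fun j _ => this f j (hg j)

lemma compCol_congr {Y Z : C.FormalSum} {q p n : ℤ} (h : q + p = n) (A : C.Obj) (r : ℤ)
    {g g' : Hom Y Z q} (f : Π₀ j : Y.I, C.Hom A (Y.X j) (p + Y.r j - r))
    (hg : ∀ j, f j ≠ 0 → g j = g' j) : compCol h A r g f = compCol h A r g' f :=
  DFinsupp.ext fun l => compCol_apply_congr h A r f l fun j hj => by rw [hg j hj]

lemma zero_compCol {Y Z : C.FormalSum} {q p n : ℤ} (h : q + p = n) (A : C.Obj) (r : ℤ)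
    (f : Π₀ j : Y.I, C.Hom A (Y.X j) (p + Y.r j - r)) : compCol h A r (0 : Hom Y Z q) f = 0 := by
  classical
  have : compCol h A r (0 : Hom Y Z q) = 0 := by
    apply DFinsupp.lhom_ext
    intro j x
    ext l
    rw [compCol_single]
    exact LinearMap.map_zero₂ _ _
  rw [this, LinearMap.zero_apply]

/-- The differential of the complex of morphisms from a shift of `A` to a twisted object. -/
noncomputable def twCol {Y : C.FormalSum} (ε : Hom Y Y 1) {m n : ℤ} (h : m + 1 = n) (A : C.Obj)
    (r : ℤ) : (Π₀ j : Y.I, C.Hom A (Y.X j) (m + Y.r j - r)) →ₗ[k]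
      Π₀ j : Y.I, C.Hom A (Y.X j) (n + Y.r j - r) :=
  dCol Y h A r + compCol (show 1 + m = n by omega) A r ε

/-- The operator d + ε squares to dε + ε² = 0. A column is treated as a matrix out of a formal sum
with a single summand, so that the Leibniz rule and associativity for matrices apply. -/
lemma twCol_twCol {Y : C.FormalSum} {ε : Hom Y Y 1}
    (hε : d one_add_one_eq_two ε + comp one_add_one_eq_two ε ε = 0) {l m n : ℤ} (h : l + 1 = m)
    (h' : m + 1 = n) (A : C.Obj) (r : ℤ) (f) : twCol ε h' A r (twCol ε h A r f) = 0 := by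
  let X : C.FormalSum := ⟨PUnit, fun _ => A, fun _ => r⟩
  let f' : Hom X Y l := fun _ => f
  suffices d h' (d h f' + comp (show 1 + l = m by omega) ε f') +
      comp (show 1 + m = n by omega) ε (d h f' + comp (show 1 + l = m by omega) ε f') = 0 from
    congrFun this PUnit.unit
  rw [map_add, map_add, d_d, zero_add,
    leibniz (show 1 + l = m by omega) one_add_one_eq_two h h' (show 2 + l = n by omega) (by omega),
    ← assoc one_add_one_eq_two (show 1 + l = m by omega) (show 2 + l = n by omega),
    eq_neg_of_add_eq_zero_left hε, koszul_one, map_neg, LinearMap.neg_apply, neg_smul, one_smul]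
  abel

lemma mapCol_single (F : DGFunctor C D) (Y : C.FormalSum) [DecidableEq Y.I] (A : C.Obj)
    (n r : ℤ) (j : Y.I) (x : C.Hom A (Y.X j) (n + Y.r j - r)) :
    mapCol F Y A n r (DFinsupp.single j x) = DFinsupp.single j (F.map x) := by
  rw [mapCol, DFinsupp.mapRange.linearMap_apply, DFinsupp.mapRange_single]

/-- A top entry of f is closed for the untwisted differential, hence a boundary inside the kernel of
F. Subtracting the twisted boundary of a primitive removes this entry and changes only finitely many
lower ones. As Y may have infinitely many summands of unbounded depth, termination comes from the
well-foundedness of `Relation.CutExpand` on finite multisets. -/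
lemma exists_twCol_eq {F : DGFunctor C D} (hF : F.IsAcyclicSurjective) {Y : C.FormalSum}
    {ε : Hom Y Y 1} (hε : d one_add_one_eq_two ε + comp one_add_one_eq_two ε ε = 0)
    (hY : WellFounded fun j i : Y.I => ε i j ≠ 0) {l m n : ℤ} (hl : l + 1 = m) (hm : m + 1 = n)
    (A : C.Obj) (r : ℤ) (f : Π₀ j : Y.I, C.Hom A (Y.X j) (m + Y.r j - r))
    (hf : twCol ε hm A r f = 0) (hFf : mapCol F Y A m r f = 0) :
    ∃ g, mapCol F Y A l r g = 0 ∧ twCol ε hl A r g = f := by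
  classical
  set R : Y.I → Y.I → Prop := fun j i => ε i j ≠ 0 with hR
  have : IsWellFounded _ R := ⟨hY⟩
  suffices ∀ (s : Multiset Y.I) (f : Π₀ j : Y.I, C.Hom A (Y.X j) (m + Y.r j - r)),
      (∀ i, f i ≠ 0 → i ∈ s) → twCol ε hm A r f = 0 → mapCol F Y A m r f = 0 →
      ∃ g, mapCol F Y A l r g = 0 ∧ twCol ε hl A r g = f from
    this f.support.val f (fun i hi => (DFinsupp.mem_support_iff).2 hi) hf hFf
  clear f hf hFf
  intro s
  induction s using (WellFounded.cutExpand hY).induction with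
  | _ s ih =>
  intro f hs hf hFf
  by_cases hf₀ : f = 0
  · exact ⟨0, map_zero _, (map_zero _).trans hf₀.symm⟩
  -- At an entry of maximal rank in the support, no other entry of the support contributes through
  -- ε.
  obtain ⟨j, hj, hmax⟩ := f.support.exists_max_image (IsWellFounded.rank R)
    (Finset.nonempty_iff_ne_empty.2 (mt DFinsupp.support_eq_empty.1 hf₀))
  rw [DFinsupp.mem_support_iff] at hj
  have h₁ (i) (hi : f i ≠ 0) : ε i j = 0 := by
    by_contra h
    exact (IsWellFounded.rank_lt_of_rel (r := R) h).not_ge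
      (hmax i (DFinsupp.mem_support_iff.2 hi))
  have h₂ : C.d (show m + Y.r j - r + 1 = n + Y.r j - r by omega) (f j) = 0 := by
    have := DFunLike.congr_fun hf j
    rw [twCol, LinearMap.add_apply, DFinsupp.add_apply, dCol_apply,
      compCol_apply_congr _ A r (g' := 0) f j h₁, zero_compCol] at this
    have := congrArg (koszul k (Y.r j) • ·) this
    simpa [smul_smul, koszul_mul_self] using this
  have h₃ : F.map (f j) = 0 := by
    rw [← mapCol_apply F Y A m r f j, hFf, DFinsupp.zero_apply]
  obtain ⟨x, hx₀, hx⟩ := hF.acyclic (show l + Y.r j - r + 1 = m + Y.r j - r by omega) _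
    (f j) h₂ h₃
  -- The sign compensates the one in `dCol`, so that the j-th entry of the untwisted differential of
  -- y is f j.
  set y : Π₀ j : Y.I, C.Hom A (Y.X j) (l + Y.r j - r) :=
    DFinsupp.single j (koszul k (Y.r j) • x) with hy
  have hFy : mapCol F Y A l r y = 0 := by
    rw [hy, mapCol_single, DGFunctor.map, map_smul, show F.toGr.map x = 0 from hx₀, smul_zero,
      DFinsupp.single_zero]
  have hFy' : mapCol F Y A m r (twCol ε hl A r y) = 0 := by
    rw [twCol, LinearMap.add_apply, map_add, mapCol_dCol, mapCol_compCol, hFy]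
    exact (congrArg₂ (· + ·) (map_zero _) (map_zero _)).trans (add_zero _)
  have hsupp (i) (hi : (f - twCol ε hl A r y) i ≠ 0) :
      i ∈ s.erase j + (ε j : Π₀ _, _).support.val := by
    revert hi
    rw [Multiset.mem_add, DFinsupp.sub_apply, twCol, LinearMap.add_apply, DFinsupp.add_apply,
      dCol_apply, hy, compCol_single]
    contrapose!
    rintro ⟨hi, hi'⟩
    have hδ : ε j i = 0 := by
      by_contra h
      exact hi' (DFinsupp.mem_support_iff.2 h)
    rw [hδ, GrCat.zero_comp, add_zero]
    by_cases hij : j = i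
    · subst hij
      rw [DFinsupp.single_eq_same, map_smul, smul_smul, koszul_mul_self, one_smul, hx, sub_self]
    · rw [DFinsupp.single_eq_of_ne (Ne.symm hij), map_zero, smul_zero, sub_zero]
      by_contra h
      exact hi ((Multiset.mem_erase_of_ne (Ne.symm hij)).2 (hs i h))
  -- One copy of j is replaced by the finitely many summands hit by ε from j, all of which are
  -- smaller than j.
  obtain ⟨g, hg₀, hg⟩ := ih (s.erase j + (ε j : Π₀ _, _).support.val) (by
      refine ⟨(ε j : Π₀ _, _).support.val, j, fun i hi => DFinsupp.mem_support_iff.1 hi, ?_⟩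
      rw [add_right_comm, add_comm (s.erase j), Multiset.singleton_add,
        Multiset.cons_erase (hs j hj)])
    (f - twCol ε hl A r y) hsupp
    (by rw [map_sub, hf, twCol_twCol hε, sub_zero]) (by rw [map_sub, hFf, hFy', sub_zero])
  exact ⟨y + g, by rw [map_add, hFy, hg₀, add_zero], by rw [map_add, hg, add_sub_cancel]⟩

/-- The twisted differential of a matrix. -/
noncomputable def twD {X Y : C.FormalSum} (δ : Hom X X 1) (ε : Hom Y Y 1) {m n : ℤ}
    (h : m + 1 = n) (f : Hom X Y m) : Hom X Y n := fun i =>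
  twCol ε h (X.X i) (X.r i) (f i) - koszul k m • compCol h (X.X i) (X.r i) f (δ i)

/-- The equation for the i-th column of g involves, through δ, only columns of smaller index, so g
is built by well-founded recursion over the summands of X. Each column equation is solved by
`exists_twCol_eq`. -/
lemma exists_twD_eq {F : DGFunctor C D} (hF : F.IsAcyclicSurjective) {X Y : C.FormalSum}
    {δ : Hom X X 1} {ε : Hom Y Y 1}
    (hδ : d one_add_one_eq_two δ + comp one_add_one_eq_two δ δ = 0)
    (hε : d one_add_one_eq_two ε + comp one_add_one_eq_two ε ε = 0)
    (hX : WellFounded fun j i : X.I => δ i j ≠ 0) (hY : WellFounded fun j i : Y.I => ε i j ≠ 0)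
    {l m n : ℤ} (hl : l + 1 = m) (hm : m + 1 = n) (f : Hom X Y m) (hf : twD δ ε hm f = 0)
    (hFf : mapHom F f = 0) : ∃ g : Hom X Y l, mapHom F g = 0 ∧ twD δ ε hl g = f := by
  classical
  have twD_twD (g : Hom X Y l) : twD δ ε hm (twD δ ε hl g) = 0 :=
    TwistedObj.d_d (A := C.mat) (X := ⟨X, δ, hδ⟩) (Y := ⟨Y, ε, hε⟩) hl hm g
  -- The default value 0 makes the recursion total before solvability is known; the induction below
  -- shows that a solution always exists.
  let next (i : X.I) (g : Hom X Y l) : Π₀ j : Y.I, C.Hom (X.X i) (Y.X j) (l + Y.r j - X.r i) :=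
    if h : ∃ y, mapCol F Y (X.X i) l (X.r i) y = 0 ∧ twCol ε hl (X.X i) (X.r i) y =
        f i + koszul k l • compCol hl (X.X i) (X.r i) g (δ i) then h.choose else 0
  let g : Hom X Y l := hX.fix fun i g =>
    next i fun j => if h : δ i j ≠ 0 then g j h else 0
  have hg (i) : g i = next i fun j => if δ i j ≠ 0 then g j else 0 := by
    refine (hX.fix_eq _ i).trans ?_
    simp only [dite_eq_ite, g]
  suffices ∀ i, mapCol F Y (X.X i) l (X.r i) (g i) = 0 ∧ twD δ ε hl g i = f i from
    ⟨g, funext fun i => (this i).1, funext fun i => (this i).2⟩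
  intro i
  induction i using hX.induction with
  | _ i ih =>
  have e : compCol hl (X.X i) (X.r i) (fun j => if δ i j ≠ 0 then g j else 0) (δ i) =
      compCol hl (X.X i) (X.r i) g (δ i) :=
    compCol_congr _ _ _ _ fun j hj => if_pos hj
  have h₁ : mapCol F Y (X.X i) m (X.r i)
      (f i + koszul k l • compCol hl (X.X i) (X.r i) g (δ i)) = 0 := by
    rw [map_add, map_smul, mapCol_compCol, compCol_congr _ _ _ _ (g' := 0), zero_compCol,
      smul_zero, add_zero]
    · exact congrFun hFf i
    · intro j hj
      refine (ih j fun h => hj ?_).1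
      rw [mapCol_apply, h]
      exact map_zero _
  -- The right side of the column equation is closed: the i-th columns of the twisted differentials
  -- of f and of the twisted differential of g both vanish, and these two matrices agree on all
  -- columns below i.
  have h₂ : twCol ε hm (X.X i) (X.r i)
      (f i + koszul k l • compCol hl (X.X i) (X.r i) g (δ i)) = 0 := by
    have hu := congrFun (twD_twD g) i
    have hf' := congrFun hf i
    rw [twD, compCol_congr hm _ _ (δ i) fun j hj => (ih j hj).2] at hu
    rw [twD] at hf'
    have := hf'.trans hu.symm
    rw [sub_left_inj, twD, map_sub, twCol_twCol hε, zero_sub] at this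
    rw [map_add, this, neg_add_cancel]
  obtain h := exists_twCol_eq hF hε hY hl hm (X.X i) (X.r i) _ h₂ h₁
  have hgi : mapCol F Y (X.X i) l (X.r i) (g i) = 0 ∧ twCol ε hl (X.X i) (X.r i) (g i) =
      f i + koszul k l • compCol hl (X.X i) (X.r i) g (δ i) := by
    rw [← e] at h ⊢
    rw [hg i]
    simp only [next]
    rw [dif_pos h]
    exact h.choose_spec
  exact ⟨hgi.1, by rw [twD, hgi.2, add_sub_cancel_right]⟩

/-- Entries are lifted one at a time by a set-theoretic section that preserves 0, so that the lifted
columns keep finite support. -/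
lemma mapHom_surjective {F : DGFunctor C D} (hF : F.IsAcyclicSurjective) {X Y : C.FormalSum}
    {n : ℤ} (f : Hom (mapObj F X) (mapObj F Y) n) : ∃ g : Hom X Y n, mapHom F g = f := by
  classical
  have (A B : C.Obj) (n : ℤ) : ∃ σ : D.Hom (F.obj A) (F.obj B) n → C.Hom A B n,
      σ 0 = 0 ∧ ∀ f, F.map (σ f) = f := by
    refine ⟨fun f => if f = 0 then 0 else (hF.surjective f).choose, if_pos rfl, fun f => ?_⟩
    by_cases h : f = 0
    · subst h
      exact (congrArg F.map (if_pos rfl)).trans (map_zero _)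
    · exact (congrArg F.map (if_neg h)).trans (hF.surjective f).choose_spec
  choose σ hσ₀ hσ using this
  refine ⟨fun i => DFinsupp.mapRange (fun j => σ _ _ _) (fun j => hσ₀ _ _ _) (f i), ?_⟩
  funext i
  refine DFinsupp.ext fun j => (mapCol_apply F Y _ n _ _ j).trans ?_
  exact hσ (X.X i) (Y.X j) (n + Y.r j - X.r i) (f i j)

lemma mapHom_mapHom (F : DGFunctor C D) (G : DGFunctor D C) {X Y : D.FormalSum} {n : ℤ}
    (f : Hom X Y n) : mapHom F (mapHom G f) = mapHom (G.comp F) f := by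
  refine funext fun (i : X.I) => DFinsupp.ext fun (j : Y.I) => ?_
  refine (mapCol_apply F (mapObj G Y) (G.obj (X.X i)) n (X.r i) _ j).trans ?_
  refine (congrArg F.map (mapCol_apply G Y (X.X i) n (X.r i) _ j)).trans ?_
  exact (mapCol_apply (G.comp F) Y (X.X i) n (X.r i) _ j).symm

lemma mapHom_id_functor {X Y : D.FormalSum} {n : ℤ} (f : Hom X Y n) :
    mapHom (DGFunctor.id D) f = f := by
  refine funext fun (i : X.I) => DFinsupp.ext fun (j : Y.I) => ?_
  exact mapCol_apply (DGFunctor.id D) Y (X.X i) n (X.r i) _ j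

end FormalSum

section

variable {C : DGCat.{w, v} k} {D : DGCat.{w', v'} k} {F : DGFunctor C D}

/-- A dg functor that is surjective on morphism complexes with acyclic kernels induces such a dg
functor on one-sided twisted objects. -/
lemma isAcyclicSurjective_fullMap (hF : F.IsAcyclicSurjective) {P : C.mat.twist.Obj → Prop}
    {Q : D.mat.twist.Obj → Prop} (h : ∀ X, P X → Q ((twistMap (matMap F)).obj X))
    (hP : ∀ X, P X → IsOneSided X) :
    (fullMap (twistMap (matMap F)) P Q h).IsAcyclicSurjective where
  surjective f := FormalSum.mapHom_surjective hF f
  acyclic {X Y _ _ _} hl hm f hf hFf :=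
    FormalSum.exists_twD_eq hF X.1.mc Y.1.mc (hP _ X.2) (hP _ Y.2) hl hm f hf hFf

/-- Functoriality of twisted objects turns a section of F into a strict section on objects, so no
lifting of Maurer–Cartan elements is needed for essential surjectivity. -/
lemma twistedObj_map_map {F : DGFunctor C D} {G : DGFunctor D C} (h : G.comp F = DGFunctor.id D)
    (X : D.mat.twist.Obj) :
    (twistMap (matMap F)).obj ((twistMap (matMap G)).obj X) = X := by
  have h₁ : (twistMap (matMap F)).obj ((twistMap (matMap G)).obj X) =
      (twistMap (matMap (G.comp F))).obj X :=
    TwistedObj.mk.congr_simp _ _ _ (FormalSum.mapHom_mapHom F G X.δ) _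
  have h₂ : (twistMap (matMap (DGFunctor.id D))).obj X = X :=
    TwistedObj.mk.congr_simp _ _ _ (FormalSum.mapHom_id_functor X.δ) _
  rw [h₁, h, h₂]

lemma isQuasiEquivalence_twMap (hF : F.IsAcyclicSurjective) {G : DGFunctor D C}
    (h : G.comp F = DGFunctor.id D) : (TwMap F).IsQuasiEquivalence :=
  (isAcyclicSurjective_fullMap hF (isTw_map F) fun _ hX => hX.2).isQuasiEquivalence
    fun X => ⟨(TwMap G).obj X, Subtype.ext (twistedObj_map_map h X.1)⟩

lemma isQuasiEquivalence_perfMap (hF : F.IsAcyclicSurjective) {G : DGFunctor D C}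
    (h : G.comp F = DGFunctor.id D) : (PerfMap F).IsQuasiEquivalence :=
  (isAcyclicSurjective_fullMap hF (isPerf_map F) fun _ hX => hX.1).isQuasiEquivalence
    fun X => ⟨(PerfMap G).obj X, Subtype.ext (twistedObj_map_map h X.1)⟩

end

lemma ModelStructure.weakEquivalences_of_isAcyclicSurjective {C D : DGCat.{u, u, u} k} {F : C ⟶ D}
    (hF : DGFunctor.IsAcyclicSurjective F) {G : D ⟶ C} (h : G ≫ F = 𝟙 D) (M : ModelStructure) :
    M.weakEquivalences k F := by
  cases M
  · exact hF.isQuasiEquivalence fun A => ⟨G.obj A, congrFun (congrArg DGFunctor.obj h) A⟩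
  · exact isQuasiEquivalence_twMap hF h
  · exact isQuasiEquivalence_perfMap hF h

end DGCat

/-! ### Lifting against semifree extensions, and the fibrations. -/

namespace DGCat

variable {k : Type u} [CommRing k]

lemma IsFreeExtension.generated {C D : DGCat.{u, u, u} k} {F : C ⟶ D} {I : Type u}
    {src tgt : I → D.Obj} {deg : I → ℤ} {mor : ∀ i, D.Hom (src i) (tgt i) (deg i)}
    (h : IsFreeExtension F src tgt deg mor) {A B : D.Obj} {n : ℤ} (f : D.Hom A B n) :
    D.Generated ({x | ∃ (A B : C.Obj) (n : ℤ) (f : C.Hom A B n), x = D.mor (F.map f)} ∪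
      Set.range fun i => D.mor (mor i)) f := by
  set T := {x | ∃ (A B : C.Obj) (n : ℤ) (f : C.Hom A B n), x = D.mor (F.map f)} ∪
      Set.range fun i => D.mor (mor i) with hT
  let G : GrCat.FunctorOver C.toGrCat (D.generatedSub T) fun A => F.obj A :=
    { map := fun {A B n} => F.toGr.map.codRestrict (D.generatedSubmodule T _ _ _)
        fun f => .of _ (.inl ⟨_, _, _, f, rfl⟩)
      map_id := fun A => Subtype.ext (F.toGr.map_id A)
      map_comp := fun h g f => Subtype.ext (F.toGr.map_comp h g f) }
  obtain ⟨r, ⟨hr, hr'⟩, -⟩ := h (D.generatedSub T) (fun A => A) G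
    (fun i => ⟨mor i, .of _ (.inr ⟨i, rfl⟩)⟩)
  have e : r.comp (D.generatedSubIncl T) = GrCat.FunctorOver.id D.toGrCat := by
    refine (h D.toGrCat (fun A => A) F.toGr mor).unique ⟨fun A B n f => ?_, fun i => ?_⟩
      ⟨fun A B n f => rfl, fun i => rfl⟩
    · rw [GrCat.FunctorOver.comp_map, hr]
      rfl
    · rw [GrCat.FunctorOver.comp_map, hr']
      rfl
  have h' : (r.comp (D.generatedSubIncl T)).map f = f := by
    rw [e]
    rfl
  rw [← h']
  exact (r.map f).2

/-- The images of the generators are chosen along the well-ordering. If y is any lift of V(f_i), the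
difference between dy and the value already determined on df_i is closed and in the kernel of p,
hence dx with p(x) = 0, and y - x is a correct image of f_i. -/
lemma IsSemifreeExtensionBy.exists_lift {A B X Y : DGCat.{u, u, u} k} {F : A ⟶ B} {R : Set B.Obj}
    {I : Type u} {src tgt : I → B.Obj} {deg : I → ℤ} {mor : ∀ i, B.Hom (src i) (tgt i) (deg i)}
    (hF : IsSemifreeExtensionBy F R src tgt deg mor) {p : X ⟶ Y}
    (hp : DGFunctor.IsAcyclicSurjective p) (o : B.Obj → X.Obj)
    (U : GrCat.FunctorOver A.toGrCat X.toGrCat fun a => o (F.obj a))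
    (hU : ∀ {a b : A.Obj} {m n : ℤ} (h : m + 1 = n) (f : A.Hom a b m),
      U.map (A.d h f) = X.d h (U.map f))
    (V : GrCat.FunctorOver B.toGrCat Y.toGrCat fun b => p.obj (o b))
    (hV : ∀ {a b : B.Obj} {m n : ℤ} (h : m + 1 = n) (f : B.Hom a b m),
      V.map (B.d h f) = Y.d h (V.map f))
    (hUV : ∀ {a b : A.Obj} {n : ℤ} (f : A.Hom a b n), p.map (U.map f) = V.map (F.map f)) :
    ∃ H : GrCat.FunctorOver B.toGrCat X.toGrCat o,
      (∀ {a b : A.Obj} {n : ℤ} (f : A.Hom a b n), H.map (F.map f) = U.map f) ∧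
      (∀ {a b : B.Obj} {n : ℤ} (f : B.Hom a b n), p.map (H.map f) = V.map f) ∧
      ∀ {a b : B.Obj} {m n : ℤ} (h : m + 1 = n) (f : B.Hom a b m),
        H.map (B.d h f) = X.d h (H.map f) := by
  classical
  obtain ⟨lt, hlt, hd⟩ := hF.d_mor
  have wf : WellFounded lt := hlt.toIsWellFounded.wf
  choose H hH using fun φ : ∀ i, X.Hom (o (src i)) (o (tgt i)) (deg i) =>
    (hF.free X.toGrCat o U φ).exists
  -- The functor `H φ` needs a value on every generator, so values not yet chosen are set to 0; this
  -- is harmless because df_i involves only earlier generators. If no suitable x exists, the default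
  -- is also 0, a case excluded by `key`.
  let next (i : I) (φ : ∀ i, X.Hom (o (src i)) (o (tgt i)) (deg i)) :
      X.Hom (o (src i)) (o (tgt i)) (deg i) :=
    if h : ∃ x, p.map x = V.map (mor i) ∧ X.d rfl x = (H φ).map (B.d rfl (mor i)) then h.choose
    else 0
  let φ (i : I) : X.Hom (o (src i)) (o (tgt i)) (deg i) := wf.fix
    (fun i φ => next i fun j => if h : lt j i then φ j h else 0) i
  have hφ (i) : φ i = next i fun j => if lt j i then φ j else 0 := by
    refine (wf.fix_eq _ i).trans ?_
    simp only [dite_eq_ite, φ]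
  have hmap_d {a b : A.Obj} {n m : ℤ} (hm : n + 1 = m) (f : A.Hom a b n) :
      (H φ).map (B.d hm (F.map f)) = X.d hm ((H φ).map (F.map f)) := by
    rw [(hH φ).1, ← hU]
    exact (congrArg (H φ).map (F.map_d hm f).symm).trans ((hH φ).1 _ _ _ _)
  have key (i) : p.map (φ i) = V.map (mor i) ∧ X.d rfl (φ i) = (H φ).map (B.d rfl (mor i)) := by
    induction i using wf.induction with
    | _ i ih =>
    -- The truncated and the full choice of values give the same functor on the subcategory
    -- containing df_i.
    have e : (H fun j => if lt j i then φ j else 0).map (B.d rfl (mor i)) =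
        (H φ).map (B.d rfl (mor i)) := by
      refine GrCat.FunctorOver.eq_of_generated ?_ (hd i)
      rintro a b n f (⟨a, b, n, f, h⟩ | ⟨j, hj, h⟩)
      · cases h
        rw [(hH _).1, (hH _).1]
      · cases h
        rw [(hH _).2, (hH _).2, if_pos hj]
    have h₁ : p.map ((H φ).map (B.d rfl (mor i))) = V.map (B.d rfl (mor i)) := by
      refine GrCat.FunctorOver.eq_of_generated (F := (H φ).comp p.toGr) ?_ (hd i)
      rintro a b n f (⟨a, b, n, f, h⟩ | ⟨j, hj, h⟩)
      · cases h
        exact (congrArg p.map ((hH φ).1 _ _ _ _)).trans (hUV f)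
      · cases h
        exact (congrArg p.map ((hH φ).2 j)).trans (ih j hj).1
    have h₂ : X.d rfl ((H φ).map (B.d rfl (mor i))) = 0 := by
      refine ((H φ).map_d_of_generated B.differential X.differential ?_ (hd i) rfl).symm.trans
        ((congrArg (H φ).map (B.d_d rfl rfl (mor i))).trans (map_zero _))
      rintro a b n f (⟨a, b, n, f, h⟩ | ⟨j, hj, h⟩) m hm
      · cases h
        exact hmap_d hm f
      · cases h
        subst hm
        exact ((congrArg (X.d rfl) ((hH φ).2 j)).trans (ih j hj).2).symm
    obtain ⟨y, hy⟩ := hp.surjective (V.map (mor i))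
    obtain ⟨x, hx₀, hx⟩ := hp.acyclic rfl rfl (X.d rfl y - (H φ).map (B.d rfl (mor i)))
      (by rw [map_sub, X.d_d, h₂, sub_zero])
      (by rw [DGFunctor.map, map_sub, p.map_d]; exact sub_eq_zero.2
            ((congrArg _ hy).trans ((hV _ _).symm.trans h₁.symm)))
    have h : ∃ x, p.map x = V.map (mor i) ∧ X.d rfl x = (H φ).map (B.d rfl (mor i)) := by
      refine ⟨y - x, ?_, by rw [map_sub, hx, sub_sub_cancel]⟩
      rw [DGFunctor.map, map_sub, show p.toGr.map x = 0 from hx₀, sub_zero]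
      exact hy
    rw [← e] at h ⊢
    rw [hφ i]
    simp only [next]
    rw [dif_pos h]
    exact h.choose_spec
  refine ⟨H φ, (hH φ).1 _ _ _, fun f => ?_, fun h f => ?_⟩
  · refine GrCat.FunctorOver.eq_of_generated (F := (H φ).comp p.toGr) ?_ (hF.free.generated f)
    rintro a b n f (⟨a, b, n, f, h⟩ | ⟨j, h⟩)
    · cases h
      exact (congrArg p.map ((hH φ).1 _ _ _ _)).trans (hUV f)
    · cases h
      exact (congrArg p.map ((hH φ).2 j)).trans (key j).1
  · refine (H φ).map_d_of_generated B.differential X.differential ?_ (hF.free.generated f) h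
    rintro a b n f (⟨a, b, n, f, h⟩ | ⟨j, h⟩) m hm
    · cases h
      exact hmap_d hm f
    · cases h
      subst hm
      exact ((congrArg (X.d rfl) ((hH φ).2 j)).trans (key j).2).symm

/-- Surjective acyclic dg functors have the right lifting property with respect to semifree
extensions. -/
lemma rlp_semifreeExtensions {X Y : DGCat.{u, u, u} k} {p : X ⟶ Y}
    (hp : DGFunctor.IsAcyclicSurjective p) (hobj : Function.Surjective p.obj) :
    (semifreeExtensions k).rlp p := by
  classical
  rintro A B F ⟨R, I, src, tgt, deg, mor, hF⟩
  refine ⟨fun {u v} sq => ?_⟩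
  have hsq (a) : p.obj (u.obj a) = v.obj (F.obj a) := congrFun (congrArg DGFunctor.obj sq.w) a
  choose s hs using hobj
  obtain ⟨o, ho₁, ho₂⟩ : ∃ o : B.Obj → X.Obj, u.obj = (fun a => o (F.obj a)) ∧
      v.obj = fun b => p.obj (o b) := by
    -- Objects of B outside the image of F are free to be sent to any preimage under p; on the
    -- image, injectivity of F on objects forces the value of u.
    refine ⟨fun b => if h : ∃ a, F.obj a = b then u.obj h.choose else s (v.obj b),
      ?_, ?_⟩
    · funext a
      have h : ∃ a', F.obj a' = F.obj a := ⟨a, rfl⟩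
      simp only
      rw [dif_pos h, hF.obj_injective h.choose_spec]
    · funext b
      by_cases h : ∃ a, F.obj a = b
      · exact (congrArg p.obj (dif_pos h)).trans ((hsq _).trans (congrArg v.obj h.choose_spec))
          |>.symm
      · exact ((congrArg p.obj (dif_neg h)).trans (hs _)).symm
  obtain ⟨uo, U, hU⟩ := u
  obtain ⟨vo, V, hV⟩ := v
  dsimp only at ho₁ ho₂
  subst ho₁ ho₂
  obtain ⟨H, hH₁, hH₂, hH₃⟩ := hF.exists_lift hp o U hU V hV
    fun f => eq_of_heq (DGFunctor.map_heq sq.w f)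
  refine ⟨⟨⟨⟨o, H, hH₃⟩, ?_, ?_⟩⟩⟩
  · have : F.toGr.comp H = U := GrCat.FunctorOver.ext fun A B n f => hH₁ f
    subst this
    rfl
  · have : H.comp p.toGr = V := GrCat.FunctorOver.ext fun A B n f => hH₂ f
    subst this
    rfl

/-- Lifting against semifree extensions passes to their retracts, and the acyclic cofibrations of
each structure are among these. -/
lemma ModelStructure.fibrations_of_isAcyclicSurjective {X Y : DGCat.{u, u, u} k} {p : X ⟶ Y}
    (hp : DGFunctor.IsAcyclicSurjective p) (hobj : Function.Surjective p.obj)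
    (M : ModelStructure) : M.fibrations k p := by
  refine MorphismProperty.antitone_rlp inf_le_left _ ?_
  rw [cofibrations, MorphismProperty.rlp_retracts]
  exact rlp_semifreeExtensions hp hobj

end DGCat

/-! ### Dg functors out of a coproduct, and the final assembly. -/

namespace DGCat

variable {k : Type u} [CommRing k]

/-- Between the two parts of a coproduct there are only zero morphisms, so the restrictions to the
parts determine the functor. -/
lemma desc_ext {C D E : DGCat.{w, v} k} {F G : coprod C D ⟶ E} (h₁ : inl C D ≫ F = inl C D ≫ G)
    (h₂ : inr C D ≫ F = inr C D ≫ G) : F = G := by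
  obtain ⟨o, F, hF⟩ := F
  obtain ⟨o', G, hG⟩ := G
  have ho : o = o' := by
    funext A
    rcases A with A | A
    · exact congrFun (congrArg DGFunctor.obj h₁) A
    · exact congrFun (congrArg DGFunctor.obj h₂) A
  subst ho
  have hFG {A B} {n : ℤ} (f : (coprod C D).Hom A B n) (hf : f = 0) : F.map f = G.map f := by
    rw [hf, map_zero, map_zero]
  have : F = G := GrCat.FunctorOver.ext fun A B n f => by
    rcases A with A | A <;> rcases B with B | B
    · exact eq_of_heq (DGFunctor.map_heq h₁ (A := A) (B := B) f)
    · exact hFG f (Subsingleton.elim (α := PUnit) _ _)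
    · exact hFG f (Subsingleton.elim (α := PUnit) _ _)
    · exact eq_of_heq (DGFunctor.map_heq h₂ (A := A) (B := B) f)
  subst this
  rfl

lemma desc_comp {C D E E' : DGCat.{w, v} k} (F : C ⟶ E) (G : D ⟶ E) (H : E ⟶ E') :
    desc F G ≫ H = desc (F ≫ H) (G ≫ H) := desc_ext rfl rfl

lemma coprodMap_desc {C D C' D' E : DGCat.{w, v} k} (F : C ⟶ C') (G : D ⟶ D') (F' : C' ⟶ E)
    (G' : D' ⟶ E) : coprodMap F G ≫ desc F' G' = desc (F ≫ F') (G ≫ G') := desc_ext rfl rfl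

end DGCat

theorem mainTheorem1 (k : Type u) [CommRing k] :
    -- the cylinder of a semifree dg category exists
    (∀ (C : DGCat.{u, u, u} k) (S : DGCat.GeneratingSet C),
      ∃ (X : DGCat.{u, u, u} k) (i₁ i₂ : C ⟶ X), Nonempty (DGCat.Cylinder S i₁ i₂)) ∧
    -- for any choice of generating morphisms and of cylinders of all semifree dg categories
    ∀ (S : ∀ C : DGCat.Semifree k, DGCat.GeneratingSet C.obj)
      (Cyl : DGCat.Semifree k → DGCat.{u, u, u} k) (i₁ i₂ : ∀ C, C.obj ⟶ Cyl C)
      (P : ∀ C, DGCat.Cylinder (S C) (i₁ C) (i₂ C)),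
    ∃ (semifree : ∀ C, DGCat.IsSemifree (Cyl C))
      (map : ∀ C D : DGCat.Semifree k,
        (C ⟶ D) → ((⟨Cyl C, semifree C⟩ : DGCat.Semifree k) ⟶ ⟨Cyl D, semifree D⟩))
      (map_id : ∀ C, map C C (𝟙 C) = 𝟙 _)
      (map_comp : ∀ C D E (F : C ⟶ D) (G : D ⟶ E), map C E (F ≫ G) = map C D F ≫ map D E G)
      (p : ∀ C, Cyl C ⟶ C.obj),
      -- `map C D F` is the unique dg functor `Cyl(F)`, and `p C` is the unique projection
      (∀ (C D : DGCat.Semifree k) (F : C ⟶ D) (G : Cyl C ⟶ Cyl D),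
        (P C).IsMap (P D) F.hom G ↔ G = (map C D F).hom) ∧
      (∀ C (q : Cyl C ⟶ C.obj), (P C).IsProjection q ↔ q = p C) ∧
      (∀ C, DGCat.semifreeExtensions k (DGCat.desc (i₁ C) (i₂ C))) ∧
      -- `Cyl` is a cylinder functor for all three model structures
      ∀ M : DGCat.ModelStructure, DGCat.IsCylinderFunctor M
        { obj := fun C => ⟨Cyl C, semifree C⟩
          map := fun {C D} F => map C D F
          map_id := map_id
          map_comp := fun {C D E} F G => map_comp C D E F G }
        (fun C => DGCat.desc (i₁ C) (i₂ C)) p := by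
  refine ⟨fun C S => ⟨_, _, _, ⟨DGCat.cylCylinder S⟩⟩, fun S Cyl i₁ i₂ P => ?_⟩
  choose map hmap using fun (C D : DGCat.Semifree k) (F : C ⟶ D) => (P C).exists_map (P D) F.hom
  choose p hp using fun C => (P C).exists_projection
  have hsemifree (C) : DGCat.semifreeExtensions k (DGCat.desc (i₁ C) (i₂ C)) :=
    ⟨_, _, _, _, _, _, (P C).semifree⟩
  refine ⟨fun C => (P C).isSemifree, fun C D F => ObjectProperty.homMk (map C D F), fun C => ?_,
    fun C D E F G => ?_, p, fun C D F G => ⟨fun h => h.unique (hmap C D F), ?_⟩,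
    fun C q => ⟨fun h => h.unique (hp C), ?_⟩, hsemifree, fun M => ?_⟩
  · exact ObjectProperty.hom_ext _ ((hmap C C (𝟙 C)).unique (P C).isMap_id)
  · exact ObjectProperty.hom_ext _ ((hmap C E (F ≫ G)).unique ((hmap C D F).comp (hmap D E G)))
  · rintro rfl
    exact hmap C D F
  · rintro rfl
    exact hp C
  · refine ⟨fun C => MorphismProperty.le_retracts _ _ (hsemifree C), fun C => ?_, fun C => ?_,
      fun {C D} F => ?_, fun {C D} F => (hmap C D F).comp_projection (hp C) (hp D)⟩
    · have h := (hp C).isAcyclicSurjective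
      -- The identity i₁ ≫ p = 𝟙 serves twice: for surjectivity on objects, and as the section that
      -- makes Tw p and Perf p surjective on objects.
      exact ⟨M.fibrations_of_isAcyclicSurjective h
        fun A => ⟨(i₁ C).obj A, congrFun (congrArg DGFunctor.obj (hp C).comp_i₁) A⟩,
        M.weakEquivalences_of_isAcyclicSurjective h (hp C).comp_i₁⟩
    · rw [DGCat.desc_comp, (hp C).comp_i₁, (hp C).comp_i₂]
      rfl
    · rw [DGCat.coprodMap_desc, DGCat.desc_comp]
      exact congrArg₂ _ (hmap C D F).comp_i₁ (hmap C D F).comp_i₂
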